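/- **Conventions.** Nested harmonic sums are $S_\emptyset(N)=1$ and $S_{a,\mathbf b}(N)=\sum_{n=1}^N \frac{(\operatorname{sign}a)^n}{n^{|a|}}S_{\mathbf b}(n)$ for non-zero integers $a$. All quantities below are formal power series in the coupling $h$ (perturbation theory). For a root $u$ let $x^\pm+1/x^\pm=\frac1h\left(u\pm\frac i2\right)$ with $x^\pm\sim\frac1h(u\pm\frac i2)$ as $h\to0$. The twist-2 all-loop asymptotic Bethe equations of ABJM for $u_1,\dots,u_N\in\mathbb C[[h]]$ are $$\left(\frac{x_k^+}{x_k^-}\right)^2=-\prod_{j\ne k}\frac{x_k^--x_j^+}{x_k^+-x_j^-}\,\frac{1-\frac1{x_k^+x_j^-}}{1-\frac1{x_k^-x_j^+}}\,\sigma_{\rm BES}^2(u_k,u_j),\qquad k=1,\dots,N,$$ where $\sigma_{\rm BES}^2=e^{2i\theta}$ is the Beisert–Eden–Staudacher dressing factor in its weak-coupling expansion. Explicitly, with $q_r(u)=\frac{i}{r-1}\left((hx^+)^{1-r}-(hx^-)^{1-r}\right)$, one has $\theta(u,w)=\sum_{r\ge2}\sum_{\nu\ge0}\sum_{\mu\ge\nu}h^{2r+2\nu+2\mu}\beta_{r,\nu,\mu}\left(q_r(u)q_{r+1+2\nu}(w)-q_{r+1+2\nu}(u)q_r(w)\right)$,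 where $\beta_{r,\nu,\mu}=2(-1)^{r+\mu+1}\frac{(r-1)(r+2\nu)}{2\mu+1}\binom{2\mu+1}{\mu-r-\nu+1}\binom{2\mu+1}{\mu-\nu}\zeta(2\mu+1)$, a binomial with negative lower entry being $0$. With $e^{ip_k}=x_k^+/x_k^-$, the asymptotic anomalous dimension is $$\gamma^{\rm ABA}(h)=\sum_{k=1}^N\left[\sqrt{1+16h^2\sin^2\tfrac{p_k}{2}}-1\right],$$ and $\gamma_4^{\rm ABA}(N)$ denotes its coefficient of $h^4$. A *ground state* of even spin $N$ is a solution of the Bethe equations such that $Q(u)=\prod_k(u-u_k|_{h=0})$ satisfies the leading order Baxter equation $\mathcal B_NQ=0$, where $$(\mathcal B_NQ)(u)=\left(u+\tfrac i2\right)^2Q(u+i)-\left(u-\tfrac i2\right)^2Q(u-i)-i(2N+2)\,u\,Q(u).$$ **Theorem.** Let $N\ge0$ be even. A ground state of spin $N$ exists, and for every ground state of spin $N$ $$\gamma_4^{\rm ABA}(N)=16S_{-3}+16S_3-8S_{-2,-1}-8S_{-2,1}-16S_{-1,-2}-16S_{-1,2}-16S_{1,-2}-16S_{1,2}-8S_{2,-1}-8S_{2,1},$$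 all sums having argument $N$. Moreover there is a constant $c$, independent of $h$ and $u$, such that the Baxter polynomial expands as $c\prod_k(u-u_k(h))=Q^{(0)}(u)+h^2Q^{(1)}(u)+O(h^3)$. Here, with $$F(a,b;d)={}_3F_2\left(-\tfrac N2,a,b;1,d;1\right),\qquad s_\pm=\tfrac12\pm iu,$$ one has $Q^{(0)}(u)=F(s_+,s_-;1)$ and $$\begin{aligned}Q^{(1)}(u)=\Big[&-3S_1(N/2)\,\partial_\alpha\big(F(s_++\alpha,s_-;1)+F(s_+,s_-+\alpha;1)\big)\\&-\partial_\alpha\partial_\beta\big(F(s_++\alpha,s_-;1+\beta)+F(s_+,s_-+\alpha;1+\beta)\big)-\partial_\alpha^2F(s_++\alpha,s_-+\alpha;1)\Big]_{\alpha=\beta=0}.\end{aligned}$$ Furthermore $Q^{(1)}$ solves the next-to-leading order Baxter equation $$\begin{aligned}(\mathcal B_NQ^{(1)})(u)=&-2i\,S_1(N/2)\left[\left(u+\tfrac i2\right)Q^{(0)}(u+i)+\left(u-\tfrac i2\right)Q^{(0)}(u-i)-2u\,Q^{(0)}(u)\right]\\&+2\left[Q^{(0)}(u+i)-Q^{(0)}(u-i)\right].\end{aligned}$$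 Finally, the above combination of harmonic sums, regarded as a function $\gamma_4$ of an arbitrary non-negative integer argument, satisfies $\gamma_4(2n+1)=\gamma_4(2n)$ for all $n\in\mathbb N$. -/

import Mathlib

noncomputable section

namespace ABJM

open PowerSeries Finset

/-! ### Nested harmonic sums -/

/-- The nested (signed) harmonic sums: `S_{a, b, …}(N) = ∑_{n=1}^N (sign a)^n / n^{|a|} S_{b, …}(n)`,
with the empty sum `S_∅ = 1`. -/
def harmonicSum : List ℤ → ℕ → ℚ
  | [], _ => 1
  | a :: l, N => ∑ n ∈ Finset.Icc 1 N, ((a.sign : ℚ) ^ n / (n : ℚ) ^ a.natAbs) * harmonicSum l n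

/-- The combination of harmonic sums of transcendentality three giving the four-loop twist-2
asymptotic anomalous dimension. -/
def gammaFour (N : ℕ) : ℚ :=
  16 * harmonicSum [-3] N + 16 * harmonicSum [3] N
    - 8 * harmonicSum [-2, -1] N - 8 * harmonicSum [-2, 1] N
    - 16 * harmonicSum [-1, -2] N - 16 * harmonicSum [-1, 2] N
    - 16 * harmonicSum [1, -2] N - 16 * harmonicSum [1, 2] N
    - 8 * harmonicSum [2, -1] N - 8 * harmonicSum [2, 1] N

/-! ### The perturbative asymptotic Bethe Ansatz

All quantities are formal power series in the coupling `h`, which is `X : PowerSeries ℂ`. -/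

/-- The square root with constant coefficient `1` of a power series with constant coefficient `1`,
`√a = ∑_n binom(1/2, n) (a - 1)^n`. -/
def psSqrt (a : PowerSeries ℂ) : PowerSeries ℂ :=
  (PowerSeries.binomialSeries ℂ (1 / 2 : ℚ)).subst (a - 1)

theorem psSqrt_mul_self (a : PowerSeries ℂ) (ha : constantCoeff a = 1) :
    psSqrt a * psSqrt a = a := by
  have hs : HasSubst (a - 1) := HasSubst.of_constantCoeff_zero' (by simp [ha])
  have h1 : PowerSeries.binomialSeries ℂ (1 / 2 : ℚ) * PowerSeries.binomialSeries ℂ (1 / 2 : ℚ) = 1 + X := by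
    rw [← binomialSeries_add]
    have := binomialSeries_nat (R := ℚ) (A := ℂ) 1
    norm_num at this ⊢
    exact this
  unfold psSqrt
  rw [← subst_mul hs, h1, subst_add hs, subst_X hs]
  have h2 : (1 : PowerSeries ℂ).subst (a - 1) = (1 : PowerSeries ℂ) := by
    rw [← coe_substAlgHom hs, map_one]
  rw [h2]; ring

/-- The rescaled deformed spectral parameter `y = h x`, where `x + 1/x = v / h` and `x ∼ v / h`
as `h → 0`. That is, `y + h² / y = v`, on the branch `y = (v / 2) (1 + √(1 - 4 h² / v²))`. -/
def deformed (v : PowerSeries ℂ) : PowerSeries ℂ :=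
  C (1 / 2) * v * (1 + psSqrt (1 - 4 * X ^ 2 * v⁻¹ ^ 2))

theorem deformed_spec (v : PowerSeries ℂ) (hv : constantCoeff v ≠ 0) :
    deformed v ^ 2 + X ^ 2 = v * deformed v := by
  have h := psSqrt_mul_self (1 - 4 * X ^ 2 * v⁻¹ ^ 2) (by simp)
  have hc : (2 : PowerSeries ℂ) * C (1 / 2) = 1 := by
    rw [show (2 : PowerSeries ℂ) = C 2 from (map_ofNat C 2).symm, ← map_mul]
    norm_num
  have hv' := PowerSeries.mul_inv_cancel v hv
  unfold deformed
  generalize psSqrt (1 - 4 * X ^ 2 * v⁻¹ ^ 2) = s at h ⊢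
  generalize v⁻¹ = w at *
  generalize C (1 / 2 : ℂ) = c at *
  linear_combination (c ^ 2 * v ^ 2) * h + (c * v ^ 2 * (1 + s)) * hc
    - (4 * c ^ 2 * X ^ 2 * (v * w + 1)) * hv' - (X ^ 2 * (2 * c + 1)) * hc

/-- `y⁺ = h x⁺`, with `x⁺ + 1/x⁺ = (u + i/2) / h`. -/
def yPlus (u : PowerSeries ℂ) : PowerSeries ℂ := deformed (u + C (Complex.I / 2))

/-- `y⁻ = h x⁻`, with `x⁻ + 1/x⁻ = (u - i/2) / h`. -/
def yMinus (u : PowerSeries ℂ) : PowerSeries ℂ := deformed (u - C (Complex.I / 2))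

/-- The magnon charges `q_r(u) = (i / (r - 1)) (1 / (y⁺)^(r - 1) - 1 / (y⁻)^(r - 1))`, `r ≥ 2`. -/
def charge (r : ℕ) (u : PowerSeries ℂ) : PowerSeries ℂ :=
  C (Complex.I / ((r : ℂ) - 1)) * ((yPlus u)⁻¹ ^ (r - 1) - (yMinus u)⁻¹ ^ (r - 1))

/-- The weak coupling coefficients of the Beisert-Eden-Staudacher phase,
`β_{r, r+1+2ν}(h) = ∑_{μ ≥ ν} h^(2r + 2ν + 2μ) β_{r, r+1+2ν}^{(r+ν+μ)}` with
`β_{r, r+1+2ν}^{(r+ν+μ)} = 2 (-1)^(r+μ+1) (r-1) (r+2ν) / (2μ+1)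
  binom(2μ+1, μ-r-ν+1) binom(2μ+1, μ-ν) ζ(2μ+1)`
(a binomial with negative lower entry is `0`). -/
def besCoeff (r ν μ : ℕ) : ℂ :=
  if r + ν ≤ μ + 1 then
    2 * (-1) ^ (r + μ + 1) * (((r : ℂ) - 1) * ((r : ℂ) + 2 * ν) / (2 * μ + 1))
      * ((2 * μ + 1).choose (μ + 1 - (r + ν)) : ℂ) * ((2 * μ + 1).choose (μ - ν) : ℂ)
      * riemannZeta (2 * μ + 1)
  else 0

/-- The dressing phase
`θ(u, w) = ∑_{r ≥ 2} ∑_{ν ≥ 0} β_{r, r+1+2ν}(h) (q_r(u) q_{r+1+2ν}(w) - q_{r+1+2ν}(u) q_r(w))`.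
The term `(r, ν, μ)` is divisible by `h^(2r + 2ν + 2μ)`, so that only finitely many terms
contribute to each coefficient. -/
def besPhase (u w : PowerSeries ℂ) : PowerSeries ℂ :=
  PowerSeries.mk fun n => coeff n
    (∑ r ∈ Finset.Icc 2 n, ∑ ν ∈ Finset.range (n + 1), ∑ μ ∈ Finset.Icc ν n,
      C (besCoeff r ν μ) * X ^ (2 * r + 2 * ν + 2 * μ) *
        (charge r u * charge (r + 1 + 2 * ν) w - charge (r + 1 + 2 * ν) u * charge r w))

/-- The square of the dressing factor, `σ_BES² = exp(2 i θ)`. -/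
def besSigmaSq (u w : PowerSeries ℂ) : PowerSeries ℂ :=
  (PowerSeries.exp ℂ).subst (C (2 * Complex.I) * besPhase u w)

/-- The all-loop Bethe equations of twist `L` with `N` symmetric pairs of momentum-carrying roots,
`(x_k⁺/x_k⁻)^L = - ∏_{j ≠ k} (x_k⁻ - x_j⁺)/(x_k⁺ - x_j⁻)
  (1 - 1/(x_k⁺ x_j⁻))/(1 - 1/(x_k⁻ x_j⁺)) σ_BES²(u_k, u_j)`, as an identity in perturbation theory,
written in terms of `y^± = h x^±`. -/
def BetheEquations (L : ℕ) {N : ℕ} (u : Fin N → PowerSeries ℂ) : Prop :=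
  ∀ k : Fin N,
    (yPlus (u k) * (yMinus (u k))⁻¹) ^ L =
      -∏ j ∈ Finset.univ.erase k,
        ((yMinus (u k) - yPlus (u j)) * (yPlus (u k) - yMinus (u j))⁻¹
          * ((1 - X ^ 2 * (yPlus (u k) * yMinus (u j))⁻¹)
              * (1 - X ^ 2 * (yMinus (u k) * yPlus (u j))⁻¹)⁻¹)
          * besSigmaSq (u k) (u j))

/-- `sin²(p/2) = (2 - e^{ip} - e^{-ip}) / 4`, where `e^{ip} = x⁺/x⁻`. -/
def sinSqHalfMomentum (u : PowerSeries ℂ) : PowerSeries ℂ :=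
  C (1 / 4) * (2 - yPlus u * (yMinus u)⁻¹ - yMinus u * (yPlus u)⁻¹)

/-- The asymptotic anomalous dimension `γ^ABA(h) = ∑_k (√(1 + 16 h² sin²(p_k/2)) - 1)`. -/
def gammaABA {N : ℕ} (u : Fin N → PowerSeries ℂ) : PowerSeries ℂ :=
  ∑ k, (psSqrt (1 + 16 * X ^ 2 * sinSqHalfMomentum (u k)) - 1)

/-! ### Baxter functions -/

/-- The difference operator of the twist-2 leading order Baxter equation,
`(u + i/2)² Q(u + i) - (u - i/2)² Q(u - i) - i (2N + 2) u Q(u)`. -/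
def baxterOp (N : ℕ) (Q : ℂ → ℂ) (u : ℂ) : ℂ :=
  (u + Complex.I / 2) ^ 2 * Q (u + Complex.I) - (u - Complex.I / 2) ^ 2 * Q (u - Complex.I)
    - Complex.I * (2 * N + 2) * u * Q u

/-- The Bethe roots of the twist-2 ground state with spin `N`, in perturbation theory: they solve
the all-loop Bethe equations of twist `2`, and the Baxter polynomial `∏_k (u - u_k)` of their
leading order values solves the leading order Baxter equation of the ground state. -/
structure IsTwistTwoGroundState (N : ℕ) (u : Fin N → PowerSeries ℂ) : Prop where
  bethe : BetheEquations 2 u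
  baxter : ∀ z : ℂ, baxterOp N (fun w => ∏ k, (w - constantCoeff (u k))) z = 0

/-- The terminating hypergeometric sum `₃F₂(-M, a, b; c, d; 1)`. -/
def hyp3F2 (M : ℕ) (a b c d : ℂ) : ℂ :=
  ∑ m ∈ Finset.range (M + 1),
    (ascPochhammer ℂ m).eval (-(M : ℂ)) * (ascPochhammer ℂ m).eval a * (ascPochhammer ℂ m).eval b
      / ((ascPochhammer ℂ m).eval c * (ascPochhammer ℂ m).eval d * (m.factorial : ℂ))

/-- `Q⁽⁰⁾(u) = ₃F₂(-N/2, 1/2 + iu, 1/2 - iu; 1, 1; 1)`. -/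
def baxterQ0 (N : ℕ) (u : ℂ) : ℂ :=
  hyp3F2 (N / 2) (1 / 2 + Complex.I * u) (1 / 2 - Complex.I * u) 1 1

/-- `∂_α ₃F₂(-N/2, 1/2 + iu + α, 1/2 - iu; 1, 1; 1)` at `α = 0`. -/
def G11 (N : ℕ) (u : ℂ) : ℂ :=
  deriv (fun α => hyp3F2 (N / 2) (1 / 2 + Complex.I * u + α) (1 / 2 - Complex.I * u) 1 1) 0

/-- `∂_α ₃F₂(-N/2, 1/2 + iu, 1/2 - iu + α; 1, 1; 1)` at `α = 0`. -/
def G12 (N : ℕ) (u : ℂ) : ℂ :=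
  deriv (fun α => hyp3F2 (N / 2) (1 / 2 + Complex.I * u) (1 / 2 - Complex.I * u + α) 1 1) 0

/-- `∂_α ∂_β ₃F₂(-N/2, 1/2 + iu + α, 1/2 - iu; 1, 1 + β; 1)` at `α = β = 0`. -/
def G21 (N : ℕ) (u : ℂ) : ℂ :=
  deriv (fun α => deriv (fun β =>
    hyp3F2 (N / 2) (1 / 2 + Complex.I * u + α) (1 / 2 - Complex.I * u) 1 (1 + β)) 0) 0

/-- `∂_α ∂_β ₃F₂(-N/2, 1/2 + iu, 1/2 - iu + α; 1, 1 + β; 1)` at `α = β = 0`. -/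
def G22 (N : ℕ) (u : ℂ) : ℂ :=
  deriv (fun α => deriv (fun β =>
    hyp3F2 (N / 2) (1 / 2 + Complex.I * u) (1 / 2 - Complex.I * u + α) 1 (1 + β)) 0) 0

/-- `∂_α² ₃F₂(-N/2, 1/2 + iu + α, 1/2 - iu + α; 1, 1; 1)` at `α = 0`. -/
def G23 (N : ℕ) (u : ℂ) : ℂ :=
  iteratedDeriv 2 (fun α =>
    hyp3F2 (N / 2) (1 / 2 + Complex.I * u + α) (1 / 2 - Complex.I * u + α) 1 1) 0

/-- `Q⁽¹⁾ = -3 S₁(N/2) (G⁽¹⁾₁ + G⁽¹⁾₂) - G⁽²⁾₁ - G⁽²⁾₂ - G⁽²⁾₃`. -/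
def baxterQ1 (N : ℕ) (u : ℂ) : ℂ :=
  -3 * (harmonicSum [1] (N / 2) : ℂ) * (G11 N u + G12 N u) - G21 N u - G22 N u - G23 N u

/-- The inhomogeneity of the twist-2 next-to-leading order Baxter equation. -/
def baxterNLOSource (N : ℕ) (u : ℂ) : ℂ :=
  -2 * Complex.I * (harmonicSum [1] (N / 2) : ℂ) *
      ((u + Complex.I / 2) * baxterQ0 N (u + Complex.I)
        + (u - Complex.I / 2) * baxterQ0 N (u - Complex.I) - 2 * u * baxterQ0 N u)
    + 2 * (baxterQ0 N (u + Complex.I) - baxterQ0 N (u - Complex.I))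

/-- The all-loop Baxter polynomial `c ∏_k (z - u_k(h))` at the point `z`. -/
def baxterPoly {N : ℕ} (c : ℂ) (u : Fin N → PowerSeries ℂ) (z : ℂ) : PowerSeries ℂ :=
  C c * ∏ k, (C z - u k)

end ABJM

end

noncomputable section

namespace ABJM

open Finset

/-! ### Harmonic numbers and alternating binomial sums -/

/-! Write `M = N / 2`, `e = 1/4 + u²` and `H_r` for the generalized harmonic numbers. In the basis
`b_k = (1/2 + iu)_k (1/2 - iu)_k / k!²` of even polynomials the Baxter operator is bidiagonal up to
a factor `2iu`, and on `∑ (-1)^k binom(M, k) t_k b_k` it sees only the differences `t_k - t_{k+1}`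
(`baxterOp_sum_basisFun`). Constant `t` gives `Q⁽⁰⁾`; the next-to-leading source asks for `t_k -
t_{k+1} = 2 H_1(M)/(k+1) + 2/(k+1)²`, which is `nloCoeff`. That the hypergeometric derivatives in
`Q⁽¹⁾` have exactly these coefficients is an alternating binomial identity (`altSum_harm_mixed`,
`baxterQ1_eq_sum`).

As a function of `M`, `Q⁽⁰⁾` solves a discrete Sturm-Liouville problem with eigenvalue `e`. Its
energy identity and a discrete Hardy inequality force `e > 1/4` at a zero, so the leading roots are
real; a Christoffel-Darboux identity makes them simple. Polynomial solutions of the Baxter equation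
are unique up to scale, so every ground state has these leading roots.

The Bethe equations say that certain ratios equal 1. At real leading roots their logarithmic
Jacobian is `i` times a real, strictly diagonally dominant matrix, so a formal inverse function
theorem gives existence (`exists_solution_of_formalDiff`) and determines the roots order by order
(`X_pow_dvd_sub_of_formalDiff`). It then suffices that `c_k + h² η_k`, with `η_k = -Q⁽¹⁾(c_k) /
Q⁽⁰⁾'(c_k)`, solves them modulo `h³`. This is `second_order_bethe`: a combination of the
next-to-leading Baxter equation and the differentiated leading one at `c_k`. The dressing phase is
`O(h⁴)` and does not enter. Since `Q⁽¹⁾` has degree below `N`, interpolation at the roots recovers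
it from the `η_k`.

The dispersion relation is exactly `1 + 2i h² (1/y⁺ - 1/y⁻)`, so the `h⁴` coefficient needs only the
sums of `1/(±i/2 - c_k)³` and `η_k/(±i/2 - c_k)²`. These are read off from the Taylor expansions of
`Q⁽⁰⁾` and `Q⁽¹⁾` at `±i/2` (`RootData.power_sums`). On the other side, nested sums with opposite
leading index pair up, leaving only even summation indices (`gammaFour_succ`). -/

/-- The generalized harmonic number `∑_{i=1}^n 1 / i^r`, as a complex number. -/
def harm (r n : ℕ) : ℂ := ∑ i ∈ range n, 1 / ((i : ℂ) + 1) ^ r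

@[simp] theorem harm_zero (r : ℕ) : harm r 0 = 0 := by simp [harm]

theorem harm_succ (r n : ℕ) : harm r (n + 1) = harm r n + 1 / ((n : ℂ) + 1) ^ r := by
  simp [harm, sum_range_succ]

theorem natCast_add_one_ne_zero (n : ℕ) : (n : ℂ) + 1 ≠ 0 := by exact_mod_cast Nat.succ_ne_zero n

/-- The alternating sum `∑_{j ≥ 1} (-1)^j binom(M, k + j) g(j - 1)`. -/
def altSum (M k : ℕ) (g : ℕ → ℂ) : ℂ :=
  ∑ j ∈ range M, (-1) ^ (j + 1) * (M.choose (k + j + 1) : ℂ) * g j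

theorem altSum_eq_sum_range {M L : ℕ} (h : M ≤ L) (k : ℕ) (g : ℕ → ℂ) :
    altSum M k g = ∑ j ∈ range L, (-1) ^ (j + 1) * (M.choose (k + j + 1) : ℂ) * g j := by
  unfold altSum
  refine sum_subset (range_mono h) fun j _ hj => ?_
  rw [Nat.choose_eq_zero_of_lt (by simp at hj; omega)]
  simp

theorem altSum_add (M k : ℕ) (f g : ℕ → ℂ) :
    altSum M k (fun j => f j + g j) = altSum M k f + altSum M k g := by
  simp [altSum, mul_add, sum_add_distrib]

theorem altSum_const_mul (M k : ℕ) (c : ℂ) (g : ℕ → ℂ) :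
    altSum M k (fun j => c * g j) = c * altSum M k g := by
  simp only [altSum, mul_sum]
  exact sum_congr rfl fun _ _ => by ring

theorem altSum_succ_succ (M k : ℕ) (g : ℕ → ℂ) :
    altSum (M + 1) (k + 1) g = altSum M k g + altSum M (k + 1) g := by
  rw [altSum_eq_sum_range (Nat.le_succ M) k, altSum_eq_sum_range (Nat.le_succ M) (k + 1), altSum,
    ← sum_add_distrib]
  refine sum_congr rfl fun j _ => ?_
  rw [show k + 1 + j + 1 = (k + j + 1) + 1 by ring, Nat.choose_succ_succ']
  push_cast
  ring

theorem choose_div_succ (M j : ℕ) :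
    (M.choose j : ℂ) / ((j : ℂ) + 1) = ((M + 1).choose (j + 1) : ℂ) / ((M : ℂ) + 1) := by
  rw [div_eq_div_iff (natCast_add_one_ne_zero j) (natCast_add_one_ne_zero M)]
  have := Nat.add_one_mul_choose_eq M j
  have h : ((M : ℂ) + 1) * (M.choose j : ℂ) = ((M + 1).choose (j + 1) : ℂ) * ((j : ℂ) + 1) := by
    exact_mod_cast this
  linear_combination h

/-- Pascal's rule followed by the absorption `binom(M, j)/(j+1) = binom(M+1, j+1)/(M+1)`. Dividing
the summand by `j + 1` thus amounts to a summation over `M`, which evaluates the sums below by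
induction. -/
theorem altSum_succ_zero_div (M : ℕ) (g : ℕ → ℂ) :
    altSum (M + 1) 0 (fun j => g j / ((j : ℂ) + 1)) =
      altSum M 0 (fun j => g j / ((j : ℂ) + 1)) + 1 / ((M : ℂ) + 1) * altSum (M + 1) 0 g := by
  rw [altSum_eq_sum_range (Nat.le_succ M) 0, altSum, altSum, mul_sum, ← sum_add_distrib]
  refine sum_congr rfl fun j _ => ?_
  have h := choose_div_succ M j
  have e1 : ((M + 1).choose (0 + j + 1) : ℂ) = M.choose j + M.choose (0 + j + 1) := by
    rw [zero_add, Nat.choose_succ_succ']; push_cast; ring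
  rw [zero_add] at *
  calc _ = (-1) ^ (j + 1) * g j * ((M.choose j : ℂ) / ((j : ℂ) + 1))
      + (-1) ^ (j + 1) * (M.choose (j + 1) : ℂ) * (g j / ((j : ℂ) + 1)) := by rw [e1]; ring
    _ = _ := by rw [h]; ring

theorem altSum_div_shift (M k : ℕ) (g : ℕ → ℂ) :
    altSum M k (fun j => g j / ((k : ℂ) + j + 2)) =
      1 / ((M : ℂ) + 1) * altSum (M + 1) (k + 1) g := by
  rw [altSum_eq_sum_range (Nat.le_succ M) k, altSum, mul_sum]
  refine sum_congr rfl fun j _ => ?_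
  have h := choose_div_succ M (k + j + 1)
  push_cast at h
  rw [show k + 1 + j + 1 = k + j + 1 + 1 by ring]
  calc _ = (-1) ^ (j + 1) * g j * ((M.choose (k + j + 1) : ℂ) / ((k : ℂ) + j + 1 + 1)) := by
        rw [show (k : ℂ) + j + 1 + 1 = (k : ℂ) + j + 2 by ring]; ring
    _ = _ := by rw [h]; ring

/-- Summation by parts: Pascal's rule moves the difference onto `f`, the boundary term vanishes
because `f 0 = 0`, and absorption turns `binom(M, j)` back into `binom(M+1, j+1)`. -/
theorem altSum_succ_zero_eq_diff (M : ℕ) (f : ℕ → ℂ) (hf : f 0 = 0) :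
    altSum (M + 1) 0 (fun j => f (j + 1)) =
      1 / ((M : ℂ) + 1) * altSum (M + 1) 0 (fun j => ((j : ℂ) + 1) * (f (j + 1) - f j)) := by
  have key : ∑ j ∈ range (M + 1), (-1) ^ (j + 1) * (M.choose j : ℂ) * f j =
      - ∑ j ∈ range (M + 1), (-1) ^ (j + 1) * (M.choose (j + 1) : ℂ) * f (j + 1) := by
    rw [sum_range_succ', sum_range_succ (fun j => (-1) ^ (j + 1) * (M.choose (j + 1) : ℂ) * _),
      Nat.choose_succ_self, hf]
    simp [pow_succ]
  have e : 1 / ((M : ℂ) + 1) * altSum (M + 1) 0 (fun j => ((j : ℂ) + 1) * (f (j + 1) - f j)) =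
      ∑ j ∈ range (M + 1), (-1) ^ (j + 1) * (M.choose j : ℂ) * (f (j + 1) - f j) := by
    rw [altSum, mul_sum]
    refine sum_congr rfl fun j _ => ?_
    have h := choose_div_succ M j
    rw [zero_add]
    rw [div_eq_iff (natCast_add_one_ne_zero j)] at h
    rw [h]; ring
  rw [e]
  simp only [mul_sub, sum_sub_distrib]
  rw [key, altSum, sub_neg_eq_add, ← sum_add_distrib]
  refine sum_congr rfl fun j _ => ?_
  rw [zero_add, Nat.choose_succ_succ']
  push_cast
  ring

theorem sum_range_alternating_choose (M L : ℕ) :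
    ∑ j ∈ range L, (-1) ^ (j + 1) * ((M + 1).choose (0 + j + 1) : ℂ) * 1 =
      (-1) ^ L * (M.choose L : ℂ) - 1 := by
  induction L with
  | zero => simp
  | succ L ih =>
    rw [sum_range_succ, ih, zero_add, Nat.choose_succ_succ']
    push_cast
    ring

theorem altSum_one (M : ℕ) : altSum (M + 1) 0 (fun _ => 1) = -1 := by
  rw [altSum, sum_range_alternating_choose, Nat.choose_succ_self]
  simp

theorem altSum_inv_zero (M : ℕ) : altSum M 0 (fun j => 1 / ((j : ℂ) + 1)) = -harm 1 M := by
  induction M with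
  | zero => simp [altSum]
  | succ M ih =>
    rw [altSum_succ_zero_div, ih, altSum_one, harm_succ]
    ring

theorem altSum_inv (M k : ℕ) :
    altSum M k (fun j => 1 / ((j : ℂ) + 1)) = -(M.choose k : ℂ) * (harm 1 M - harm 1 k) := by
  induction M generalizing k with
  | zero => cases k <;> simp [altSum]
  | succ M ih =>
    cases k with
    | zero => rw [altSum_inv_zero]; simp
    | succ k =>
      rw [altSum_succ_succ, ih, ih, harm_succ, harm_succ, Nat.choose_succ_succ']
      have h := choose_div_succ M k
      rw [Nat.choose_succ_succ'] at h
      push_cast at h ⊢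
      linear_combination -h

theorem altSum_harm_one (M : ℕ) :
    altSum (M + 1) 0 (fun j => harm 1 (j + 1)) = -1 / ((M : ℂ) + 1) := by
  rw [altSum_succ_zero_eq_diff M (harm 1) (harm_zero 1)]
  have : (fun j : ℕ => ((j : ℂ) + 1) * (harm 1 (j + 1) - harm 1 j)) = fun _ => 1 := by
    funext j
    rw [harm_succ]
    field_simp [natCast_add_one_ne_zero j]
    ring
  rw [this, altSum_one]
  ring

theorem altSum_harm_two (M : ℕ) :
    altSum (M + 1) 0 (fun j => harm 2 (j + 1)) = -harm 1 (M + 1) / ((M : ℂ) + 1) := by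
  rw [altSum_succ_zero_eq_diff M (harm 2) (harm_zero 2)]
  have : (fun j : ℕ => ((j : ℂ) + 1) * (harm 2 (j + 1) - harm 2 j)) =
      fun j : ℕ => 1 / ((j : ℂ) + 1) := by
    funext j
    rw [harm_succ]
    field_simp [natCast_add_one_ne_zero j]
    ring
  rw [this, altSum_inv_zero]
  ring

theorem altSum_harm_one_div (M : ℕ) :
    altSum M 0 (fun j => harm 1 (j + 1) / ((j : ℂ) + 1)) = -harm 2 M := by
  induction M with
  | zero => simp [altSum]
  | succ M ih =>
    rw [altSum_succ_zero_div, ih, altSum_harm_one, harm_succ]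
    generalize (M : ℂ) + 1 = m
    ring

/-- The nested sum `S_{2,1}`. -/
def harmNested (n : ℕ) : ℂ := ∑ i ∈ range n, harm 1 (i + 1) / ((i : ℂ) + 1) ^ 2

theorem harmNested_succ (n : ℕ) :
    harmNested (n + 1) = harmNested n + harm 1 (n + 1) / ((n : ℂ) + 1) ^ 2 := by
  simp [harmNested, sum_range_succ]

theorem altSum_harm_two_div (M : ℕ) :
    altSum M 0 (fun j => harm 2 (j + 1) / ((j : ℂ) + 1)) = -harmNested M := by
  induction M with
  | zero => simp [altSum, harmNested]
  | succ M ih =>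
    rw [altSum_succ_zero_div, ih, altSum_harm_two, harmNested_succ]
    generalize (M : ℂ) + 1 = m
    ring

theorem altSum_harm_mixed_zero (M : ℕ) :
    altSum M 0 (fun j => (harm 1 (j + 1) + 2 * harm 1 j) / ((j : ℂ) + 1)) =
      harm 1 M ^ 2 - 2 * harm 2 M := by
  induction M with
  | zero => simp [altSum]
  | succ M ih =>
    rw [altSum_succ_zero_div, ih]
    have : (fun j : ℕ => harm 1 (j + 1) + 2 * harm 1 j) =
        fun j : ℕ => 3 * harm 1 (j + 1) + (-2) * (1 / ((j : ℂ) + 1)) := by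
      funext j
      rw [harm_succ]; ring
    rw [this, altSum_add, altSum_const_mul, altSum_const_mul, altSum_harm_one, altSum_inv_zero,
      harm_succ, harm_succ]
    generalize (M : ℂ) + 1 = m
    ring

/-- The combination `H(k+j+1) + 2 H(j)` is the one left in `Q⁽¹⁾` after setting `m = k + j + 1`.
Pascal's rule lowers `M`; raising `k` in the first harmonic number costs `1/(k+j+2)`, which
`altSum_div_shift` and `altSum_inv` absorb. -/
theorem altSum_harm_mixed (M k : ℕ) :
    altSum M k (fun j => (harm 1 (k + j + 1) + 2 * harm 1 j) / ((j : ℂ) + 1)) =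
      (M.choose k : ℂ) * ((harm 1 M - 2 * harm 1 k) * (harm 1 M - harm 1 k)
        - 2 * (harm 2 M - harm 2 k)) := by
  induction M generalizing k with
  | zero => cases k <;> simp [altSum]
  | succ M ih =>
    cases k with
    | zero =>
      have := altSum_harm_mixed_zero (M + 1)
      simp only [zero_add]
      rw [this]; simp; ring
    | succ k =>
      rw [altSum_succ_succ, ih]
      have e : (fun j : ℕ => (harm 1 (k + 1 + j + 1) + 2 * harm 1 j) / ((j : ℂ) + 1)) =
          fun j : ℕ => (harm 1 (k + j + 1) + 2 * harm 1 j) / ((j : ℂ) + 1)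
            + (1 / ((j : ℂ) + 1)) / ((k : ℂ) + j + 2) := by
        funext j
        rw [show k + 1 + j + 1 = k + j + 1 + 1 by ring, harm_succ]
        push_cast
        rw [show (k : ℂ) + j + 1 + 1 = (k : ℂ) + j + 2 by ring]
        ring
      rw [e, altSum_add, ih, altSum_div_shift, altSum_inv]
      simp only [harm_succ]
      have h := choose_div_succ M k
      rw [Nat.choose_succ_succ'] at h
      rw [Nat.choose_succ_succ']
      push_cast at h ⊢
      generalize (M.choose k : ℂ) = a at *
      generalize (M.choose (k + 1) : ℂ) = b at *
      generalize harm 1 M = x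
      generalize harm 2 M = x2
      generalize harm 1 k = y
      generalize harm 2 k = y2
      generalize (k : ℂ) + 1 = K at *
      generalize (M : ℂ) + 1 = m at *
      linear_combination (3 * x - 4 * (y + 1 / K)) * h

/-! ### The basis `(1/2 + iu)_k (1/2 - iu)_k / k!²` of even polynomials -/

section Basis
open Polynomial

/-- The polynomial `∏_{j < k} (j (j + 1) + e) / (j + 1)²` in `e`; at `e = 1/4 + u²` this is
`(1/2 + iu)_k (1/2 - iu)_k / k!²`. -/
def basisPoly (k : ℕ) : ℂ[X] :=
  ∏ j ∈ range k, C (1 / ((j : ℂ) + 1) ^ 2) * (C ((j : ℂ) * (j + 1)) + X)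

theorem basisPoly_succ (k : ℕ) :
    C (((k : ℂ) + 1) ^ 2) * basisPoly (k + 1) = (C ((k : ℂ) * (k + 1)) + X) * basisPoly k := by
  have h : C (((k : ℂ) + 1) ^ 2) * C (1 / ((k : ℂ) + 1) ^ 2) = 1 := by
    rw [← C_mul, mul_one_div_cancel (pow_ne_zero 2 (natCast_add_one_ne_zero k)), C_1]
  rw [basisPoly, prod_range_succ, ← basisPoly]
  linear_combination (basisPoly k * (C ((k : ℂ) * (k + 1)) + X)) * h

@[simp] theorem basisPoly_zero : basisPoly 0 = 1 := by simp [basisPoly]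

/-- The value of `basisPoly k` at `1/4 + u²`. -/
def basisFun (k : ℕ) (u : ℂ) : ℂ := (basisPoly k).eval (1 / 4 + u ^ 2)

@[simp] theorem basisFun_zero (u : ℂ) : basisFun 0 u = 1 := by simp [basisFun]

theorem basisFun_succ (k : ℕ) (u : ℂ) :
    ((k : ℂ) + 1) ^ 2 * basisFun (k + 1) u = (((k : ℂ) + 1 / 2) ^ 2 + u ^ 2) * basisFun k u := by
  have := congrArg (eval (1 / 4 + u ^ 2)) (basisPoly_succ k)
  simp only [eval_mul, eval_C, eval_add, eval_X] at this
  rw [basisFun, basisFun, this]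
  ring

/-- The deformation `(1/2 + iu + α)_m (1/2 - iu + α)_m / m!²`, as a polynomial in `α`. -/
def deformedBasis (m : ℕ) (u : ℂ) : ℂ[X] :=
  ∏ j ∈ range m, C (1 / ((j : ℂ) + 1) ^ 2) * ((X + C ((j : ℂ) + 1 / 2)) ^ 2 + C (u ^ 2))

theorem deformedBasis_succ (m : ℕ) (u : ℂ) :
    C (((m : ℂ) + 1) ^ 2) * deformedBasis (m + 1) u =
      C (((m : ℂ) + 1 / 2) ^ 2 + u ^ 2) * deformedBasis m u
        + C (2 * (m : ℂ) + 1) * (X * deformedBasis m u) + X * (X * deformedBasis m u) := by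
  have h : C (((m : ℂ) + 1) ^ 2) * C (1 / ((m : ℂ) + 1) ^ 2) = 1 := by
    rw [← C_mul, mul_one_div_cancel (pow_ne_zero 2 (natCast_add_one_ne_zero m)), C_1]
  have e : C (2 * (m : ℂ) + 1) = 2 * C ((m : ℂ) + 1 / 2) := by
    rw [show (2 : ℂ[X]) = C 2 from (map_ofNat C 2).symm, ← C_mul]; congr 1; ring
  have e' : C (((m : ℂ) + 1 / 2) ^ 2 + u ^ 2) = C ((m : ℂ) + 1 / 2) ^ 2 + C (u ^ 2) := by
    rw [C_add, C_pow]
  rw [deformedBasis, prod_range_succ, ← deformedBasis, e, e']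
  linear_combination (deformedBasis m u * ((X + C ((m : ℂ) + 1 / 2)) ^ 2 + C (u ^ 2))) * h

/-- Translates multiplication by `(m + 1/2)² + u²` into basis coefficients: since `(m + 1/2)² - (k +
1/2)² = (m - k)(m + k + 1)`, it sends `b_k` to `(k+1)² b_{k+1} + (m-k)(m+k+1) b_k`. The sequence `w`
is an inhomogeneity. -/
theorem basisFun_sum_step (m : ℕ) (u : ℂ) (y z w : ℕ → ℂ)
    (h : ∀ k < m, ((m : ℂ) + 1) ^ 2 * z k =
      (k : ℂ) ^ 2 * y (k - 1) + ((m : ℂ) - k) * (m + k + 1) * y k + w k)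
    (hm : ((m : ℂ) + 1) ^ 2 * z m = (m : ℂ) ^ 2 * y (m - 1) + w m) :
    ((m : ℂ) + 1) ^ 2 * ∑ k ∈ range (m + 1), basisFun k u * z k =
      (((m : ℂ) + 1 / 2) ^ 2 + u ^ 2) * ∑ k ∈ range m, basisFun k u * y k
        + ∑ k ∈ range (m + 1), basisFun k u * w k := by
  have e1 : (((m : ℂ) + 1 / 2) ^ 2 + u ^ 2) * ∑ k ∈ range m, basisFun k u * y k =
      ∑ k ∈ range (m + 1), (k : ℂ) ^ 2 * (basisFun k u * y (k - 1))
        + ∑ k ∈ range m, basisFun k u * (((m : ℂ) - k) * (m + k + 1) * y k) := by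
    rw [sum_range_succ', mul_sum]
    simp only [Nat.cast_zero, add_tsub_cancel_right, ne_eq, OfNat.ofNat_ne_zero, not_false_eq_true,
      zero_pow, zero_mul, add_zero]
    rw [← sum_add_distrib]
    refine sum_congr rfl fun k _ => ?_
    push_cast
    linear_combination -(y k) * basisFun_succ k u
  rw [e1, sum_range_succ, sum_range_succ, sum_range_succ _ m]
  have e2 : ((m : ℂ) + 1) ^ 2 * ∑ k ∈ range m, basisFun k u * z k =
      ∑ k ∈ range m, (k : ℂ) ^ 2 * (basisFun k u * y (k - 1))
        + ∑ k ∈ range m, basisFun k u * (((m : ℂ) - k) * (m + k + 1) * y k)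
        + ∑ k ∈ range m, basisFun k u * w k := by
    rw [mul_sum, ← sum_add_distrib, ← sum_add_distrib]
    refine sum_congr rfl fun k hk => ?_
    linear_combination basisFun k u * h k (mem_range.1 hk)
  linear_combination e2 + basisFun m u * hm

theorem deformedBasis_coeff_zero (m : ℕ) (u : ℂ) : (deformedBasis m u).coeff 0 = basisFun m u := by
  induction m with
  | zero => simp [deformedBasis]
  | succ m ih =>
    have h := congrArg (coeff · 0) (deformedBasis_succ m u)
    simp only [coeff_add, coeff_C_mul, coeff_X_mul_zero, ih, ← basisFun_succ] at h
    refine mul_left_cancel₀ (pow_ne_zero 2 (natCast_add_one_ne_zero m)) ?_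
    rw [h]; ring

/-- The first `α`-derivative written in the basis; the coefficients `1/(m - k)` satisfy the
recursion of `basisFun_sum_step`, with the order-zero term entering as `w`. -/
theorem deformedBasis_coeff_one (m : ℕ) (u : ℂ) :
    (deformedBasis m u).coeff 1 = ∑ k ∈ range m, basisFun k u * (1 / ((m : ℂ) - k)) := by
  induction m with
  | zero => simp [deformedBasis, coeff_one]
  | succ m ih =>
    have h := congrArg (coeff · 1) (deformedBasis_succ m u)
    simp only [coeff_add, coeff_C_mul, coeff_X_mul, coeff_X_mul_zero, ih,
      deformedBasis_coeff_zero] at h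
    refine mul_left_cancel₀ (pow_ne_zero 2 (natCast_add_one_ne_zero m)) ?_
    rw [h, basisFun_sum_step m u (fun k => 1 / ((m : ℂ) - k)) (fun k => 1 / (((m + 1 : ℕ) : ℂ) - k))
      (fun k => if k = m then 2 * (m : ℂ) + 1 else 0)]
    · simp
      ring
    · intro k hk
      obtain ⟨d, rfl⟩ := Nat.exists_eq_add_of_lt hk
      have h1 := natCast_add_one_ne_zero d
      have h2 := natCast_add_one_ne_zero (d + 1)
      push_cast at h2
      rw [if_neg hk.ne]
      -- For `k = 0` the truncated index `k - 1` is harmless, since its coefficient `k²` vanishes.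
      cases k with
      | zero =>
        simp only [CharP.cast_eq_zero]
        push_cast
        simp only [zero_add, sub_zero]
        field_simp
        ring
      | succ k =>
        push_cast
        rw [show ((k : ℂ) + 1 + d + 1 + 1 - (k + 1)) = (d : ℂ) + 1 + 1 by ring,
          show ((k : ℂ) + 1 + d + 1 - (k + 1)) = (d : ℂ) + 1 by ring,
          show ((k : ℂ) + 1 + d + 1 - k) = (d : ℂ) + 1 + 1 by ring]
        field_simp
        ring
    · cases m with
      | zero => simp
      | succ m =>
        push_cast
        rw [if_pos rfl, show ((m : ℂ) + 1 + 1 - (m + 1)) = 1 by ring, show ((m : ℂ) + 1 - m) = 1 by ring]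
        ring

/-- The same recursion, with both lower-order coefficients now feeding the inhomogeneity `w`. -/
theorem deformedBasis_coeff_two (m : ℕ) (u : ℂ) :
    (deformedBasis m u).coeff 2 = ∑ k ∈ range m, basisFun k u *
      ((harm 1 (m - k - 1) + harm 1 m - harm 1 k) / ((m : ℂ) - k)) := by
  induction m with
  | zero => simp [deformedBasis, coeff_one]
  | succ m ih =>
    have h := congrArg (coeff · 2) (deformedBasis_succ m u)
    simp only [coeff_add, coeff_C_mul, coeff_X_mul, ih, deformedBasis_coeff_zero,
      deformedBasis_coeff_one] at h
    refine mul_left_cancel₀ (pow_ne_zero 2 (natCast_add_one_ne_zero m)) ?_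
    rw [h, basisFun_sum_step m u
      (fun k => (harm 1 (m - k - 1) + harm 1 m - harm 1 k) / ((m : ℂ) - k))
      (fun k => (harm 1 (m + 1 - k - 1) + harm 1 (m + 1) - harm 1 k) / (((m + 1 : ℕ) : ℂ) - k))
      (fun k => if k = m then 1 else (2 * (m : ℂ) + 1) * (1 / ((m : ℂ) - k)))]
    · rw [sum_range_succ _ m, if_pos rfl]
      have : ∑ k ∈ range m, basisFun k u *
          (if k = m then 1 else (2 * (m : ℂ) + 1) * (1 / ((m : ℂ) - k))) =
          (2 * (m : ℂ) + 1) * ∑ k ∈ range m, (basisFun k u * (1 / ((m : ℂ) - k))) := by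
        rw [mul_sum]
        refine sum_congr rfl fun k hk => ?_
        rw [if_neg (mem_range.1 hk).ne]; ring
      rw [this]; ring
    · intro k hk
      obtain ⟨d, rfl⟩ := Nat.exists_eq_add_of_lt hk
      have h1 := natCast_add_one_ne_zero d
      have h2 := natCast_add_one_ne_zero (d + 1)
      push_cast at h2
      rw [if_neg hk.ne]
      have e1 : k + d + 1 + 1 - k - 1 = d + 1 := by omega
      have e2 : k + d + 1 - k - 1 = d := by omega
      rw [e1, e2, harm_succ 1 (k + d + 1), harm_succ 1 d]
      cases k with
      | zero =>
        simp only [CharP.cast_eq_zero, harm_zero]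
        push_cast
        simp only [zero_add, sub_zero]
        field_simp
        ring
      | succ k =>
        have e3 : k + 1 + d + 1 - (k + 1 - 1) - 1 = d + 1 := by omega
        rw [e3, add_tsub_cancel_right, harm_succ 1 d, harm_succ 1 k]
        push_cast
        have h3 := natCast_add_one_ne_zero k
        have h4 := natCast_add_one_ne_zero (k + 1 + d + 1)
        push_cast at h4
        rw [show ((k : ℂ) + 1 + d + 1 + 1 - (k + 1)) = (d : ℂ) + 1 + 1 by ring,
          show ((k : ℂ) + 1 + d + 1 - (k + 1)) = (d : ℂ) + 1 by ring,
          show ((k : ℂ) + 1 + d + 1 - k) = (d : ℂ) + 1 + 1 by ring]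
        field_simp
        ring
    · cases m with
      | zero => simp [harm]
      | succ m =>
        have e1 : m + 1 + 1 - (m + 1) - 1 = 0 := by omega
        have e2 : m + 1 - (m + 1 - 1) - 1 = 0 := by omega
        have h1 := natCast_add_one_ne_zero m
        have h2 := natCast_add_one_ne_zero (m + 1)
        push_cast at h2
        rw [e1, e2, add_tsub_cancel_right, if_pos rfl, harm_succ 1 (m + 1), harm_succ 1 m]
        push_cast
        rw [show ((m : ℂ) + 1 + 1 - (m + 1)) = 1 by ring, show ((m : ℂ) + 1 - m) = 1 by ring,
          harm_zero]
        field_simp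
        ring

end Basis

section Hypergeometric
open Polynomial

/-! ### The hypergeometric polynomials in the basis -/

/-- The rising factorial `(s + α)_m` as a polynomial in `α`. -/
def risingPoly (s : ℂ) (m : ℕ) : ℂ[X] := (ascPochhammer ℂ m).comp (X + C s)

theorem risingPoly_eval (s α : ℂ) (m : ℕ) :
    (risingPoly s m).eval α = (ascPochhammer ℂ m).eval (s + α) := by
  simp [risingPoly, add_comm]

theorem risingPoly_succ (s : ℂ) (m : ℕ) :
    risingPoly s (m + 1) = risingPoly s m * (X + C (s + m)) := by
  simp only [risingPoly, ascPochhammer_succ_right, mul_comp, add_comp, X_comp, natCast_comp, C_add,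
    C_eq_natCast]
  simp [add_assoc]

theorem risingPoly_mul (m : ℕ) (u : ℂ) :
    risingPoly (1 / 2 + Complex.I * u) m * risingPoly (1 / 2 - Complex.I * u) m =
      C ((m.factorial : ℂ) ^ 2) * deformedBasis m u := by
  induction m with
  | zero => simp [risingPoly, deformedBasis]
  | succ m ih =>
    rw [risingPoly_succ, risingPoly_succ, mul_mul_mul_comm, ih, deformedBasis, deformedBasis,
      prod_range_succ, Nat.factorial_succ]
    have h : C (((m : ℂ) + 1) ^ 2) * C (1 / ((m : ℂ) + 1) ^ 2) = 1 := by
      rw [← C_mul, mul_one_div_cancel (pow_ne_zero 2 (natCast_add_one_ne_zero m)), C_1]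
    have e1 : (X + C (1 / 2 + Complex.I * u + m)) * (X + C (1 / 2 - Complex.I * u + m)) =
        (X + C ((m : ℂ) + 1 / 2)) ^ 2 + C (u ^ 2) := by
      have : C (u ^ 2) = -(C (Complex.I * u)) ^ 2 := by
        rw [← C_pow, mul_pow, Complex.I_sq, ← C_neg]; congr 1; ring
      rw [this]
      simp only [C_add, C_sub]
      ring
    have e2 : C ((((m + 1) * m.factorial : ℕ) : ℂ) ^ 2) =
        C (((m : ℂ) + 1) ^ 2) * C ((m.factorial : ℂ) ^ 2) := by
      rw [← C_mul]; push_cast; congr 1; ring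
    rw [e1, e2]
    generalize (∏ j ∈ range m, C (1 / ((j : ℂ) + 1) ^ 2) *
      ((X + C ((j : ℂ) + 1 / 2)) ^ 2 + C (u ^ 2))) = p
    linear_combination -(C ((m.factorial : ℂ) ^ 2) * p * ((X + C ((m : ℂ) + 1 / 2)) ^ 2 + C (u ^ 2))) * h

theorem risingPoly_one_coeff (m : ℕ) :
    (risingPoly 1 m).coeff 0 = m.factorial ∧
      (risingPoly 1 m).coeff 1 = m.factorial * harm 1 m := by
  induction m with
  | zero => simp [risingPoly, coeff_one]
  | succ m ih =>
    rw [risingPoly_succ, mul_add, Nat.factorial_succ, harm_succ]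
    simp only [coeff_add, coeff_mul_C, coeff_mul_X, coeff_mul_X_zero, ih.1, ih.2]
    have := natCast_add_one_ne_zero m
    push_cast
    constructor
    · ring
    · field_simp
      ring

theorem ascPochhammer_eval_neg_natCast (M m : ℕ) :
    (ascPochhammer ℂ m).eval (-(M : ℂ)) = (-1) ^ m * (M.choose m : ℂ) * m.factorial := by
  rw [ascPochhammer_eval_neg_eq_descPochhammer, descPochhammer_eval_eq_descFactorial,
    Nat.descFactorial_eq_factorial_mul_choose]
  push_cast
  ring

theorem deriv_eval_zero (p : ℂ[X]) : deriv (fun α => p.eval α) 0 = p.coeff 1 := by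
  rw [Polynomial.deriv, ← coeff_zero_eq_eval_zero, coeff_derivative]
  simp

theorem iteratedDeriv_two_eval_zero (p : ℂ[X]) :
    iteratedDeriv 2 (fun α => p.eval α) 0 = 2 * p.coeff 2 := by
  rw [iteratedDeriv_succ, iteratedDeriv_one]
  have : deriv (fun α => p.eval α) = fun α => (derivative p).eval α := by
    funext α; exact Polynomial.deriv p
  rw [this, deriv_eval_zero, coeff_derivative]
  norm_num
  ring

theorem hyp3F2_one (M : ℕ) (a b d : ℂ) :
    hyp3F2 M a b 1 d = ∑ m ∈ range (M + 1), (-1) ^ m * (M.choose m : ℂ) *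
      ((ascPochhammer ℂ m).eval a * (ascPochhammer ℂ m).eval b /
        ((ascPochhammer ℂ m).eval d * m.factorial)) := by
  refine sum_congr rfl fun m _ => ?_
  have h : (m.factorial : ℂ) ≠ 0 := by exact_mod_cast m.factorial_ne_zero
  rw [ascPochhammer_eval_neg_natCast, ascPochhammer_eval_one]
  by_cases hd : (ascPochhammer ℂ m).eval d = 0
  · simp [hd]
  · field_simp

theorem hyp3F2_one_one (M : ℕ) (a b : ℂ) :
    hyp3F2 M a b 1 1 = ∑ m ∈ range (M + 1), (-1) ^ m * (M.choose m : ℂ) *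
      ((ascPochhammer ℂ m).eval a * (ascPochhammer ℂ m).eval b / (m.factorial : ℂ) ^ 2) := by
  rw [hyp3F2_one]
  simp only [ascPochhammer_eval_one, sq]

variable (N : ℕ) (u : ℂ)

theorem hyp3F2_deformed (M : ℕ) (α : ℂ) :
    hyp3F2 M (1 / 2 + Complex.I * u + α) (1 / 2 - Complex.I * u + α) 1 1 =
      (∑ m ∈ range (M + 1), C ((-1) ^ m * (M.choose m : ℂ)) * deformedBasis m u).eval α := by
  rw [hyp3F2_one_one, eval_finsetSum]
  refine sum_congr rfl fun m _ => ?_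
  have h : (m.factorial : ℂ) ≠ 0 := by exact_mod_cast m.factorial_ne_zero
  rw [← risingPoly_eval, ← risingPoly_eval, ← eval_mul, risingPoly_mul, eval_mul, eval_mul, eval_C,
    eval_C]
  field_simp

theorem baxterQ0_eq_sum :
    baxterQ0 N u = ∑ m ∈ range (N / 2 + 1), (-1) ^ m * ((N / 2).choose m : ℂ) * basisFun m u := by
  have h := hyp3F2_deformed u (N / 2) 0
  rw [add_zero, add_zero, ← coeff_zero_eq_eval_zero, finsetSum_coeff] at h
  rw [baxterQ0, h]
  simp only [coeff_C_mul, deformedBasis_coeff_zero]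

theorem G23_eq_sum :
    G23 N u = 2 * ∑ m ∈ range (N / 2 + 1), (-1) ^ m * ((N / 2).choose m : ℂ) *
      (deformedBasis m u).coeff 2 := by
  unfold G23
  simp only [hyp3F2_deformed]
  rw [iteratedDeriv_two_eval_zero, finsetSum_coeff]
  simp only [coeff_C_mul]

theorem deformedBasis_coeff_one_eq (m : ℕ) :
    (risingPoly (1 / 2 + Complex.I * u) m).coeff 1 * (risingPoly (1 / 2 - Complex.I * u) m).coeff 0
      + (risingPoly (1 / 2 + Complex.I * u) m).coeff 0
        * (risingPoly (1 / 2 - Complex.I * u) m).coeff 1 =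
      (m.factorial : ℂ) ^ 2 * (deformedBasis m u).coeff 1 := by
  rw [← coeff_C_mul (deformedBasis m u), ← risingPoly_mul, mul_coeff_one]
  ring

theorem deriv_sum_risingPoly (M : ℕ) (w : ℕ → ℂ) (s t : ℂ) :
    deriv (fun α => ∑ m ∈ range (M + 1), w m *
      ((ascPochhammer ℂ m).eval (s + α) * (ascPochhammer ℂ m).eval t)) 0 =
      ∑ m ∈ range (M + 1), w m * ((risingPoly s m).coeff 1 * (risingPoly t m).coeff 0) := by
  have : (fun α => ∑ m ∈ range (M + 1), w m *
      ((ascPochhammer ℂ m).eval (s + α) * (ascPochhammer ℂ m).eval t)) =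
      fun α => (∑ m ∈ range (M + 1), C (w m * (risingPoly t m).coeff 0) * risingPoly s m).eval α := by
    funext α
    rw [eval_finsetSum]
    refine sum_congr rfl fun m _ => ?_
    rw [eval_mul, eval_C, risingPoly_eval, coeff_zero_eq_eval_zero, risingPoly_eval, add_zero]
    ring
  rw [this, deriv_eval_zero, finsetSum_coeff]
  refine sum_congr rfl fun m _ => ?_
  rw [coeff_C_mul]; ring

/-- Separately the one-sided derivatives need not be even in `u`. By the product rule their sum is
the first-order term of the symmetric deformation, which lies in the even basis. -/
theorem G11_add_G12 :
    G11 N u + G12 N u = ∑ m ∈ range (N / 2 + 1), (-1) ^ m * ((N / 2).choose m : ℂ) *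
      (deformedBasis m u).coeff 1 := by
  have h1 := deriv_sum_risingPoly (N / 2)
    (fun m => (-1) ^ m * ((N / 2).choose m : ℂ) / (m.factorial : ℂ) ^ 2)
    (1 / 2 + Complex.I * u) (1 / 2 - Complex.I * u)
  have h2 := deriv_sum_risingPoly (N / 2)
    (fun m => (-1) ^ m * ((N / 2).choose m : ℂ) / (m.factorial : ℂ) ^ 2)
    (1 / 2 - Complex.I * u) (1 / 2 + Complex.I * u)
  have e1 : G11 N u = _ := (congrArg (fun f => deriv f 0) (funext fun α => ?_)).trans h1
  have e2 : G12 N u = _ := (congrArg (fun f => deriv f 0) (funext fun α => ?_)).trans h2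
  · rw [e1, e2, ← sum_add_distrib]
    refine sum_congr rfl fun m _ => ?_
    have h : (m.factorial : ℂ) ≠ 0 := by exact_mod_cast m.factorial_ne_zero
    have := deformedBasis_coeff_one_eq u m
    rw [← mul_add, mul_comm ((risingPoly (1 / 2 - Complex.I * u) m).coeff 1), this]
    field_simp
  · rw [hyp3F2_one_one]
    exact sum_congr rfl fun m _ => by ring
  · rw [hyp3F2_one_one]
    exact sum_congr rfl fun m _ => by ring

/-- Only `1/(1 + β)_m` depends on `β`, and its derivative at `0` is `-H_1(m)/m!`. -/
theorem hasDerivAt_hyp3F2 (M : ℕ) (a b : ℂ) :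
    HasDerivAt (fun β => hyp3F2 M a b 1 (1 + β))
      (∑ m ∈ range (M + 1), -((-1) ^ m * (M.choose m : ℂ) / (m.factorial : ℂ) ^ 2 * harm 1 m) *
        ((ascPochhammer ℂ m).eval a * (ascPochhammer ℂ m).eval b)) 0 := by
  simp only [hyp3F2_one]
  refine HasDerivAt.fun_sum fun m _ => ?_
  have h : (m.factorial : ℂ) ≠ 0 := by exact_mod_cast m.factorial_ne_zero
  have h0 := (risingPoly_one_coeff m).1
  have h1 := (risingPoly_one_coeff m).2
  rw [coeff_zero_eq_eval_zero] at h0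
  have hd : HasDerivAt (fun β => (risingPoly 1 m).eval β) ((m.factorial : ℂ) * harm 1 m) 0 := by
    have := (risingPoly 1 m).hasDerivAt 0
    rwa [← coeff_zero_eq_eval_zero, coeff_derivative, Nat.cast_zero, zero_add, zero_add, h1, mul_one] at this
  have h2 := ((hd.mul_const (m.factorial : ℂ)).fun_inv (by rw [h0]; exact mul_ne_zero h h)).const_mul
    ((-1) ^ m * (M.choose m : ℂ) * ((ascPochhammer ℂ m).eval a * (ascPochhammer ℂ m).eval b))
  simp only [risingPoly_eval] at h2
  rw [← risingPoly_eval, h0] at h2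
  refine (h2.congr_deriv ?_).congr_of_eventuallyEq (Filter.Eventually.of_forall fun β => ?_)
  · field_simp
  · simp only [div_eq_mul_inv]
    ring

theorem G21_add_G22 :
    G21 N u + G22 N u = ∑ m ∈ range (N / 2 + 1), -((-1) ^ m * ((N / 2).choose m : ℂ) * harm 1 m) *
      (deformedBasis m u).coeff 1 := by
  have h1 := deriv_sum_risingPoly (N / 2)
    (fun m => -((-1) ^ m * ((N / 2).choose m : ℂ) / (m.factorial : ℂ) ^ 2 * harm 1 m))
    (1 / 2 + Complex.I * u) (1 / 2 - Complex.I * u)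
  have h2 := deriv_sum_risingPoly (N / 2)
    (fun m => -((-1) ^ m * ((N / 2).choose m : ℂ) / (m.factorial : ℂ) ^ 2 * harm 1 m))
    (1 / 2 - Complex.I * u) (1 / 2 + Complex.I * u)
  have e1 : G21 N u = _ := (congrArg (fun f => deriv f 0) (funext fun α => ?_)).trans h1
  have e2 : G22 N u = _ := (congrArg (fun f => deriv f 0) (funext fun α => ?_)).trans h2
  · rw [e1, e2, ← sum_add_distrib]
    refine sum_congr rfl fun m _ => ?_
    have h : (m.factorial : ℂ) ≠ 0 := by exact_mod_cast m.factorial_ne_zero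
    have := deformedBasis_coeff_one_eq u m
    rw [← mul_add, mul_comm ((risingPoly (1 / 2 - Complex.I * u) m).coeff 1), this]
    field_simp
  · rw [(hasDerivAt_hyp3F2 _ _ _).deriv]
    exact sum_congr rfl fun m _ => by ring
  · exact (hasDerivAt_hyp3F2 _ _ _).deriv

/-! ### The next-to-leading Baxter function in the even basis -/

theorem harmonicSum_cons_succ (a : ℤ) (l : List ℤ) (n : ℕ) :
    harmonicSum (a :: l) (n + 1) = harmonicSum (a :: l) n +
      ((a.sign : ℚ) ^ (n + 1) / ((n + 1 : ℕ) : ℚ) ^ a.natAbs) * harmonicSum l (n + 1) := by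
  rw [harmonicSum, sum_Icc_succ_top (by omega), ← harmonicSum]

theorem harmonicSum_cons_zero (a : ℤ) (l : List ℤ) : harmonicSum (a :: l) 0 = 0 := by
  simp [harmonicSum]

theorem harmonicSum_one_cast (n : ℕ) : ((harmonicSum [1] n : ℚ) : ℂ) = harm 1 n := by
  induction n with
  | zero => simp [harmonicSum_cons_zero]
  | succ n ih =>
    rw [harmonicSum_cons_succ, harm_succ]
    push_cast
    rw [ih]
    simp [harmonicSum]

/-- The coefficients of the next-to-leading order Baxter function. -/
def nloCoeff (M k : ℕ) : ℂ :=
  2 * harm 1 M * (harm 1 M - harm 1 k) + 2 * (harm 2 M - harm 2 k)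

theorem sum_range_sum_range_lt (M : ℕ) (F : ℕ → ℕ → ℂ) :
    ∑ m ∈ range (M + 1), ∑ k ∈ range m, F m k =
      ∑ k ∈ range (M + 1), ∑ j ∈ range (M - k), F (k + j + 1) k := by
  rw [Finset.sum_comm' (t' := range (M + 1)) (s' := fun k => Ico (k + 1) (M + 1))]
  · refine sum_congr rfl fun k _ => ?_
    rw [sum_Ico_eq_sum_range, Nat.add_sub_add_right]
    exact sum_congr rfl fun j _ => by rw [add_right_comm]
  · intro m k
    simp only [mem_range, mem_Ico]
    omega

/-- All three kinds of derivative have a denominator `m - k`. Exchanging the sums and putting `m = k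
+ j + 1` leaves, for each `k`, an alternating sum covered by `altSum_inv` and `altSum_harm_mixed`.
-/
theorem baxterQ1_eq_sum :
    baxterQ1 N u = ∑ k ∈ range (N / 2 + 1), (-1) ^ k * ((N / 2).choose k : ℂ) *
      nloCoeff (N / 2) k * basisFun k u := by
  generalize hM : N / 2 = M
  have e : baxterQ1 N u = ∑ m ∈ range (M + 1), ∑ k ∈ range m,
      -((-1) ^ m * (M.choose m : ℂ) * basisFun k u *
        ((3 * harm 1 M - harm 1 m + 2 * (harm 1 (m - k - 1) + harm 1 m - harm 1 k)) /
          ((m : ℂ) - k))) := by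
    have : baxterQ1 N u = -3 * (harmonicSum [1] (N / 2) : ℂ) * (G11 N u + G12 N u)
      - (G21 N u + G22 N u) - G23 N u := by rw [baxterQ1]; ring
    rw [this, G11_add_G12, G21_add_G22, G23_eq_sum, harmonicSum_one_cast, hM, mul_sum, mul_sum,
      ← sum_sub_distrib, ← sum_sub_distrib]
    refine sum_congr rfl fun m _ => ?_
    rw [deformedBasis_coeff_one, deformedBasis_coeff_two]
    simp only [mul_sum]
    rw [← sum_sub_distrib, ← sum_sub_distrib]
    exact sum_congr rfl fun k _ => by ring
  rw [e, sum_range_sum_range_lt]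
  refine sum_congr rfl fun k hk => ?_
  have hk' : k ≤ M := by simpa [Nat.lt_succ_iff] using hk
  have e1 : ∑ j ∈ range (M - k), -((-1) ^ (k + j + 1) * (M.choose (k + j + 1) : ℂ) * basisFun k u *
        ((3 * harm 1 M - harm 1 (k + j + 1) + 2 * (harm 1 (k + j + 1 - k - 1) + harm 1 (k + j + 1)
          - harm 1 k)) / (((k + j + 1 : ℕ) : ℂ) - k))) =
      -(-1) ^ k * basisFun k u * altSum M k (fun j =>
        (3 * harm 1 M - 2 * harm 1 k) * (1 / ((j : ℂ) + 1))
          + (harm 1 (k + j + 1) + 2 * harm 1 j) / ((j : ℂ) + 1)) := by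
    have hz : altSum M k (fun j =>
        (3 * harm 1 M - 2 * harm 1 k) * (1 / ((j : ℂ) + 1))
          + (harm 1 (k + j + 1) + 2 * harm 1 j) / ((j : ℂ) + 1)) =
        ∑ j ∈ range (M - k), (-1) ^ (j + 1) * (M.choose (k + j + 1) : ℂ) *
          ((3 * harm 1 M - 2 * harm 1 k) * (1 / ((j : ℂ) + 1))
          + (harm 1 (k + j + 1) + 2 * harm 1 j) / ((j : ℂ) + 1)) := by
      unfold altSum
      refine (sum_subset (range_mono (Nat.sub_le M k)) fun j _ hj => ?_).symm
      rw [Nat.choose_eq_zero_of_lt (by simp at hj; omega)]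
      simp
    rw [hz, mul_sum]
    refine sum_congr rfl fun j _ => ?_
    rw [show k + j + 1 - k - 1 = j by omega]
    push_cast
    rw [show (k : ℂ) + j + 1 - k = j + 1 by ring]
    ring
  rw [e1, altSum_add, altSum_const_mul, altSum_inv, altSum_harm_mixed, nloCoeff]
  ring

end Hypergeometric

/-! ### The Baxter equations -/

section Baxter
open Polynomial Complex

theorem basisFun_neg (k : ℕ) (u : ℂ) : basisFun k (-u) = basisFun k u := by
  simp [basisFun]

/-- The shift `u → u + i` moves one rising factorial down and the other up by one, so the product
telescopes to `b_m(u)` times two linear factors. -/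
theorem basisFun_succ_add_I (m : ℕ) (u : ℂ) :
    ((m : ℂ) + 1) ^ 2 * basisFun (m + 1) (u + I) =
      -((1 / 2 - I * u + m + 1) * (1 / 2 - I * u + m)) * basisFun m u := by
  induction m with
  | zero =>
    rw [basisFun_succ]
    simp only [basisFun_zero]
    push_cast
    linear_combination (1 + u ^ 2) * I_sq
  | succ m ih =>
    have h1 := basisFun_succ (m + 1) (u + I)
    have h2 := basisFun_succ m u
    rw [h1]
    push_cast at ih ⊢
    refine mul_left_cancel₀ (pow_ne_zero 2 (natCast_add_one_ne_zero m)) ?_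
    have e : ((m : ℂ) + 1 + 1 / 2) ^ 2 + (u + I) ^ 2 =
        (m + 1 / 2 + I * u) * (m + 5 / 2 - I * u) := by
      linear_combination (1 + u ^ 2) * I_sq
    have e2 : ((m : ℂ) + 1 / 2) ^ 2 + u ^ 2 = (m + 1 / 2 + I * u) * (m + 1 / 2 - I * u) := by
      linear_combination u ^ 2 * I_sq
    rw [e]
    rw [e2] at h2
    linear_combination ((m + 1 / 2 + I * u) * (m + 5 / 2 - I * u)) * ih
      + (1 / 2 - I * u + (m + 1) + 1) * (1 / 2 - I * u + (m + 1)) * h2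

theorem basisFun_succ_sub_I (m : ℕ) (u : ℂ) :
    ((m : ℂ) + 1) ^ 2 * basisFun (m + 1) (u - I) =
      -((1 / 2 + I * u + m + 1) * (1 / 2 + I * u + m)) * basisFun m u := by
  have := basisFun_succ_add_I m (-u)
  rw [basisFun_neg, ← basisFun_neg (m + 1)] at this
  rw [show u - I = -(-u + I) by ring, this]
  ring

theorem baxterOp_basisFun_zero (N : ℕ) (u : ℂ) :
    baxterOp N (basisFun 0) u = 2 * I * u * ((0 - N) * basisFun 0 u) := by
  simp only [baxterOp, basisFun_zero]
  ring

/-- Both shifts of `b_{m+1}` are multiples of `b_m`, so the operator is bidiagonal in this basis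
after extracting `2iu`. -/
theorem baxterOp_basisFun_succ (N m : ℕ) (u : ℂ) :
    baxterOp N (basisFun (m + 1)) u =
      2 * I * u * ((2 * (m + 1) - N) * basisFun (m + 1) u - 2 * (m + 1) * basisFun m u) := by
  have h1 := basisFun_succ_add_I m u
  have h2 := basisFun_succ_sub_I m u
  have h3 := basisFun_succ m u
  have h0 := natCast_add_one_ne_zero m
  refine mul_left_cancel₀ (pow_ne_zero 2 h0) ?_
  rw [baxterOp]
  linear_combination (u + I / 2) ^ 2 * h1 - (u - I / 2) ^ 2 * h2
    - (I * (2 * N + 2) * u + 2 * I * u * (2 * (m + 1) - N)) * h3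
    + (I * (m * u + u - 2 * u ^ 3) * basisFun m u) * I_sq

theorem baxterOp_sum (N : ℕ) (s : Finset ℕ) (c : ℕ → ℂ) (f : ℕ → ℂ → ℂ) (u : ℂ) :
    baxterOp N (fun z => ∑ k ∈ s, c k * f k z) u = ∑ k ∈ s, c k * baxterOp N (f k) u := by
  simp only [baxterOp, mul_sum, ← sum_sub_distrib]
  exact sum_congr rfl fun k _ => by ring

theorem choose_succ_mul_cast (M m : ℕ) :
    (M.choose (m + 1) : ℂ) * (m + 1) = M.choose m * (M - m) := by
  rcases le_or_gt m M with h | h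
  · have := Nat.choose_succ_right_eq M m
    rw [← Nat.cast_sub h]
    exact_mod_cast this
  · rw [Nat.choose_eq_zero_of_lt h, Nat.choose_eq_zero_of_lt (h.trans (Nat.lt_succ_self m))]
    simp

/-- The diagonal factor `2(k - M)` turns `binom(M, k)` into `(k+1) binom(M, k+1)`, the weight of the
off-diagonal term coming from `k + 1`. Hence only differences of `t` survive and constant `t` spans
part of the kernel. -/
theorem baxterOp_sum_basisFun (M : ℕ) (t : ℕ → ℂ) (u : ℂ) :
    baxterOp (M + M) (fun z => ∑ k ∈ range (M + 1), (-1) ^ k * (M.choose k : ℂ) * t k * basisFun k z) u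
      = 4 * I * u * ∑ m ∈ range M, (-1) ^ (m + 1) * (M.choose (m + 1) : ℂ) * (m + 1) *
        (t m - t (m + 1)) * basisFun m u := by
  rw [baxterOp_sum, sum_range_succ', baxterOp_basisFun_zero]
  have e : ∀ k ∈ range M, (-1) ^ (k + 1) * (M.choose (k + 1) : ℂ) * t (k + 1) *
      baxterOp (M + M) (basisFun (k + 1)) u =
      4 * I * u * ((-1) ^ (k + 1) * (M.choose (k + 1) : ℂ) * t (k + 1) * (((k + 1 : ℕ) : ℂ) - M) *
        basisFun (k + 1) u)
      + 4 * I * u * ((-1) ^ (k + 1) * (M.choose (k + 1) : ℂ) * (k + 1) * (-t (k + 1)) * basisFun k u) := by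
    intro k _
    rw [baxterOp_basisFun_succ]
    push_cast
    ring
  rw [sum_congr rfl e, sum_add_distrib, ← mul_sum, ← mul_sum]
  have e2 : ∑ k ∈ range M, (-1) ^ (k + 1) * (M.choose (k + 1) : ℂ) * t (k + 1) *
      (((k + 1 : ℕ) : ℂ) - M) * basisFun (k + 1) u + (-1) ^ 0 * (M.choose 0 : ℂ) * t 0 *
        (((0 : ℕ) : ℂ) - M) * basisFun 0 u =
      ∑ m ∈ range M, (-1) ^ (m + 1) * (M.choose (m + 1) : ℂ) * (m + 1) * t m * basisFun m u := by
    rw [← sum_range_succ' (fun k => (-1) ^ k * (M.choose k : ℂ) * t k * ((k : ℂ) - M) * basisFun k u),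
      sum_range_succ, sub_self, mul_zero, zero_mul, add_zero]
    refine sum_congr rfl fun m _ => ?_
    linear_combination ((-1) ^ m * t m * basisFun m u) * choose_succ_mul_cast M m
  have e3 : ∑ m ∈ range M, (-1) ^ (m + 1) * (M.choose (m + 1) : ℂ) * (m + 1) *
        (t m - t (m + 1)) * basisFun m u =
      ∑ m ∈ range M, (-1) ^ (m + 1) * (M.choose (m + 1) : ℂ) * (m + 1) * t m * basisFun m u
      + ∑ m ∈ range M, (-1) ^ (m + 1) * (M.choose (m + 1) : ℂ) * (m + 1) * (-t (m + 1)) * basisFun m u := by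
    rw [← sum_add_distrib]
    exact sum_congr rfl fun m _ => by ring
  rw [e3, ← e2]
  push_cast
  ring

theorem baxterQ0_eq (M : ℕ) (u : ℂ) : baxterQ0 (M + M) u =
    ∑ m ∈ range (M + 1), (-1) ^ m * (M.choose m : ℂ) * (1 : ℕ → ℂ) m * basisFun m u := by
  rw [baxterQ0_eq_sum, show (M + M) / 2 = M by omega]
  simp

theorem baxterQ1_eq (M : ℕ) (u : ℂ) : baxterQ1 (M + M) u =
    ∑ m ∈ range (M + 1), (-1) ^ m * (M.choose m : ℂ) * nloCoeff M m * basisFun m u := by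
  rw [baxterQ1_eq_sum, show (M + M) / 2 = M by omega]

theorem baxterOp_baxterQ0 (M : ℕ) (u : ℂ) : baxterOp (M + M) (baxterQ0 (M + M)) u = 0 := by
  rw [show baxterQ0 (M + M) = _ from funext (baxterQ0_eq M), baxterOp_sum_basisFun]
  simp

theorem baxterNLOSource_eq (M : ℕ) (u : ℂ) : baxterNLOSource (M + M) u =
    8 * I * u * ∑ m ∈ range M, (-1) ^ (m + 1) * (M.choose (m + 1) : ℂ) *
      (harm 1 M + 1 / ((m : ℂ) + 1)) * basisFun m u := by
  have hA : (u + I / 2) * baxterQ0 (M + M) (u + I) + (u - I / 2) * baxterQ0 (M + M) (u - I)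
      - 2 * u * baxterQ0 (M + M) u =
      ∑ m ∈ range M, (-1) ^ (m + 1) * (M.choose (m + 1) : ℂ) * (-4 * u * basisFun m u) := by
    simp only [baxterQ0_eq, mul_sum]
    rw [← sum_add_distrib, ← sum_sub_distrib, sum_range_succ']
    simp only [basisFun_zero]
    have : ∀ k ∈ range M, (u + I / 2) * ((-1) ^ (k + 1) * (M.choose (k + 1) : ℂ) * (1 : ℕ → ℂ) (k + 1) *
        basisFun (k + 1) (u + I)) + (u - I / 2) * ((-1) ^ (k + 1) * (M.choose (k + 1) : ℂ) *
        (1 : ℕ → ℂ) (k + 1) * basisFun (k + 1) (u - I)) - 2 * u * ((-1) ^ (k + 1) *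
        (M.choose (k + 1) : ℂ) * (1 : ℕ → ℂ) (k + 1) * basisFun (k + 1) u) =
        (-1) ^ (k + 1) * (M.choose (k + 1) : ℂ) * (-4 * u * basisFun k u) := by
      intro m _
      have h1 := basisFun_succ_add_I m u
      have h2 := basisFun_succ_sub_I m u
      have h3 := basisFun_succ m u
      have h0 := natCast_add_one_ne_zero m
      refine mul_left_cancel₀ (pow_ne_zero 2 h0) ?_
      rw [Pi.one_apply]
      linear_combination (-1) ^ (m + 1) * (M.choose (m + 1) : ℂ) * ((u + I / 2) * h1
        + (u - I / 2) * h2 - 2 * u * h3 + ((2 * m * u + 2 * u - 2 * u ^ 3) * basisFun m u) * I_sq)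
    rw [sum_congr rfl this]
    ring
  have hB : baxterQ0 (M + M) (u + I) - baxterQ0 (M + M) (u - I) =
      ∑ m ∈ range M, (-1) ^ (m + 1) * (M.choose (m + 1) : ℂ) *
        (4 * I * u * (1 / ((m : ℂ) + 1)) * basisFun m u) := by
    simp only [baxterQ0_eq]
    rw [← sum_sub_distrib, sum_range_succ']
    simp only [basisFun_zero, sub_self, add_zero]
    refine sum_congr rfl fun m _ => ?_
    have h1 := basisFun_succ_add_I m u
    have h2 := basisFun_succ_sub_I m u
    have h0 := natCast_add_one_ne_zero m
    refine mul_left_cancel₀ (pow_ne_zero 2 h0) ?_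
    rw [Pi.one_apply]
    have h4 : ((m : ℂ) + 1) ^ 2 * (1 / ((m : ℂ) + 1)) = m + 1 := by field_simp
    linear_combination (-1) ^ (m + 1) * (M.choose (m + 1) : ℂ) * (h1 - h2
      - 4 * I * u * basisFun m u * h4)
  rw [baxterNLOSource, hA, hB, harmonicSum_one_cast, show (M + M) / 2 = M by omega]
  simp only [mul_sum]
  rw [← sum_add_distrib]
  exact sum_congr rfl fun m _ => by ring

/-- Comparing coefficients of `b_m`, the equation reduces to the first difference of `nloCoeff`. -/
theorem baxterOp_baxterQ1 (M : ℕ) (u : ℂ) :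
    baxterOp (M + M) (baxterQ1 (M + M)) u = baxterNLOSource (M + M) u := by
  rw [show baxterQ1 (M + M) = _ from funext (baxterQ1_eq M), baxterOp_sum_basisFun,
    baxterNLOSource_eq, mul_sum, mul_sum]
  refine sum_congr rfl fun m _ => ?_
  have h0 := natCast_add_one_ne_zero m
  rw [nloCoeff, nloCoeff, harm_succ, harm_succ]
  field_simp
  ring

/-! ### Normalization at `i/2` and uniqueness of polynomial solutions -/

theorem basisFun_I_div_two (k : ℕ) : basisFun (k + 1) (I / 2) = 0 := by
  rw [basisFun, basisPoly, eval_prod]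
  refine prod_eq_zero (mem_range.2 k.succ_pos) ?_
  simp only [eval_mul, eval_C, eval_add, eval_X, CharP.cast_eq_zero, zero_mul, zero_add]
  rw [div_pow, I_sq]
  norm_num

theorem baxterQ0_I_div_two (M : ℕ) : baxterQ0 (M + M) (I / 2) = 1 := by
  rw [baxterQ0_eq, sum_range_succ', sum_eq_zero]
  · simp
  · intro k _
    rw [basisFun_I_div_two, mul_zero]

/-- The Baxter equation is a recursion along `i/2 + iℕ` whose coefficient of the value below `i/2`
vanishes, so a single initial value determines the rest. -/
theorem baxterOp_kernel_lattice {N : ℕ} {f : ℂ → ℂ} (h : ∀ z, baxterOp N f z = 0)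
    (h0 : f (I / 2) = 0) (n : ℕ) : f (I / 2 + I * n) = 0 := by
  induction n using Nat.strong_induction_on with
  | _ n ih =>
    match n, ih with
    | 0, _ => simpa using h0
    | 1, _ =>
      -- At `z = i/2` the factor `(z - i/2)²` removes `f(-i/2)`, leaving only `f(3i/2)`.
      have := h (I / 2)
      rw [baxterOp, h0, sub_self] at this
      have h1 : (I / 2 + I / 2) ^ 2 = -1 := by rw [add_halves, I_sq]
      rw [h1] at this
      rw [Nat.cast_one, mul_one]
      linear_combination -this
    | n + 2, ih =>
      have := h (I / 2 + I * ((n + 1 : ℕ) : ℂ))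
      rw [baxterOp, ih (n + 1) (by omega)] at this
      have e1 := ih n (by omega)
      push_cast at this ⊢
      rw [show I / 2 + I * ((n : ℂ) + 1) - I = I / 2 + I * n by ring, e1,
        show I / 2 + I * ((n : ℂ) + 1) + I = I / 2 + I * (n + 2) by ring] at this
      have hne : (I / 2 + I * ((n : ℂ) + 1) + I / 2) ^ 2 ≠ 0 := by
        have : I / 2 + I * ((n : ℂ) + 1) + I / 2 = I * ((n + 1 : ℕ) + 1) := by push_cast; ring
        rw [this]
        exact pow_ne_zero 2 (mul_ne_zero I_ne_zero (natCast_add_one_ne_zero _))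
      simpa [hne] using this

theorem eq_zero_of_baxterOp_eq_zero {N : ℕ} {p : ℂ[X]} (h : ∀ z, baxterOp N (fun w => p.eval w) z = 0)
    (h0 : p.eval (I / 2) = 0) : p = 0 := by
  refine Polynomial.eq_zero_of_infinite_isRoot p (Set.Infinite.mono ?_
    (Set.infinite_range_of_injective (f := fun n : ℕ => I / 2 + I * (n : ℂ)) ?_))
  · rintro _ ⟨n, rfl⟩
    exact baxterOp_kernel_lattice h h0 n
  · intro a b hab
    have := mul_left_cancel₀ I_ne_zero (add_left_cancel hab)
    exact_mod_cast this

/-! ### Polynomials in the spectral parameter -/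

/-- The combination `∑_k (-1)^k binom(M, k) t_k P_k` of the basis polynomials. -/
def binomialPoly (M : ℕ) (t : ℕ → ℂ) : ℂ[X] :=
  ∑ k ∈ range (M + 1), C ((-1) ^ k * (M.choose k : ℂ) * t k) * basisPoly k

theorem eval_binomialPoly (M : ℕ) (t : ℕ → ℂ) (u : ℂ) :
    (binomialPoly M t).eval (1 / 4 + u ^ 2) =
      ∑ k ∈ range (M + 1), (-1) ^ k * (M.choose k : ℂ) * t k * basisFun k u := by
  simp [binomialPoly, eval_finsetSum, basisFun]

theorem degree_basisPoly (k : ℕ) : (basisPoly k).degree = k := by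
  rw [basisPoly, degree_prod]
  have : ∀ j ∈ range k, (C (1 / ((j : ℂ) + 1) ^ 2) * (C ((j : ℂ) * (j + 1)) + X)).degree = 1 := by
    intro j _
    rw [degree_C_mul (one_div_ne_zero (pow_ne_zero 2 (natCast_add_one_ne_zero j))), add_comm,
      degree_X_add_C]
  rw [sum_congr rfl this]
  simp

theorem degree_C_mul_basisPoly_le (c : ℂ) (k : ℕ) : (C c * basisPoly k).degree ≤ k := by
  refine (degree_mul_le _ _).trans ((add_le_add degree_C_le (degree_basisPoly k).le).trans ?_)
  rw [zero_add]

theorem degree_binomialPoly_range_lt (M : ℕ) (t : ℕ → ℂ) :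
    (∑ k ∈ range M, C ((-1) ^ k * (M.choose k : ℂ) * t k) * basisPoly k).degree < M := by
  rw [← mem_degreeLT]
  refine Submodule.sum_mem _ fun k hk => ?_
  rw [mem_degreeLT]
  exact (degree_C_mul_basisPoly_le _ k).trans_lt (by exact_mod_cast mem_range.1 hk)

theorem degree_binomialPoly_one (M : ℕ) : (binomialPoly M 1).degree = M := by
  have h : (C ((-1) ^ M * (M.choose M : ℂ) * (1 : ℕ → ℂ) M) * basisPoly M).degree = M := by
    rw [degree_C_mul (by simp), degree_basisPoly]
  rw [binomialPoly, sum_range_succ, degree_add_eq_right_of_degree_lt, h]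
  rw [h]
  exact degree_binomialPoly_range_lt M 1

/-- Applied to `nloCoeff M`, which vanishes at `k = M`: thus `Q⁽¹⁾` has degree below `N`, as the
interpolation at the `N` roots requires. -/
theorem degree_binomialPoly_lt {M : ℕ} {t : ℕ → ℂ} (h : t M = 0) : (binomialPoly M t).degree < M := by
  rw [binomialPoly, sum_range_succ, h]
  simpa using degree_binomialPoly_range_lt M t

/-- The even polynomial in `u` obtained from a polynomial in `1/4 + u²`. -/
def spectralPoly (p : ℂ[X]) : ℂ[X] := p.comp (C (1 / 4) + X ^ 2)

theorem eval_spectralPoly (p : ℂ[X]) (u : ℂ) : (spectralPoly p).eval u = p.eval (1 / 4 + u ^ 2) := by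
  simp [spectralPoly]

theorem natDegree_spectralPoly (p : ℂ[X]) : (spectralPoly p).natDegree = p.natDegree * 2 := by
  rw [spectralPoly, natDegree_comp]
  congr 1
  rw [natDegree_C_add, natDegree_X_pow]

theorem eval_spectralPoly_Q0 (M : ℕ) (u : ℂ) :
    (spectralPoly (binomialPoly M 1)).eval u = baxterQ0 (M + M) u := by
  rw [eval_spectralPoly, eval_binomialPoly, baxterQ0_eq]

theorem eval_spectralPoly_Q1 (M : ℕ) (u : ℂ) :
    (spectralPoly (binomialPoly M (nloCoeff M))).eval u = baxterQ1 (M + M) u := by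
  rw [eval_spectralPoly, eval_binomialPoly, baxterQ1_eq]

theorem degree_spectralPoly_Q1_lt (M : ℕ) :
    (spectralPoly (binomialPoly M (nloCoeff M))).degree < (M + M : ℕ) := by
  have h := degree_binomialPoly_lt (M := M) (t := nloCoeff M) (by simp [nloCoeff])
  by_cases h0 : binomialPoly M (nloCoeff M) = 0
  · rw [h0, spectralPoly, zero_comp, degree_zero]
    exact WithBot.bot_lt_coe _
  · have h1 : (binomialPoly M (nloCoeff M)).natDegree < M := (natDegree_lt_iff_degree_lt h0).2 h
    refine degree_le_natDegree.trans_lt ?_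
    rw [natDegree_spectralPoly]
    exact_mod_cast (by omega : (binomialPoly M (nloCoeff M)).natDegree * 2 < M + M)

theorem natDegree_spectralPoly_Q0 (M : ℕ) :
    (spectralPoly (binomialPoly M 1)).natDegree = M + M := by
  rw [natDegree_spectralPoly, natDegree_eq_of_degree_eq_some (degree_binomialPoly_one M)]
  ring

theorem eval_eq_mul_baxterQ0 {M : ℕ} {p : ℂ[X]}
    (h : ∀ z, baxterOp (M + M) (fun w => p.eval w) z = 0) :
    p = C (p.eval (I / 2)) * spectralPoly (binomialPoly M 1) := by
  rw [← sub_eq_zero]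
  refine eq_zero_of_baxterOp_eq_zero (N := M + M) (fun z => ?_) ?_
  · have h2 := baxterOp_baxterQ0 M z
    have h1 := h z
    simp only [baxterOp, eval_sub, eval_mul, eval_C, eval_spectralPoly_Q0] at h1 h2 ⊢
    linear_combination h1 - p.eval (I / 2) * h2
  · rw [eval_sub, eval_mul, eval_C, eval_spectralPoly_Q0, baxterQ0_I_div_two]
    ring

end Baxter

section Recurrence
open Polynomial ComplexConjugate

/-! ### The three-term recurrence, and the roots of the leading order Baxter function -/

/-- The numerator `M² (R_M - R_{M-1})` of the discrete derivative of `R_M = binomialPoly M 1`. -/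
def binomialDiff (M : ℕ) : ℂ[X] :=
  ∑ k ∈ range (M + 1), C ((-1) ^ k * ((M : ℂ) * k * M.choose k)) * basisPoly k

theorem binomialPoly_one_eq {M L : ℕ} (h : M ≤ L) :
    binomialPoly M 1 = ∑ k ∈ range (L + 1), C ((-1) ^ k * (M.choose k : ℂ)) * basisPoly k := by
  rw [binomialPoly]
  simp only [Pi.one_apply, mul_one]
  refine sum_subset (range_mono (by omega)) fun k _ hk => ?_
  rw [Nat.choose_eq_zero_of_lt (by simp at hk; omega)]
  simp

theorem binomialPoly_succ_sub (M : ℕ) :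
    C (((M : ℂ) + 1) ^ 2) * (binomialPoly (M + 1) 1 - binomialPoly M 1) = binomialDiff (M + 1) := by
  rw [binomialPoly_one_eq le_rfl, binomialPoly_one_eq (Nat.le_succ M), ← sum_sub_distrib, mul_sum,
    binomialDiff]
  refine sum_congr rfl fun k _ => ?_
  rw [← sub_mul, ← C_sub, ← mul_assoc, ← C_mul]
  congr 2
  cases k with
  | zero => simp
  | succ k =>
    have h1 := choose_succ_mul_cast M k
    rw [Nat.choose_succ_succ']
    push_cast
    linear_combination (-1) ^ k * (M + 1) * h1

/-- With `binomialPoly_succ_sub` this is a discrete Sturm-Liouville equation in `M` with eigenvalue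
`e`; equivalently, a three-term recurrence. -/
theorem binomialDiff_succ (M : ℕ) :
    binomialDiff (M + 1) = binomialDiff M - X * binomialPoly M 1 := by
  have h1 : binomialDiff (M + 1) = ∑ k ∈ range (M + 1),
      C ((-1) ^ (k + 1) * (((M : ℂ) + 1) * (k + 1) * (M + 1).choose (k + 1))) * basisPoly (k + 1) := by
    rw [binomialDiff, sum_range_succ']
    simp
  have h2 : binomialDiff M = ∑ k ∈ range (M + 1),
      C ((-1) ^ (k + 1) * ((M : ℂ) * (k + 1) * M.choose (k + 1))) * basisPoly (k + 1) := by
    rw [binomialDiff, sum_range_succ', sum_range_succ _ M, Nat.choose_succ_self]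
    simp
  have h3 : X * binomialPoly M 1 = ∑ k ∈ range (M + 1),
      C ((-1) ^ k * (M.choose k : ℂ) * (k + 1) ^ 2) * basisPoly (k + 1)
      - ∑ k ∈ range (M + 1),
      C ((-1) ^ (k + 1) * (M.choose (k + 1) : ℂ) * ((k + 1) * (k + 2))) * basisPoly (k + 1) := by
    have h4 : ∑ k ∈ range (M + 1),
        C ((-1) ^ (k + 1) * (M.choose (k + 1) : ℂ) * ((k + 1) * (k + 2))) * basisPoly (k + 1) =
        ∑ k ∈ range (M + 1), C ((-1) ^ k * (M.choose k : ℂ) * (k * (k + 1))) * basisPoly k := by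
      rw [sum_range_succ, sum_range_succ', Nat.choose_succ_self]
      simp only [CharP.cast_eq_zero, mul_zero, zero_mul, map_zero, add_zero]
      refine sum_congr rfl fun k _ => ?_
      congr 3
      push_cast
      ring
    rw [h4, binomialPoly_one_eq le_rfl, mul_sum, ← sum_sub_distrib]
    refine sum_congr rfl fun k _ => ?_
    have := basisPoly_succ k
    simp only [C_mul] at this ⊢
    linear_combination (-(C ((-1) ^ k) * C (M.choose k : ℂ))) * this
  rw [h1, h2, h3, sub_sub_eq_add_sub, ← sum_add_distrib, ← sum_sub_distrib]
  refine sum_congr rfl fun k _ => ?_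
  rw [← add_mul, ← sub_mul, ← C_add, ← C_sub]
  congr 2
  have h1 := choose_succ_mul_cast M k
  rw [Nat.choose_succ_succ']
  push_cast
  linear_combination (-1) ^ k * (k + 1) * h1

@[simp] theorem binomialDiff_zero : binomialDiff 0 = 0 := by simp [binomialDiff]

@[simp] theorem binomialPoly_zero_one : binomialPoly 0 1 = 1 := by simp [binomialPoly]

/-! ### Energy identity, Hardy inequality, reality and simplicity of the roots -/

variable (e : ℂ)

theorem eval_binomialDiff_succ (n : ℕ) : (binomialDiff (n + 1)).eval e =
    (binomialDiff n).eval e - e * (binomialPoly n 1).eval e := by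
  rw [binomialDiff_succ]; simp

theorem eval_binomialDiff_succ' (n : ℕ) : (binomialDiff (n + 1)).eval e =
    ((n : ℂ) + 1) ^ 2 * ((binomialPoly (n + 1) 1).eval e - (binomialPoly n 1).eval e) := by
  rw [← binomialPoly_succ_sub]; simp

/-- Summation by parts of the Sturm-Liouville equation against the conjugate of the solution. The
boundary term disappears when `e` is a root of `R_M = binomialPoly M 1`. -/
theorem dirichlet_identity (M : ℕ) :
    e * ((∑ n ∈ range M, Complex.normSq ((binomialPoly n 1).eval e) : ℝ) : ℂ)
      + (binomialDiff M).eval e * conj ((binomialPoly M 1).eval e) =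
      ((∑ n ∈ range M, ((n : ℝ) + 1) ^ 2 *
        Complex.normSq ((binomialPoly (n + 1) 1).eval e - (binomialPoly n 1).eval e) : ℝ) : ℂ) := by
  induction M with
  | zero => simp
  | succ n ih =>
    rw [sum_range_succ, sum_range_succ]
    push_cast at ih ⊢
    rw [← ih, ← Complex.mul_conj, ← Complex.mul_conj, map_sub]
    have h1 := eval_binomialDiff_succ e n
    have h2 := eval_binomialDiff_succ' e n
    linear_combination (conj ((binomialPoly n 1).eval e)) * h1
      + (conj ((binomialPoly (n + 1) 1).eval e) - conj ((binomialPoly n 1).eval e)) * h2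

theorem hardy_step (m : ℝ) (hm : 1 ≤ m) (a b : ℂ) :
    Complex.normSq a / 4 + (m - 1) / 2 * Complex.normSq a ≤
      m ^ 2 * Complex.normSq (b - a) + m / 2 * Complex.normSq b := by
  simp only [Complex.normSq_apply, Complex.sub_re, Complex.sub_im]
  have key : ∀ x y : ℝ, (x * x) / 4 + (m - 1) / 2 * (x * x) ≤
      m ^ 2 * ((y - x) * (y - x)) + m / 2 * (y * y) := by
    intro x y
    have h1 : 0 ≤ (m ^ 2 + m / 2) * (m ^ 2 * ((y - x) * (y - x)) + m / 2 * (y * y)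
        - ((x * x) / 4 + (m - 1) / 2 * (x * x))) := by
      have : (m ^ 2 + m / 2) * (m ^ 2 * ((y - x) * (y - x)) + m / 2 * (y * y)
        - ((x * x) / 4 + (m - 1) / 2 * (x * x))) =
          ((m ^ 2 + m / 2) * y - m ^ 2 * x) ^ 2 +
            ((m ^ 2 + m / 2) * (m ^ 2 - 1 / 4 - (m - 1) / 2) - m ^ 4) * x ^ 2 := by ring
      rw [this]
      -- The right-hand side equals `m / 8`.
      have : 0 ≤ (m ^ 2 + m / 2) * (m ^ 2 - 1 / 4 - (m - 1) / 2) - m ^ 4 := by nlinarith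
      positivity
    have h2 : 0 < m ^ 2 + m / 2 := by positivity
    have := nonneg_of_mul_nonneg_right h1 h2
    linarith
  have := key a.re b.re
  have := key a.im b.im
  linarith

/-- The boundary weight `(M+1)/2` makes the inequality inductive, `hardy_step` passing it from one
index to the next. Strictness comes from the first step and `r 0 = 1`. -/
theorem hardy_inequality (r : ℕ → ℂ) (h0 : r 0 = 1) (M : ℕ) :
    (∑ n ∈ range (M + 1), Complex.normSq (r n)) / 4 <
      ∑ n ∈ range (M + 1), ((n : ℝ) + 1) ^ 2 * Complex.normSq (r (n + 1) - r n)
        + ((M : ℝ) + 1) / 2 * Complex.normSq (r (M + 1)) := by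
  induction M with
  | zero =>
    simp only [zero_add, sum_range_one, h0, CharP.cast_eq_zero, Complex.normSq_apply,
      Complex.sub_re, Complex.sub_im, Complex.one_re, Complex.one_im]
    -- The quadratic in `r 1` is minimal at `2/3`, with value `1/3 > 1/4`.
    nlinarith [sq_nonneg ((r 1).re - 2 / 3), sq_nonneg ((r 1).im)]
  | succ M ih =>
    rw [sum_range_succ, sum_range_succ (fun n => ((n : ℝ) + 1) ^ 2 * _)]
    have := hardy_step ((M : ℝ) + 2) (by linarith [(Nat.cast_nonneg M : (0 : ℝ) ≤ M)])
      (r (M + 1)) (r (M + 1 + 1))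
    push_cast
    linear_combination ih + this

/-- At a root the energy identity reads `e A = B` with `A ≥ 1` and `B` real, so `e` is real; Hardy's
inequality gives `B > A / 4`. -/
theorem root_real_of_eval_eq_zero {M : ℕ} {e : ℂ} (h : (binomialPoly M 1).eval e = 0) :
    e.im = 0 ∧ 1 / 4 < e.re := by
  cases M with
  | zero => simp at h
  | succ M =>
    have h1 := dirichlet_identity e (M + 1)
    have h2 := hardy_inequality (fun n => (binomialPoly n 1).eval e) (by simp) M
    rw [h] at h1 h2
    simp only [map_zero, mul_zero, add_zero] at h1 h2
    set A := ∑ n ∈ range (M + 1), Complex.normSq ((binomialPoly n 1).eval e) with hA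
    set B := ∑ n ∈ range (M + 1), ((n : ℝ) + 1) ^ 2 *
        Complex.normSq ((binomialPoly (n + 1) 1).eval e - (binomialPoly n 1).eval e)
    have hpos : 1 ≤ A := by
      rw [hA, sum_range_succ']
      simp only [binomialPoly_zero_one, eval_one, map_one]
      linarith [sum_nonneg (s := range M) fun n _ =>
        Complex.normSq_nonneg ((binomialPoly (n + 1) 1).eval e)]
    have him := congrArg Complex.im h1
    have hre := congrArg Complex.re h1
    simp only [Complex.mul_im, Complex.mul_re, Complex.ofReal_re, Complex.ofReal_im, mul_zero,
      zero_add, sub_zero] at him hre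
    constructor
    · rcases mul_eq_zero.1 him with h | h
      · exact h
      · linarith
    · nlinarith

theorem eval_im_eq_zero {e : ℂ} (he : e.im = 0) (n : ℕ) :
    ((binomialPoly n 1).eval e).im = 0 ∧ ((binomialDiff n).eval e).im = 0 := by
  induction n with
  | zero => simp
  | succ n ih =>
    have h1 : ((binomialDiff (n + 1)).eval e).im = 0 := by
      rw [eval_binomialDiff_succ]
      simp [Complex.mul_im, he, ih.1, ih.2]
    refine ⟨?_, h1⟩
    rw [eval_binomialDiff_succ', show ((n : ℂ) + 1) ^ 2 = ((((n : ℝ) + 1) ^ 2 : ℝ) : ℂ) by push_cast; rfl,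
      Complex.im_ofReal_mul, Complex.sub_im, ih.1, sub_zero] at h1
    exact (mul_eq_zero.1 h1).resolve_left (by positivity)

/-- The confluent Christoffel-Darboux identity for the recurrence. -/
theorem wronskian_eq (M : ℕ) :
    derivative (binomialDiff M) * binomialPoly M 1 - binomialDiff M * derivative (binomialPoly M 1) =
      -∑ k ∈ range M, binomialPoly k 1 ^ 2 := by
  induction M with
  | zero => simp
  | succ M ih =>
    have h0 : C (((M : ℂ) + 1) ^ 2) ≠ 0 := by
      rw [Ne, C_eq_zero]; exact pow_ne_zero 2 (natCast_add_one_ne_zero M)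
    have h1 := binomialPoly_succ_sub M
    have h1' := congrArg derivative h1
    have h2 := binomialDiff_succ M
    have h2' := congrArg derivative h2
    rw [derivative_C_mul, derivative_sub] at h1'
    rw [derivative_sub, derivative_mul, derivative_X, one_mul] at h2'
    rw [sum_range_succ, neg_add, ← ih]
    -- `R_{M+1} - R_M` is proportional to `D_{M+1}`, so exchanging the two does not change the
    -- Wronskian with `D_{M+1}`.
    have key : derivative (binomialDiff (M + 1)) * binomialPoly (M + 1) 1
        - binomialDiff (M + 1) * derivative (binomialPoly (M + 1) 1) =
        derivative (binomialDiff (M + 1)) * binomialPoly M 1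
        - binomialDiff (M + 1) * derivative (binomialPoly M 1) := by
      refine mul_left_cancel₀ h0 ?_
      linear_combination derivative (binomialDiff (M + 1)) * h1 - binomialDiff (M + 1) * h1'
    rw [key]
    linear_combination (binomialPoly M 1) * h2' - derivative (binomialPoly M 1) * h2

/-- At a double root the sum of the `R_k(e)²` would vanish; but `e` is real, hence every `R_k(e)`
is, and `R_0 = 1`. -/
theorem derivative_eval_ne_zero {M : ℕ} {e : ℂ} (h : (binomialPoly M 1).eval e = 0) :
    (derivative (binomialPoly M 1)).eval e ≠ 0 := by
  intro h'
  have hw := congrArg (eval e) (wronskian_eq M)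
  simp only [eval_sub, eval_mul, h, h', mul_zero, sub_zero, eval_neg, eval_finsetSum, eval_pow] at hw
  have him := (root_real_of_eval_eq_zero h).1
  have hM : M ≠ 0 := by rintro rfl; simp at h
  obtain ⟨m, rfl⟩ := Nat.exists_eq_succ_of_ne_zero hM
  have hs : ∑ k ∈ range (m + 1), ((binomialPoly k 1).eval e) ^ 2 =
      ((∑ k ∈ range (m + 1), ((binomialPoly k 1).eval e).re ^ 2 : ℝ) : ℂ) := by
    push_cast
    refine sum_congr rfl fun k _ => ?_
    congr 1
    apply Complex.ext <;> simp [(eval_im_eq_zero him k).1]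
  rw [hs] at hw
  have hpos : 0 < ∑ k ∈ range (m + 1), ((binomialPoly k 1).eval e).re ^ 2 := by
    rw [sum_range_succ']
    have : 0 ≤ ∑ k ∈ range m, ((binomialPoly (k + 1) 1).eval e).re ^ 2 :=
      sum_nonneg fun _ _ => sq_nonneg _
    simp
    linarith
  have : ((∑ k ∈ range (m + 1), ((binomialPoly k 1).eval e).re ^ 2 : ℝ) : ℂ) = 0 := by
    simpa using hw.symm
  exact hpos.ne' (by exact_mod_cast this)

theorem spectralPoly_root {M : ℕ} {u : ℂ} (h : (spectralPoly (binomialPoly M 1)).eval u = 0) :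
    u.im = 0 ∧ (derivative (spectralPoly (binomialPoly M 1))).eval u ≠ 0 := by
  rw [eval_spectralPoly] at h
  obtain ⟨h1, h2⟩ := root_real_of_eval_eq_zero h
  have h3 : (u ^ 2).im = 0 ∧ 0 < (u ^ 2).re := by
    constructor
    · simpa using h1
    · have : (1 / 4 + u ^ 2 : ℂ).re = 1 / 4 + (u ^ 2).re := by
        rw [Complex.add_re]; norm_num
      linarith
  have him : u.im = 0 := by
    obtain ⟨h4, h5⟩ := h3
    simp only [sq, Complex.mul_im, Complex.mul_re] at h4 h5
    have : u.re * u.im = 0 := by linarith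
    rcases mul_eq_zero.1 this with h6 | h6
    · rw [h6] at h5; nlinarith [mul_self_nonneg u.im]
    · exact h6
  refine ⟨him, ?_⟩
  have hu : u ≠ 0 := by rintro rfl; simp at h3
  rw [spectralPoly, derivative_comp, eval_mul, eval_comp]
  simp only [derivative_add, derivative_C, zero_add, derivative_X_pow, eval_mul, eval_add, eval_C,
    eval_pow, eval_X]
  exact mul_ne_zero (by simp [hu]) (derivative_eval_ne_zero h)

/-! ### Expansions at `u = ± i / 2` -/

theorem coeff_succ_X_add_X_sq_mul (p : ℂ[X]) (n : ℕ) :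
    ((X + X ^ 2) * p).coeff (n + 2) = p.coeff (n + 1) + p.coeff n := by
  rw [add_mul, coeff_add, sq, mul_assoc, coeff_X_mul, coeff_X_mul, coeff_X_mul]

/-- For `u = ±(i/2 + ia)` one has `e = -(a + a²)`. The two recurrences in `M` propagate the first
four Taylor coefficients in `a` simultaneously. -/
theorem expansion_binomialPoly (M : ℕ) :
    let R := (binomialPoly M 1).comp (-(X + X ^ 2))
    let D := (binomialDiff M).comp (-(X + X ^ 2))
    (R.coeff 0 = 1 ∧ R.coeff 1 = harm 1 M ∧ R.coeff 2 = (harm 1 M ^ 2 + harm 2 M) / 2 ∧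
      R.coeff 3 = harm 1 M ^ 3 / 6 + harm 1 M * harm 2 M / 2 + harm 3 M / 3 - harmNested M) ∧
    (D.coeff 0 = 0 ∧ D.coeff 1 = M ∧ D.coeff 2 = M * harm 1 M ∧
      D.coeff 3 = M * ((harm 1 M ^ 2 + harm 2 M) / 2) - harm 1 M) := by
  induction M with
  | zero => simp [coeff_one, harmNested]
  | succ M ih =>
    obtain ⟨⟨r0, r1, r2, r3⟩, d0, d1, d2, d3⟩ := ih
    have h1 := congrArg (fun p => p.comp (-(X + X ^ 2))) (binomialPoly_succ_sub M)
    have h2 := congrArg (fun p => p.comp (-(X + X ^ 2))) (binomialDiff_succ M)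
    simp only [mul_comp, sub_comp, C_comp, X_comp, neg_mul, sub_neg_eq_add] at h1 h2
    have e0 := congrArg (coeff · 0) h2
    have e1 := congrArg (coeff · 1) h2
    have e2 := congrArg (coeff · 2) h2
    have e3 := congrArg (coeff · 3) h2
    have f0 := congrArg (coeff · 0) h1
    have f1 := congrArg (coeff · 1) h1
    have f2 := congrArg (coeff · 2) h1
    have f3 := congrArg (coeff · 3) h1
    have c0 : ∀ p : ℂ[X], ((X + X ^ 2) * p).coeff 0 = 0 := by simp [mul_coeff_zero]
    have c1 : ∀ p : ℂ[X], ((X + X ^ 2) * p).coeff 1 = p.coeff 0 := by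
      intro p
      rw [add_mul, coeff_add, sq, mul_assoc, coeff_X_mul, coeff_X_mul, coeff_X_mul_zero, add_zero]
    have c2 := fun p => coeff_succ_X_add_X_sq_mul p 0
    have c3 := fun p => coeff_succ_X_add_X_sq_mul p 1
    norm_num at c2 c3
    simp only [coeff_add, coeff_C_mul, coeff_sub, c0, c1, c2, c3, r0, r1, r2, r3, d0, d1, d2, d3]
      at e0 e1 e2 e3 f0 f1 f2 f3
    rw [e0] at f0
    rw [e1] at f1
    rw [e2] at f2
    rw [e3] at f3
    have h0 := natCast_add_one_ne_zero M
    have hne := pow_ne_zero 2 h0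
    dsimp only
    simp only [harm_succ, harmNested_succ, div_eq_mul_inv, ← inv_pow]
    have hp := mul_inv_cancel₀ h0
    have hM : (M : ℂ) = (M + 1) - 1 := by ring
    push_cast
    rw [hM] at e1 e2 e3 f1 f2 f3 ⊢
    simp only [sub_add_cancel] at e1 e2 e3 f1 f2 f3 ⊢
    generalize (M : ℂ) + 1 = m at *
    generalize m⁻¹ = p at *
    refine ⟨⟨mul_left_cancel₀ hne ?_, mul_left_cancel₀ hne ?_, mul_left_cancel₀ hne ?_,
      mul_left_cancel₀ hne ?_⟩, ?_, ?_, ?_, ?_⟩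
    · linear_combination f0
    · linear_combination f1 - m * hp
    · linear_combination f2 - (harm 1 M * m + (m * p + 1)) * hp
    · linear_combination f3 - m * ((harm 1 M ^ 2 + harm 2 M) / 2) * hp
    · linear_combination e0
    · linear_combination e1
    · linear_combination e2 - hp
    · linear_combination e3 - (harm 1 M + p) * hp

/-- The factor `j = 0` is `e = -(a + a²)`, a simple zero at `a = 0`; the other factors at `a = 0`
multiply to `1/(k+1)`. -/
theorem expansion_basisPoly (k : ℕ) :
    ((basisPoly (k + 1)).comp (-(X + X ^ 2))).coeff 0 = 0 ∧
      ((basisPoly (k + 1)).comp (-(X + X ^ 2))).coeff 1 = -1 / ((k : ℂ) + 1) := by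
  induction k with
  | zero =>
    rw [basisPoly]
    simp [coeff_X_pow, coeff_X]
  | succ k ih =>
    have h := congrArg (fun p => p.comp (-(X + X ^ 2))) (basisPoly_succ (k + 1))
    simp only [mul_comp, add_comp, C_comp, X_comp] at h
    have h1 := congrArg (coeff · 0) h
    have h2 := congrArg (coeff · 1) h
    simp only [mul_coeff_zero, mul_coeff_one, coeff_add, coeff_neg, ih.1, ih.2,
      coeff_X_pow, coeff_X, coeff_C, one_ne_zero, show ((0 : ℕ) = 2) = False by simp,
      show ((1 : ℕ) = 2) = False by simp, if_true, if_false, zero_mul, add_zero, mul_zero,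
      neg_zero] at h1 h2
    have hk := natCast_add_one_ne_zero k
    have h0 := natCast_add_one_ne_zero (k + 1)
    refine ⟨mul_left_cancel₀ (pow_ne_zero 2 h0) ?_, mul_left_cancel₀ (pow_ne_zero 2 h0) ?_⟩
    · rw [h1]; simp
    · rw [h2]
      push_cast at h0 ⊢
      field_simp

theorem expansion_nlo (M : ℕ) :
    let q := (binomialPoly M (nloCoeff M)).comp (-(X + X ^ 2))
    q.coeff 0 = 2 * harm 1 M ^ 2 + 2 * harm 2 M ∧
      q.coeff 1 = 2 * harm 1 M ^ 3 - 2 * harmNested M := by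
  have h : (binomialPoly M (nloCoeff M)).comp (-(X + X ^ 2)) =
      ∑ k ∈ range M, C ((-1) ^ (k + 1) * (M.choose (k + 1) : ℂ) * nloCoeff M (k + 1)) *
        (basisPoly (k + 1)).comp (-(X + X ^ 2)) + C (nloCoeff M 0) := by
    rw [binomialPoly, sum_range_succ']
    simp [add_comp, Polynomial.sum_comp, mul_comp]
  dsimp only
  rw [h]
  simp only [coeff_add, finsetSum_coeff, coeff_C_mul, (expansion_basisPoly _).1,
    (expansion_basisPoly _).2, coeff_C_zero, mul_zero, sum_const_zero, zero_add]
  constructor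
  · simp [nloCoeff]; ring
  · rw [coeff_C_of_ne_zero one_ne_zero, add_zero]
    have e : ∑ k ∈ range M, (-1) ^ (k + 1) * (M.choose (k + 1) : ℂ) * nloCoeff M (k + 1) *
        (-1 / ((k : ℂ) + 1)) = altSum M 0 (fun j =>
          (-(2 * harm 1 M ^ 2 + 2 * harm 2 M)) * (1 / ((j : ℂ) + 1)) +
            ((2 * harm 1 M) * (harm 1 (j + 1) / ((j : ℂ) + 1))
              + 2 * (harm 2 (j + 1) / ((j : ℂ) + 1)))) := by
      unfold altSum nloCoeff
      refine sum_congr rfl fun k _ => ?_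
      rw [zero_add]
      ring
    rw [e, altSum_add, altSum_add, altSum_const_mul, altSum_const_mul, altSum_const_mul,
      altSum_inv_zero, altSum_harm_one_div, altSum_harm_two_div]
    ring

end Recurrence

/-! ### Harmonic sums of even argument -/

theorem harmonicSum_nil (n : ℕ) : harmonicSum [] n = 1 := by rw [harmonicSum]

/-- Odd indices cancel between the two signs and even indices double. -/
theorem harmonicSum_pair_even (n r : ℕ) (hr : r ≠ 0) :
    harmonicSum [-(r : ℤ)] (2 * n) + harmonicSum [(r : ℤ)] (2 * n) =
      2 / 2 ^ r * ∑ i ∈ range n, 1 / ((i : ℚ) + 1) ^ r := by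
  induction n with
  | zero => simp [harmonicSum_cons_zero]
  | succ n ih =>
    have hs : (r : ℤ).sign = 1 := Int.sign_eq_one_of_pos (by omega)
    rw [show 2 * (n + 1) = 2 * n + 1 + 1 by ring, sum_range_succ, mul_add, ← ih]
    rw [harmonicSum_cons_succ, harmonicSum_cons_succ, harmonicSum_cons_succ, harmonicSum_cons_succ]
    simp only [Int.sign_neg, hs, Int.natAbs_neg, Int.natAbs_natCast, harmonicSum_nil]
    push_cast
    rw [show (2 * (n : ℚ) + 1 + 1) = 2 * (n + 1) by ring, mul_pow]
    have e1 : ((-1 : ℚ)) ^ (2 * n + 1) = -1 := by rw [pow_succ, pow_mul]; simp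
    have e2 : ((-1 : ℚ)) ^ (2 * n + 1 + 1) = 1 := by rw [pow_succ, e1]; simp
    rw [e1, e2]
    simp only [one_pow]
    field_simp
    ring

/-- Terms with opposite first index and equal remaining indices occur with equal weight, which
produces the common factor `1 + (-1)^(n+1)`; a step to an odd argument therefore adds nothing. -/
theorem gammaFour_succ (n : ℕ) :
    gammaFour (n + 1) = gammaFour n + (1 + (-1) ^ (n + 1)) *
      (16 / ((n : ℚ) + 1) ^ 3
        - 8 / ((n : ℚ) + 1) ^ 2 * (harmonicSum [-1] (n + 1) + harmonicSum [1] (n + 1))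
        - 16 / ((n : ℚ) + 1) * (harmonicSum [-2] (n + 1) + harmonicSum [2] (n + 1))) := by
  have s1 : Int.sign (-1) = -1 := rfl
  have s2 : Int.sign (-2) = -1 := rfl
  have s3 : Int.sign (-3) = -1 := rfl
  have s4 : Int.sign 1 = 1 := rfl
  have s5 : Int.sign 2 = 1 := rfl
  have s6 : Int.sign 3 = 1 := rfl
  have a1 : Int.natAbs (-1) = 1 := rfl
  have a2 : Int.natAbs (-2) = 2 := rfl
  have a3 : Int.natAbs (-3) = 3 := rfl
  have a4 : Int.natAbs 1 = 1 := rfl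
  have a5 : Int.natAbs 2 = 2 := rfl
  have a6 : Int.natAbs 3 = 3 := rfl
  unfold gammaFour
  rw [harmonicSum_cons_succ (-3), harmonicSum_cons_succ 3, harmonicSum_cons_succ (-2) [-1],
    harmonicSum_cons_succ (-2) [1], harmonicSum_cons_succ (-1) [-2], harmonicSum_cons_succ (-1) [2],
    harmonicSum_cons_succ 1 [-2], harmonicSum_cons_succ 1 [2], harmonicSum_cons_succ 2 [-1],
    harmonicSum_cons_succ 2 [1]]
  simp only [s1, s2, s3, s4, s5, s6, a1, a2, a3, a4, a5, a6]
  generalize harmonicSum [-1] (n + 1) = x1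
  generalize harmonicSum [1] (n + 1) = x2
  generalize harmonicSum [-2] (n + 1) = x3
  generalize harmonicSum [2] (n + 1) = x4
  simp only [harmonicSum]
  push_cast
  simp only [one_pow]
  ring

theorem gammaFour_odd (n : ℕ) : gammaFour (2 * n + 1) = gammaFour (2 * n) := by
  rw [gammaFour_succ, pow_succ, pow_mul]
  simp

theorem gammaFour_even (M : ℕ) : ((gammaFour (M + M) : ℚ) : ℂ) =
    -4 * harm 3 M + 4 * harmNested M - 8 * harm 1 M * harm 2 M := by
  induction M with
  | zero => simp [gammaFour, harmonicSum_cons_zero, harmNested]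
  | succ M ih =>
    have h1 := harmonicSum_pair_even (M + 1) 1 one_ne_zero
    have h2 := harmonicSum_pair_even (M + 1) 2 two_ne_zero
    have e : gammaFour (M + 1 + (M + 1)) = gammaFour (M + M) +
        (4 / ((M : ℚ) + 1) ^ 3
          - 4 / ((M : ℚ) + 1) ^ 2 * (∑ i ∈ range (M + 1), 1 / ((i : ℚ) + 1) ^ 1)
          - 8 / ((M : ℚ) + 1) * (∑ i ∈ range (M + 1), 1 / ((i : ℚ) + 1) ^ 2)) := by
      rw [show M + 1 + (M + 1) = 2 * M + 1 + 1 by ring, gammaFour_succ, gammaFour_odd,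
        ← two_mul M]
      rw [show 2 * (M + 1) = 2 * M + 1 + 1 by ring] at h1 h2
      simp only [Nat.cast_one, Nat.cast_ofNat] at h1 h2
      rw [h1, h2]
      have e1 : ((-1 : ℚ)) ^ (2 * M + 1 + 1) = 1 := by
        rw [pow_succ, pow_succ, pow_mul]; simp
      rw [e1]
      push_cast
      rw [show (2 * (M : ℚ) + 1 + 1) = 2 * (M + 1) by ring]
      field_simp
      ring
    rw [e]
    push_cast
    rw [ih]
    have g1 : ∑ i ∈ range (M + 1), 1 / ((i : ℂ) + 1) ^ 1 = harm 1 (M + 1) := rfl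
    have g2 : ∑ i ∈ range (M + 1), 1 / ((i : ℂ) + 1) ^ 2 = harm 2 (M + 1) := rfl
    rw [g1, g2, harmNested_succ, harm_succ, harm_succ, harm_succ]
    have := natCast_add_one_ne_zero M
    field_simp
    ring

section FormalCalculus
open PowerSeries

/-! ### Formal differentiability of functionals of power series -/

variable {ι : Type*}

/-- `Ψ` has constant coefficient `a` and linearization `l` at tuples of power series with constant
coefficients `c`. -/
structure FormalDiff (c : ι → ℂ) (Ψ : (ι → PowerSeries ℂ) → PowerSeries ℂ) (a : ℂ)
    (l : (ι → ℂ) → ℂ) : Prop where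
  const : ∀ u, (∀ k, constantCoeff (u k) = c k) → constantCoeff (Ψ u) = a
  diff : ∀ (n : ℕ) (u δ : ι → PowerSeries ℂ), (∀ k, constantCoeff (u k) = c k) →
    ∃ w, Ψ (fun k => u k + X ^ (n + 1) * δ k) = Ψ u + X ^ (n + 1) * w ∧
      constantCoeff w = l fun k => constantCoeff (δ k)

variable {c : ι → ℂ} {Ψ Φ : (ι → PowerSeries ℂ) → PowerSeries ℂ} {a b : ℂ} {l m : (ι → ℂ) → ℂ}

theorem constantCoeff_add_X_pow_mul (f g : PowerSeries ℂ) (n : ℕ) :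
    constantCoeff (f + X ^ (n + 1) * g) = constantCoeff f := by simp

theorem FormalDiff.congr_right {l' : (ι → ℂ) → ℂ} {a' : ℂ} (h : FormalDiff c Ψ a l) (ha : a = a')
    (hl : ∀ δ, l δ = l' δ) : FormalDiff c Ψ a' l' := by
  obtain rfl : l = l' := funext hl
  exact ha ▸ h

theorem FormalDiff.apply (c : ι → ℂ) (k : ι) : FormalDiff c (fun u => u k) (c k) fun δ => δ k :=
  ⟨fun _ hu => hu k, fun _ _ δ _ => ⟨δ k, rfl, rfl⟩⟩

theorem FormalDiff.fun_const (c : ι → ℂ) (f : PowerSeries ℂ) :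
    FormalDiff c (fun _ => f) (constantCoeff f) fun _ => 0 :=
  ⟨fun _ _ => rfl, fun _ _ _ _ => ⟨0, by simp, by simp⟩⟩

theorem FormalDiff.add (h : FormalDiff c Ψ a l) (h' : FormalDiff c Φ b m) :
    FormalDiff c (fun u => Ψ u + Φ u) (a + b) fun δ => l δ + m δ := by
  refine ⟨fun u hu => by rw [map_add, h.const u hu, h'.const u hu], fun n u δ hu => ?_⟩
  obtain ⟨w, hw, hw0⟩ := h.diff n u δ hu
  obtain ⟨w', hw', hw0'⟩ := h'.diff n u δ hu
  exact ⟨w + w', by rw [hw, hw']; ring, by rw [map_add, hw0, hw0']⟩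

theorem FormalDiff.neg (h : FormalDiff c Ψ a l) : FormalDiff c (fun u => -Ψ u) (-a) fun δ => -l δ := by
  refine ⟨fun u hu => by rw [map_neg, h.const u hu], fun n u δ hu => ?_⟩
  obtain ⟨w, hw, hw0⟩ := h.diff n u δ hu
  exact ⟨-w, by rw [hw]; ring, by rw [map_neg, hw0]⟩

theorem FormalDiff.sub (h : FormalDiff c Ψ a l) (h' : FormalDiff c Φ b m) :
    FormalDiff c (fun u => Ψ u - Φ u) (a - b) fun δ => l δ - m δ := by
  simpa only [sub_eq_add_neg] using h.add h'.neg

theorem FormalDiff.mul (h : FormalDiff c Ψ a l) (h' : FormalDiff c Φ b m) :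
    FormalDiff c (fun u => Ψ u * Φ u) (a * b) fun δ => l δ * b + a * m δ := by
  refine ⟨fun u hu => by rw [map_mul, h.const u hu, h'.const u hu], fun n u δ hu => ?_⟩
  obtain ⟨w, hw, hw0⟩ := h.diff n u δ hu
  obtain ⟨w', hw', hw0'⟩ := h'.diff n u δ hu
  refine ⟨w * Φ u + Ψ u * w' + X ^ (n + 1) * (w * w'), by rw [hw, hw']; ring, ?_⟩
  simp [hw0, hw0', h.const u hu, h'.const u hu]

theorem FormalDiff.inv (h : FormalDiff c Ψ a l) (ha : a ≠ 0) :
    FormalDiff c (fun u => (Ψ u)⁻¹) a⁻¹ fun δ => -(l δ * a⁻¹ ^ 2) := by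
  refine ⟨fun u hu => by rw [constantCoeff_inv, h.const u hu], fun n u δ hu => ?_⟩
  obtain ⟨w, hw, hw0⟩ := h.diff n u δ hu
  have e1 := PowerSeries.mul_inv_cancel (Ψ u) (by rwa [h.const u hu])
  have e2 := PowerSeries.mul_inv_cancel (Ψ u + X ^ (n + 1) * w) (by simp [h.const u hu, ha])
  refine ⟨-(w * (Ψ u)⁻¹ * (Ψ u + X ^ (n + 1) * w)⁻¹), ?_, ?_⟩
  · rw [hw]
    linear_combination (Ψ u)⁻¹ * e2 - (Ψ u + X ^ (n + 1) * w)⁻¹ * e1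
  · simp [constantCoeff_inv, hw0, h.const u hu]
    ring

/-- An explicit power of `h` pushes the response beyond the order of the perturbation. This removes
all coupling-dependent factors from the Jacobian. -/
theorem FormalDiff.X_pow_mul (h : FormalDiff c Ψ a l) (n : ℕ) :
    FormalDiff c (fun u => X ^ (n + 1) * Ψ u) 0 fun _ => 0 := by
  have h1 := (FormalDiff.fun_const c (X ^ (n + 1))).mul h
  refine h1.congr_right (by simp) fun δ => by simp

/-- `Ψ` is formally differentiable with logarithmic derivative `l`. -/
def LogDiff (c : ι → ℂ) (Ψ : (ι → PowerSeries ℂ) → PowerSeries ℂ) (a : ℂ) (l : (ι → ℂ) → ℂ) : Prop :=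
  a ≠ 0 ∧ FormalDiff c Ψ a fun δ => a * l δ

theorem FormalDiff.logDiff (h : FormalDiff c Ψ a l) (ha : a ≠ 0) : LogDiff c Ψ a fun δ => l δ / a :=
  ⟨ha, h.congr_right rfl fun δ => by field_simp⟩

theorem LogDiff.congr_right {l' : (ι → ℂ) → ℂ} {a' : ℂ} (h : LogDiff c Ψ a l) (ha : a = a')
    (hl : ∀ δ, l δ = l' δ) : LogDiff c Ψ a' l' := by
  obtain rfl : l = l' := funext hl
  exact ha ▸ h

theorem LogDiff.mul (h : LogDiff c Ψ a l) (h' : LogDiff c Φ b m) :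
    LogDiff c (fun u => Ψ u * Φ u) (a * b) fun δ => l δ + m δ :=
  ⟨mul_ne_zero h.1 h'.1, (h.2.mul h'.2).congr_right rfl fun δ => by ring⟩

theorem LogDiff.inv (h : LogDiff c Ψ a l) : LogDiff c (fun u => (Ψ u)⁻¹) a⁻¹ fun δ => -l δ :=
  ⟨inv_ne_zero h.1, (h.2.inv h.1).congr_right rfl fun δ => by have := h.1; field_simp⟩

theorem LogDiff.neg (h : LogDiff c Ψ a l) : LogDiff c (fun u => -Ψ u) (-a) l :=
  ⟨neg_ne_zero.2 h.1, h.2.neg.congr_right rfl fun δ => by ring⟩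

theorem LogDiff.sq (h : LogDiff c Ψ a l) : LogDiff c (fun u => Ψ u ^ 2) (a ^ 2) fun δ => 2 * l δ := by
  simp only [pow_two (Ψ _)]
  exact (h.mul h).congr_right (pow_two a).symm fun δ => by ring

theorem LogDiff.prod {κ : Type*} (s : Finset κ) {Ψ : κ → (ι → PowerSeries ℂ) → PowerSeries ℂ}
    {a : κ → ℂ} {l : κ → (ι → ℂ) → ℂ} (h : ∀ j ∈ s, LogDiff c (Ψ j) (a j) (l j)) :
    LogDiff c (fun u => ∏ j ∈ s, Ψ j u) (∏ j ∈ s, a j) fun δ => ∑ j ∈ s, l j δ := by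
  classical
  induction s using Finset.induction_on with
  | empty =>
    simp only [prod_empty, sum_empty]
    exact ⟨one_ne_zero, (FormalDiff.fun_const c 1).congr_right (by simp) fun δ => by simp⟩
  | insert j s hj ih =>
    simp only [prod_insert hj, sum_insert hj]
    exact (h j (mem_insert_self j s)).mul (ih fun i hi => h i (mem_insert_of_mem hi))

/-- `Ψ` is continuous for the `X`-adic topology, with modulus of continuity the identity, at tuples
with constant coefficients `c`. -/
def Causal (c : ι → ℂ) (Ψ : (ι → PowerSeries ℂ) → PowerSeries ℂ) : Prop :=
  ∀ (n : ℕ) (u v : ι → PowerSeries ℂ), (∀ k, constantCoeff (u k) = c k) →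
    (∀ k, constantCoeff (v k) = c k) → (∀ k, X ^ n ∣ u k - v k) → X ^ n ∣ Ψ u - Ψ v

theorem FormalDiff.exists_of_dvd (h : FormalDiff c Ψ a l) {n : ℕ} {u v : ι → PowerSeries ℂ}
    (hv : ∀ k, constantCoeff (v k) = c k) (huv : ∀ k, X ^ (n + 1) ∣ u k - v k) :
    ∃ w, Ψ u = Ψ v + X ^ (n + 1) * w ∧
      constantCoeff w = l fun k => coeff (n + 1) (u k) - coeff (n + 1) (v k) := by
  choose δ hδ using huv
  have hu : u = fun k => v k + X ^ (n + 1) * δ k := funext fun k => by rw [← hδ]; ring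
  obtain ⟨w, hw, hw0⟩ := h.diff n v δ hv
  refine ⟨w, by rw [hu, hw], hw0.trans ?_⟩
  congr 1
  funext k
  rw [← map_sub, hδ]
  have := coeff_X_pow_mul (δ k) (n + 1) 0
  rw [zero_add] at this
  rw [this, coeff_zero_eq_constantCoeff_apply]

theorem FormalDiff.causal (h : FormalDiff c Ψ a l) : Causal c Ψ := by
  intro n u v hu hv huv
  cases n with
  | zero => simp
  | succ n =>
    obtain ⟨w, hw, -⟩ := h.exists_of_dvd hv huv
    exact ⟨w, by rw [hw]; ring⟩

theorem Causal.fun_const (c : ι → ℂ) (f : PowerSeries ℂ) : Causal c fun _ => f :=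
  (FormalDiff.fun_const c f).causal

theorem Causal.mul (h : Causal c Ψ) (h' : Causal c Φ) : Causal c fun u => Ψ u * Φ u := by
  intro n u v hu hv huv
  have := dvd_add ((h n u v hu hv huv).mul_right (Φ u)) ((h' n u v hu hv huv).mul_left (Ψ v))
  rwa [show (Ψ u - Ψ v) * Φ u + Ψ v * (Φ u - Φ v) = Ψ u * Φ u - Ψ v * Φ v by ring] at this

theorem Causal.sub (h : Causal c Ψ) (h' : Causal c Φ) : Causal c fun u => Ψ u - Φ u := by
  intro n u v hu hv huv
  have := dvd_sub (h n u v hu hv huv) (h' n u v hu hv huv)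
  rwa [show Ψ u - Ψ v - (Φ u - Φ v) = Ψ u - Φ u - (Ψ v - Φ v) by ring] at this

theorem Causal.pow (h : Causal c Ψ) (r : ℕ) : Causal c fun u => Ψ u ^ r :=
  fun n u v hu hv huv => (h n u v hu hv huv).trans (sub_dvd_pow_sub_pow _ _ r)

/-- Coefficientwise: `A - B` divides each `A^d - B^d`, so the powers agree below order `n`. -/
theorem X_pow_dvd_subst_sub (f : PowerSeries ℂ) {A B : PowerSeries ℂ} (hA : constantCoeff A = 0)
    (hB : constantCoeff B = 0) {n : ℕ} (h : X ^ n ∣ A - B) : X ^ n ∣ f.subst A - f.subst B := by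
  rw [X_pow_dvd_iff]
  intro i hi
  rw [map_sub, coeff_subst' (HasSubst.of_constantCoeff_zero' hA),
    coeff_subst' (HasSubst.of_constantCoeff_zero' hB), sub_eq_zero]
  refine finsum_congr fun d => ?_
  have := X_pow_dvd_iff.1 (h.trans (sub_dvd_pow_sub_pow A B d)) i hi
  rw [map_sub, sub_eq_zero] at this
  rw [this]

theorem constantCoeff_subst_of_zero (f : PowerSeries ℂ) {A : PowerSeries ℂ}
    (hA : constantCoeff A = 0) : constantCoeff (f.subst A) = constantCoeff f := by
  have h1 := X_pow_dvd_subst_sub f hA (B := 0) (by simp) (n := 1) (by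
    rw [pow_one, X_dvd_iff]; simp [hA])
  rw [pow_one, X_dvd_iff, map_sub, sub_eq_zero] at h1
  rw [h1, ← coeff_zero_eq_constantCoeff_apply,
    coeff_subst' (HasSubst.of_constantCoeff_zero' (by simp)), finsum_eq_single _ 0]
  · simp
  · intro d hd
    simp [hd]

theorem FormalDiff.subst_of_flat (f : PowerSeries ℂ) (h : FormalDiff c Ψ 0 fun _ => 0) :
    FormalDiff c (fun u => f.subst (Ψ u)) (constantCoeff f) fun _ => 0 := by
  refine ⟨fun u hu => constantCoeff_subst_of_zero f (h.const u hu), fun n u δ hu => ?_⟩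
  obtain ⟨w, hw, hw0⟩ := h.diff n u δ hu
  have hd : X ^ (n + 2) ∣ Ψ (fun k => u k + X ^ (n + 1) * δ k) - Ψ u := by
    rw [hw, add_sub_cancel_left, pow_succ _ (n + 1)]
    exact mul_dvd_mul_left _ (X_dvd_iff.2 hw0)
  obtain ⟨q, hq⟩ := X_pow_dvd_subst_sub f (h.const _ fun k => by simp [hu k]) (h.const u hu) hd
  exact ⟨X * q, by rw [sub_eq_iff_eq_add.1 hq]; ring, by simp⟩

/-! ### Formal inverse function theorem -/

variable [Fintype ι] [DecidableEq ι] {F : ι → (ι → PowerSeries ℂ) → PowerSeries ℂ}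
  {J : Matrix ι ι ℂ}

/-- Order-by-order uniqueness: if the tuples agree below order `n + 1`, the order `n + 1`
coefficients of their difference lie in the kernel of `J`. -/
theorem X_pow_dvd_sub_of_formalDiff (hJ : J.det ≠ 0) {a : ι → ℂ}
    (hF : ∀ k, FormalDiff c (F k) (a k) fun δ => J.mulVec δ k) {u v : ι → PowerSeries ℂ}
    (hu : ∀ k, constantCoeff (u k) = c k) (hv : ∀ k, constantCoeff (v k) = c k) {n : ℕ}
    (h : ∀ k, X ^ (n + 1) ∣ F k u - F k v) (k : ι) : X ^ (n + 1) ∣ u k - v k := by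
  induction n generalizing k with
  | zero => rw [zero_add, pow_one, X_dvd_iff, map_sub, hu, hv, sub_self]
  | succ n ih =>
    have hd : ∀ k, X ^ (n + 1) ∣ u k - v k :=
      ih fun k => (pow_dvd_pow X (Nat.le_succ (n + 1))).trans (h k)
    have hz : J.mulVec (fun k => coeff (n + 1) (u k) - coeff (n + 1) (v k)) = 0 := by
      funext k
      obtain ⟨w, hw, hw0⟩ := (hF k).exists_of_dvd hv hd
      rw [← hw0, Pi.zero_apply]
      have := X_pow_dvd_iff.1 (h k) (n + 1) (Nat.lt_succ_self _)
      rw [hw, add_sub_cancel_left] at this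
      have h2 := coeff_X_pow_mul w (n + 1) 0
      rw [zero_add] at h2
      rwa [h2, coeff_zero_eq_constantCoeff_apply] at this
    have hz' := congrFun (Matrix.eq_zero_of_mulVec_eq_zero hJ hz) k
    rw [X_pow_dvd_iff]
    intro i hi
    rcases Nat.lt_succ_iff_lt_or_eq.1 hi with hi | rfl
    · exact X_pow_dvd_iff.1 (hd k) i hi
    · rw [map_sub]; exact hz'

/-- Each residual is cancelled to one further order by applying `J⁻¹` to its leading coefficients.
Uniqueness makes the approximations Cauchy in the `X`-adic topology. -/
theorem exists_solution_of_formalDiff (hJ : J.det ≠ 0)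
    (hF : ∀ k, FormalDiff c (F k) 1 fun δ => J.mulVec δ k) :
    ∃ u : ι → PowerSeries ℂ, (∀ k, constantCoeff (u k) = c k) ∧ ∀ k, F k u = 1 := by
  have approx : ∀ n : ℕ, ∃ u : ι → PowerSeries ℂ, (∀ k, constantCoeff (u k) = c k) ∧
      ∀ k, X ^ (n + 1) ∣ F k u - 1 := by
    intro n
    induction n with
    | zero =>
      refine ⟨fun k => C (c k), fun k => by simp, fun k => ?_⟩
      rw [zero_add, pow_one, X_dvd_iff, map_sub, (hF k).const _ fun k => by simp]
      simp
    | succ n ih =>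
      obtain ⟨u, hu, h⟩ := ih
      choose q hq using h
      refine ⟨fun k => u k + X ^ (n + 1) *
        C (J⁻¹.mulVec (fun k => -constantCoeff (q k)) k), fun k => by simp [hu k], fun k => ?_⟩
      obtain ⟨w, hw, hw0⟩ := (hF k).diff n u
        (fun k => C (J⁻¹.mulVec (fun k => -constantCoeff (q k)) k)) hu
      simp only [constantCoeff_C] at hw0
      rw [Matrix.mulVec_mulVec, Matrix.mul_nonsing_inv _ (isUnit_iff_ne_zero.2 hJ),
        Matrix.one_mulVec] at hw0
      rw [hw, add_sub_right_comm, hq, ← mul_add, pow_succ _ (n + 1)]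
      refine mul_dvd_mul_left _ (X_dvd_iff.2 ?_)
      rw [map_add, hw0]; ring
  choose s hs hs1 using approx
  have hcauchy : ∀ n m, n ≤ m → ∀ k, X ^ (n + 1) ∣ s m k - s n k := by
    intro n m hnm
    refine X_pow_dvd_sub_of_formalDiff hJ hF (hs m) (hs n) fun k => ?_
    have := dvd_sub ((pow_dvd_pow X (Nat.succ_le_succ hnm)).trans (hs1 m k)) (hs1 n k)
    rwa [sub_sub_sub_cancel_right] at this
  -- The limit: approximation `n` is already correct in its coefficient `n`.
  let u : ι → PowerSeries ℂ := fun k => PowerSeries.mk fun n => coeff n (s n k)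
  have hus : ∀ n k, X ^ (n + 1) ∣ u k - s n k := by
    intro n k
    rw [X_pow_dvd_iff]
    intro i hi
    have := X_pow_dvd_iff.1 (hcauchy i n (Nat.lt_succ_iff.1 hi) k) i (Nat.lt_succ_self i)
    rw [map_sub, sub_eq_zero] at this
    simp [u, this]
  have hu : ∀ k, constantCoeff (u k) = c k := fun k => by
    rw [← hs 0 k, ← sub_eq_zero, ← map_sub, ← X_dvd_iff]
    simpa using hus 0 k
  refine ⟨u, hu, fun k => ?_⟩
  rw [← sub_eq_zero]
  ext i
  have := dvd_add ((hF k).causal (i + 1) u (s i) hu (hs i) (hus i)) (hs1 i k)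
  rw [sub_add_sub_cancel] at this
  rw [X_pow_dvd_iff.1 this i (Nat.lt_succ_self i), map_zero]

end FormalCalculus

section Bethe
open PowerSeries

/-! ### The Bethe equations are formally differentiable -/

theorem constantCoeff_psSqrt {f : PowerSeries ℂ} (hf : constantCoeff f = 1) :
    constantCoeff (psSqrt f) = 1 := by
  rw [psSqrt, constantCoeff_subst_of_zero _ (by simp [hf]), binomialSeries_constantCoeff]

theorem constantCoeff_deformed (v : PowerSeries ℂ) : constantCoeff (deformed v) = constantCoeff v := by
  rw [deformed, map_mul, map_mul, map_add, constantCoeff_psSqrt (by simp)]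
  simp
  ring

variable {ι : Type*} {c : ι → ℂ} {Ψ Φ : (ι → PowerSeries ℂ) → PowerSeries ℂ} {a b : ℂ}
  {l m : (ι → ℂ) → ℂ}

/-- Subtracting the quadratic equations gives `(y' - y)(y' + y - v') = (v' - v) y`. The second
factor on the left has constant coefficient `a ≠ 0` and can be inverted. -/
theorem FormalDiff.deformed (h : FormalDiff c Ψ a l) (ha : a ≠ 0) :
    FormalDiff c (fun u => deformed (Ψ u)) a l := by
  refine ⟨fun u hu => by rw [constantCoeff_deformed, h.const u hu], fun n u δ hu => ?_⟩
  obtain ⟨w, hw, hw0⟩ := h.diff n u δ hu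
  rw [hw]
  have hv := h.const u hu
  generalize Ψ u = v at hv ⊢
  have s1 := deformed_spec v (by rwa [hv])
  have s2 := deformed_spec (v + X ^ (n + 1) * w) (by rwa [constantCoeff_add_X_pow_mul, hv])
  have c1 := constantCoeff_deformed v
  have c2 := constantCoeff_deformed (v + X ^ (n + 1) * w)
  rw [constantCoeff_add_X_pow_mul, hv] at c2
  rw [hv] at c1
  generalize ABJM.deformed v = y at s1 c1 ⊢
  generalize ABJM.deformed (v + X ^ (n + 1) * w) = y' at s2 c2 ⊢
  have hd : constantCoeff (y' + y - (v + X ^ (n + 1) * w)) = a := by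
    rw [map_sub, constantCoeff_add_X_pow_mul, map_add, c1, c2, hv]; ring
  have hi := PowerSeries.mul_inv_cancel (y' + y - (v + X ^ (n + 1) * w)) (by rwa [hd])
  refine ⟨w * y * (y' + y - (v + X ^ (n + 1) * w))⁻¹, ?_, ?_⟩
  · generalize (y' + y - (v + X ^ (n + 1) * w))⁻¹ = q at hi
    linear_combination q * (s2 - s1) - (y' - y) * hi
  · rw [map_mul, map_mul, constantCoeff_inv, hd, c1, hw0]
    field_simp

theorem add_I_div_two_ne_zero {z : ℂ} (hz : z.im = 0) : z + Complex.I / 2 ≠ 0 := by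
  intro h
  have := congrArg Complex.im h
  simp [hz] at this

theorem sub_I_div_two_ne_zero {z : ℂ} (hz : z.im = 0) : z - Complex.I / 2 ≠ 0 := by
  intro h
  have := congrArg Complex.im h
  simp [hz] at this

theorem add_I_ne_zero {z : ℂ} (hz : z.im = 0) : z + Complex.I ≠ 0 := by
  intro h
  have := congrArg Complex.im h
  simp [hz] at this

theorem sub_I_ne_zero {z : ℂ} (hz : z.im = 0) : z - Complex.I ≠ 0 := by
  intro h
  have := congrArg Complex.im h
  simp [hz] at this

theorem constantCoeff_yPlus (u : PowerSeries ℂ) :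
    constantCoeff (yPlus u) = constantCoeff u + Complex.I / 2 := by
  rw [yPlus, constantCoeff_deformed]; simp

theorem constantCoeff_yMinus (u : PowerSeries ℂ) :
    constantCoeff (yMinus u) = constantCoeff u - Complex.I / 2 := by
  rw [yMinus, constantCoeff_deformed]; simp

theorem formalDiff_yPlus (hc : ∀ k, (c k).im = 0) (k : ι) :
    FormalDiff c (fun u => yPlus (u k)) (c k + Complex.I / 2) fun δ => δ k :=
  (((FormalDiff.apply c k).add (FormalDiff.fun_const c (C (Complex.I / 2)))).congr_right
    (by simp) fun δ => by simp).deformed (add_I_div_two_ne_zero (hc k))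

theorem formalDiff_yMinus (hc : ∀ k, (c k).im = 0) (k : ι) :
    FormalDiff c (fun u => yMinus (u k)) (c k - Complex.I / 2) fun δ => δ k :=
  (((FormalDiff.apply c k).sub (FormalDiff.fun_const c (C (Complex.I / 2)))).congr_right
    (by simp) fun δ => by simp).deformed (sub_I_div_two_ne_zero (hc k))

theorem causal_charge (hc : ∀ k, (c k).im = 0) (r : ℕ) (k : ι) :
    Causal c fun u => charge r (u k) := by
  unfold charge
  exact (Causal.fun_const c _).mul
    ((((formalDiff_yPlus hc k).inv (add_I_div_two_ne_zero (hc k))).causal.pow _).sub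
    (((formalDiff_yMinus hc k).inv (sub_I_div_two_ne_zero (hc k))).causal.pow _))

/-- The charges preserve the order of a perturbation, and every term of the phase carries a further
positive power of `h`; so the phase is flat to first order. -/
theorem formalDiff_besPhase (hc : ∀ k, (c k).im = 0) (k j : ι) :
    FormalDiff c (fun u => besPhase (u k) (u j)) 0 fun _ => 0 := by
  refine ⟨fun u _ => ?_, fun n u δ hu => ?_⟩
  · rw [← coeff_zero_eq_constantCoeff_apply, besPhase, coeff_mk]
    simp
  · obtain ⟨q, hq⟩ : X ^ (n + 2) ∣ besPhase (u k + X ^ (n + 1) * δ k) (u j + X ^ (n + 1) * δ j)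
        - besPhase (u k) (u j) := by
      rw [X_pow_dvd_iff]
      intro i hi
      rw [map_sub, besPhase, besPhase, coeff_mk, coeff_mk, ← map_sub]
      simp only [← sum_sub_distrib]
      refine X_pow_dvd_iff.1 (Finset.dvd_sum fun r hr => Finset.dvd_sum fun ν _ =>
        Finset.dvd_sum fun μ _ => ?_) i hi
      have hr2 : 2 ≤ r := (mem_Icc.1 hr).1
      have hca := (((causal_charge hc r k).mul (causal_charge hc (r + 1 + 2 * ν) j)).sub
        ((causal_charge hc (r + 1 + 2 * ν) k).mul (causal_charge hc r j))) (n + 1)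
        (fun k => u k + X ^ (n + 1) * δ k) u (fun k => by simp [hu k]) hu (fun k => ⟨δ k, by ring⟩)
      rw [← mul_sub, show n + 2 = 1 + (n + 1) by ring, pow_add]
      refine mul_dvd_mul ((pow_dvd_pow X ?_).mul_left _) hca
      omega
    exact ⟨X * q, by rw [sub_eq_iff_eq_add.1 hq]; ring, by simp⟩

theorem logDiff_besSigmaSq (hc : ∀ k, (c k).im = 0) (k j : ι) :
    LogDiff c (fun u => besSigmaSq (u k) (u j)) 1 fun _ => 0 := by
  have h := ((FormalDiff.fun_const c (C (2 * Complex.I))).mul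
    (formalDiff_besPhase hc k j)).congr_right (a' := 0) (l' := fun _ => 0) (by simp) fun δ => by simp
  refine ⟨one_ne_zero, (h.subst_of_flat (PowerSeries.exp ℂ)).congr_right ?_ fun δ => by simp⟩
  simp

theorem logDiff_one_sub (h : FormalDiff c Ψ a l) :
    LogDiff c (fun u => 1 - X ^ 2 * Ψ u) 1 fun _ => 0 :=
  ⟨one_ne_zero, ((FormalDiff.fun_const c 1).sub (h.X_pow_mul 1)).congr_right (by simp)
    fun δ => by simp⟩

/-- The factor of the Bethe equations for the scattering of two roots. -/
def scattering (u w : PowerSeries ℂ) : PowerSeries ℂ :=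
  (yMinus u - yPlus w) * (yPlus u - yMinus w)⁻¹
    * ((1 - X ^ 2 * (yPlus u * yMinus w)⁻¹) * (1 - X ^ 2 * (yMinus u * yPlus w)⁻¹)⁻¹)
    * besSigmaSq u w

theorem logDiff_scattering (hc : ∀ k, (c k).im = 0) (k j : ι) :
    LogDiff c (fun u => scattering (u k) (u j))
      ((c k - c j - Complex.I) * (c k - c j + Complex.I)⁻¹)
      fun δ => (1 / (c k - c j - Complex.I) - 1 / (c k - c j + Complex.I)) * (δ k - δ j) := by
  have hd : (c k - c j).im = 0 := by simp [hc]
  have hp := formalDiff_yPlus hc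
  have hm := formalDiff_yMinus hc
  have hp0 := fun k => add_I_div_two_ne_zero (hc k)
  have hm0 := fun k => sub_I_div_two_ne_zero (hc k)
  have h1 := ((hm k).sub (hp j)).congr_right (a' := c k - c j - Complex.I) (by ring) fun _ => rfl
  have h2 := ((hp k).sub (hm j)).congr_right (a' := c k - c j + Complex.I) (by ring) fun _ => rfl
  have h3 := logDiff_one_sub (((hp k).mul (hm j)).inv (mul_ne_zero (hp0 k) (hm0 j)))
  have h4 := logDiff_one_sub (((hm k).mul (hp j)).inv (mul_ne_zero (hm0 k) (hp0 j)))
  refine ((((h1.logDiff (sub_I_ne_zero hd)).mul (h2.logDiff (add_I_ne_zero hd)).inv).mul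
    (h3.mul h4.inv)).mul (logDiff_besSigmaSq hc k j)).congr_right ?_ fun δ => ?_
  · simp
  · ring

/-- The logarithmic derivative of the leading order scattering factor. -/
def scatteringKernel (c : ι → ℂ) (k j : ι) : ℂ :=
  1 / (c k - c j - Complex.I) - 1 / (c k - c j + Complex.I)

theorem scatteringKernel_eq (x : ι → ℝ) (k j : ι) :
    scatteringKernel (fun i => (x i : ℂ)) k j =
      Complex.I * ((2 / ((x k - x j) ^ 2 + 1) : ℝ) : ℂ) := by
  have h1 := sub_I_ne_zero (z := ((x k - x j : ℝ) : ℂ)) (Complex.ofReal_im _)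
  have h2 := add_I_ne_zero (z := ((x k - x j : ℝ) : ℂ)) (Complex.ofReal_im _)
  have h3 : ((x k : ℂ) - x j) ^ 2 + 1 = (x k - x j - Complex.I) * (x k - x j + Complex.I) := by
    linear_combination Complex.I_sq
  push_cast at h1 h2 ⊢
  rw [scatteringKernel, h3]
  field_simp
  ring

variable [Fintype ι] [DecidableEq ι]

/-- The ratio of the two sides of the twist-two Bethe equation for the root `k`. -/
def betheRatio (k : ι) (u : ι → PowerSeries ℂ) : PowerSeries ℂ :=
  (yPlus (u k) * (yMinus (u k))⁻¹) ^ 2 * (-∏ j ∈ univ.erase k, scattering (u k) (u j))⁻¹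

/-- The Jacobian matrix of the logarithm of the leading order Bethe equations. -/
def betheJacobian (c : ι → ℂ) : Matrix ι ι ℂ := fun k j =>
  if j = k then 2 * (1 / (c k + Complex.I / 2) - 1 / (c k - Complex.I / 2))
    - ∑ i ∈ univ.erase k, scatteringKernel c k i
  else scatteringKernel c k j

theorem betheJacobian_mulVec (c δ : ι → ℂ) (k : ι) :
    (betheJacobian c).mulVec δ k = 2 * (δ k / (c k + Complex.I / 2) - δ k / (c k - Complex.I / 2))
      - ∑ j ∈ univ.erase k, scatteringKernel c k j * (δ k - δ j) := by
  rw [Matrix.mulVec, dotProduct, ← add_sum_erase _ _ (mem_univ k)]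
  have : ∑ j ∈ univ.erase k, betheJacobian c k j * δ j =
      ∑ j ∈ univ.erase k, scatteringKernel c k j * δ j := by
    refine sum_congr rfl fun j hj => ?_
    rw [betheJacobian, if_neg (ne_of_mem_erase hj)]
  rw [this, betheJacobian, if_pos rfl]
  simp only [mul_sub, sum_sub_distrib, sub_mul, sum_mul]
  ring

/-- For real roots the matrix is `i` times a real one. Each diagonal entry exceeds in modulus the
sum of the off-diagonal ones by the momentum term `2/(x_k² + 1/4)`. -/
theorem betheJacobian_det_ne_zero (hc : ∀ k, (c k).im = 0) : (betheJacobian c).det ≠ 0 := by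
  obtain ⟨x, rfl⟩ : ∃ x : ι → ℝ, c = fun i => (x i : ℂ) :=
    ⟨fun i => (c i).re, funext fun i => Complex.ext rfl (hc i)⟩
  refine det_ne_zero_of_sum_row_lt_diag fun k => ?_
  have h1 : ∀ j ∈ univ.erase k, ‖betheJacobian (fun i => (x i : ℂ)) k j‖ =
      2 / ((x k - x j) ^ 2 + 1) := by
    intro j hj
    rw [betheJacobian, if_neg (ne_of_mem_erase hj), scatteringKernel_eq, norm_mul, Complex.norm_I,
      one_mul, Complex.norm_real, Real.norm_of_nonneg (by positivity)]
  have h2 : betheJacobian (fun i => (x i : ℂ)) k k = -(Complex.I *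
      ((2 / (x k ^ 2 + 1 / 4) + ∑ j ∈ univ.erase k, 2 / ((x k - x j) ^ 2 + 1) : ℝ) : ℂ)) := by
    rw [betheJacobian, if_pos rfl]
    simp only [scatteringKernel_eq, ← mul_sum, ← Complex.ofReal_sum]
    rw [Complex.ofReal_add, mul_add, neg_add, ← sub_eq_add_neg]
    congr 1
    have h1 := sub_I_div_two_ne_zero (Complex.ofReal_im (x k))
    have h2 := add_I_div_two_ne_zero (Complex.ofReal_im (x k))
    have h3 : (x k : ℂ) ^ 2 + 1 / 4 = (x k - Complex.I / 2) * (x k + Complex.I / 2) := by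
      linear_combination Complex.I_sq / 4
    push_cast
    rw [h3]
    generalize hA : (x k : ℂ) - Complex.I / 2 = A at *
    generalize hB : (x k : ℂ) + Complex.I / 2 = B at *
    have : A - B = -Complex.I := by rw [← hA, ← hB]; ring
    field_simp
    linear_combination this
  have h3 : 0 ≤ ∑ j ∈ univ.erase k, 2 / ((x k - x j) ^ 2 + 1) :=
    sum_nonneg fun j _ => by positivity
  have h4 : 0 < 2 / (x k ^ 2 + 1 / 4) := by positivity
  rw [sum_congr rfl h1, h2, norm_neg, norm_mul, Complex.norm_I, one_mul, Complex.norm_real,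
    Real.norm_of_nonneg (by linarith)]
  linarith

/-- The leading order Bethe equations in terms of the Baxter equation. -/
theorem bethe_of_baxter {N : ℕ} {c : Fin N → ℂ} (hc : ∀ k, (c k).im = 0)
    (h : ∀ z, baxterOp N (fun w => ∏ k, (w - c k)) z = 0) (k : Fin N) :
    ((c k + Complex.I / 2) * (c k - Complex.I / 2)⁻¹) ^ 2 *
      (-∏ j ∈ univ.erase k, (c k - c j - Complex.I) * (c k - c j + Complex.I)⁻¹)⁻¹ = 1 := by
  have hk := h (c k)
  have h0 : ∏ j, (c k - c j) = 0 := prod_eq_zero (mem_univ k) (sub_self _)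
  simp only [baxterOp, h0, mul_zero, sub_zero] at hk
  -- The factor `j = k` contributes `i` to one shifted product and `-i` to the other, which is the
  -- origin of the minus sign in the Bethe equations.
  rw [← mul_prod_erase _ _ (mem_univ k), ← mul_prod_erase univ (fun j => c k - Complex.I - c j)
    (mem_univ k)] at hk
  rw [prod_mul_distrib, prod_inv_distrib]
  have e1 : ∏ j ∈ univ.erase k, (c k + Complex.I - c j) = ∏ j ∈ univ.erase k, (c k - c j + Complex.I) :=
    prod_congr rfl fun j _ => by ring
  have e2 : ∏ j ∈ univ.erase k, (c k - Complex.I - c j) = ∏ j ∈ univ.erase k, (c k - c j - Complex.I) :=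
    prod_congr rfl fun j _ => by ring
  rw [e1, e2] at hk
  have n1 : ∏ j ∈ univ.erase k, (c k - c j + Complex.I) ≠ 0 :=
    prod_ne_zero_iff.2 fun j _ => add_I_ne_zero (by simp [hc])
  have n2 : ∏ j ∈ univ.erase k, (c k - c j - Complex.I) ≠ 0 :=
    prod_ne_zero_iff.2 fun j _ => sub_I_ne_zero (by simp [hc])
  have n3 := sub_I_div_two_ne_zero (hc k)
  generalize ∏ j ∈ univ.erase k, (c k - c j + Complex.I) = P at *
  generalize ∏ j ∈ univ.erase k, (c k - c j - Complex.I) = M at *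
  rw [add_sub_cancel_left, sub_sub_cancel_left] at hk
  have hk' : (c k + Complex.I / 2) ^ 2 * P = -((c k - Complex.I / 2) ^ 2 * M) := by
    refine mul_left_cancel₀ Complex.I_ne_zero ?_
    linear_combination hk
  rw [← div_eq_mul_inv, ← div_eq_mul_inv, ← div_eq_mul_inv, div_pow, div_div,
    div_eq_one_iff_eq (mul_ne_zero (pow_ne_zero 2 n3) (neg_ne_zero.2 (div_ne_zero n2 n1))),
    mul_neg, mul_div_assoc', ← neg_div, eq_div_iff n1]
  exact hk'

theorem formalDiff_betheRatio {N : ℕ} {c : Fin N → ℂ} (hc : ∀ k, (c k).im = 0)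
    (h : ∀ z, baxterOp N (fun w => ∏ k, (w - c k)) z = 0) (k : Fin N) :
    FormalDiff c (betheRatio k) 1 fun δ => (betheJacobian c).mulVec δ k := by
  have h1 := ((formalDiff_yPlus hc k).logDiff (add_I_div_two_ne_zero (hc k))).mul
    ((formalDiff_yMinus hc k).logDiff (sub_I_div_two_ne_zero (hc k))).inv
  have h2 := LogDiff.prod (univ.erase k) (fun j _ => logDiff_scattering hc k j)
  refine ((h1.sq.mul h2.neg.inv).congr_right (bethe_of_baxter hc h k) (fun δ => ?_)).2.congr_right
    rfl fun δ => one_mul _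
  rw [betheJacobian_mulVec]
  simp only [scatteringKernel]
  ring

theorem constantCoeff_scattering_prod_ne_zero {N : ℕ} {u : Fin N → PowerSeries ℂ}
    (hc : ∀ k, (constantCoeff (u k)).im = 0) (k : Fin N) :
    constantCoeff (-∏ j ∈ univ.erase k, scattering (u k) (u j)) ≠ 0 := by
  have h := (LogDiff.prod (univ.erase k)
    (fun j _ => logDiff_scattering (c := fun k => constantCoeff (u k)) hc k j)).neg
  rw [h.2.const u fun _ => rfl]
  exact h.1

theorem betheEquations_iff {N : ℕ} {u : Fin N → PowerSeries ℂ}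
    (hc : ∀ k, (constantCoeff (u k)).im = 0) :
    BetheEquations 2 u ↔ ∀ k, betheRatio k u = 1 := by
  refine forall_congr' fun k => ?_
  rw [betheRatio, eq_comm (b := (1 : PowerSeries ℂ)),
    PowerSeries.eq_mul_inv_iff_mul_eq (constantCoeff_scattering_prod_ne_zero hc k), one_mul, eq_comm]
  rfl

end Bethe

section Jets
open PowerSeries

/-! ### Second order jets in the coupling -/

/-- `f = a + l h² + O(h³)`. -/
def Jet (f : PowerSeries ℂ) (a l : ℂ) : Prop := ∃ g, f = C a + X ^ 2 * C l + X ^ 3 * g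

variable {f g : PowerSeries ℂ} {a b l m : ℂ}

theorem Jet.congr {a' l' : ℂ} (h : Jet f a l) (ha : a = a') (hl : l = l') : Jet f a' l' :=
  ha ▸ hl ▸ h

theorem Jet.constantCoeff_eq (h : Jet f a l) : constantCoeff f = a := by
  obtain ⟨w, rfl⟩ := h; simp

theorem Jet.coeff_one_eq (h : Jet f a l) : coeff 1 f = 0 := by
  obtain ⟨w, rfl⟩ := h
  simp only [map_add, coeff_C, coeff_X_pow_mul']
  simp

theorem Jet.coeff_two_eq (h : Jet f a l) : coeff 2 f = l := by
  obtain ⟨w, rfl⟩ := h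
  simp only [map_add, coeff_C, coeff_X_pow_mul']
  simp

theorem Jet.of_dvd (h : X ^ 3 ∣ f - g) (hg : Jet g a l) : Jet f a l := by
  obtain ⟨w, hw⟩ := hg
  obtain ⟨q, hq⟩ := h
  exact ⟨w + q, by linear_combination hq + hw⟩

theorem Jet.const (a : ℂ) : Jet (C a) a 0 := ⟨0, by simp⟩

theorem Jet.one : Jet 1 1 0 := (Jet.const 1).of_dvd (by simp)

theorem Jet.add (h : Jet f a l) (h' : Jet g b m) : Jet (f + g) (a + b) (l + m) := by
  obtain ⟨w, rfl⟩ := h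
  obtain ⟨w', rfl⟩ := h'
  exact ⟨w + w', by rw [map_add, map_add]; ring⟩

theorem Jet.neg (h : Jet f a l) : Jet (-f) (-a) (-l) := by
  obtain ⟨w, rfl⟩ := h
  exact ⟨-w, by rw [map_neg, map_neg]; ring⟩

theorem Jet.sub (h : Jet f a l) (h' : Jet g b m) : Jet (f - g) (a - b) (l - m) := by
  simpa only [sub_eq_add_neg] using h.add h'.neg

theorem Jet.mul (h : Jet f a l) (h' : Jet g b m) : Jet (f * g) (a * b) (l * b + a * m) := by
  obtain ⟨w, rfl⟩ := h
  obtain ⟨w', rfl⟩ := h'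
  refine ⟨X * (C l * C m) + w * (C b + X ^ 2 * C m + X ^ 3 * w') + w' * (C a + X ^ 2 * C l), ?_⟩
  simp only [map_add, map_mul]
  ring

theorem Jet.inv (h : Jet f a l) (ha : a ≠ 0) : Jet f⁻¹ a⁻¹ (-(l * a⁻¹ ^ 2)) := by
  have e1 := PowerSeries.mul_inv_cancel f (by rwa [h.constantCoeff_eq])
  obtain ⟨w, hw⟩ := h.mul (⟨0, rfl⟩ : Jet (C a⁻¹ + X ^ 2 * C (-(l * a⁻¹ ^ 2)) + X ^ 3 * 0) a⁻¹ _)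
  have e2 : l * a⁻¹ + a * -(l * a⁻¹ ^ 2) = 0 := by field_simp; ring
  rw [e2, mul_inv_cancel₀ ha, map_one, map_zero, mul_zero, add_zero, mul_zero, add_zero] at hw
  refine ⟨-(f⁻¹ * w), ?_⟩
  linear_combination -f⁻¹ * hw + (C a⁻¹ + X ^ 2 * C (-(l * a⁻¹ ^ 2))) * e1

theorem Jet.X_sq_mul (h : constantCoeff f = a) : Jet (X ^ 2 * f) 0 a := by
  obtain ⟨q, hq⟩ := X_dvd_iff.2 (show constantCoeff (f - C a) = 0 by simp [h])
  exact ⟨q, by rw [map_zero]; linear_combination X ^ 2 * hq⟩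

/-- From `y = v - h²/y`, where to this order `y` on the right may be replaced by its constant term.
-/
theorem Jet.deformed (h : Jet f a l) (ha : a ≠ 0) : Jet (deformed f) a (l - a⁻¹) := by
  have hf := h.constantCoeff_eq
  have s := deformed_spec f (by rwa [hf])
  have c := constantCoeff_deformed f
  rw [hf] at c
  have e := PowerSeries.mul_inv_cancel (ABJM.deformed f) (by rwa [c])
  have : ABJM.deformed f = f - X ^ 2 * (ABJM.deformed f)⁻¹ := by
    linear_combination (ABJM.deformed f)⁻¹ * s - (ABJM.deformed f - f) * e
  rw [this]
  exact (h.sub (Jet.X_sq_mul (by rw [constantCoeff_inv, c]))).congr (sub_zero a) rfl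

theorem Jet.yPlus (h : Jet f a l) (ha : a.im = 0) :
    Jet (yPlus f) (a + Complex.I / 2) (l - (a + Complex.I / 2)⁻¹) :=
  ((h.add (Jet.const (Complex.I / 2))).congr rfl (add_zero l)).deformed (add_I_div_two_ne_zero ha)

theorem Jet.yMinus (h : Jet f a l) (ha : a.im = 0) :
    Jet (yMinus f) (a - Complex.I / 2) (l - (a - Complex.I / 2)⁻¹) :=
  ((h.sub (Jet.const (Complex.I / 2))).congr rfl (sub_zero l)).deformed (sub_I_div_two_ne_zero ha)

theorem X_pow_four_dvd_besPhase (u w : PowerSeries ℂ) : X ^ 4 ∣ besPhase u w := by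
  rw [X_pow_dvd_iff]
  intro i hi
  rw [besPhase, coeff_mk]
  refine X_pow_dvd_iff.1 (Finset.dvd_sum fun r hr => Finset.dvd_sum fun ν _ =>
    Finset.dvd_sum fun μ _ => ?_) i hi
  have hr2 : 2 ≤ r := (mem_Icc.1 hr).1
  exact ((pow_dvd_pow X (by omega)).mul_left _).mul_right _

theorem jet_besSigmaSq (u w : PowerSeries ℂ) : Jet (besSigmaSq u w) 1 0 := by
  have h4 : X ^ 4 ∣ C (2 * Complex.I) * besPhase u w := (X_pow_four_dvd_besPhase u w).mul_left _
  have h0 : constantCoeff (C (2 * Complex.I) * besPhase u w) = 0 :=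
    X_dvd_iff.1 ((Dvd.intro_left _ (by ring : X ^ 3 * X = (X : PowerSeries ℂ) ^ 4)).trans h4)
  have h := X_pow_dvd_subst_sub (PowerSeries.exp ℂ) h0 (B := 0) (by simp) (n := 3) (by
    rw [sub_zero]; exact (pow_dvd_pow X (by norm_num)).trans h4)
  refine Jet.of_dvd h ?_
  rw [subst_zero_eq_C_constantCoeff]
  exact (Jet.const _).congr (by simp) rfl

/-- `f = a (1 + l h² + O(h³))` with `a ≠ 0`. -/
def LogJet (f : PowerSeries ℂ) (a l : ℂ) : Prop := a ≠ 0 ∧ Jet f a (a * l)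

theorem LogJet.congr {a' l' : ℂ} (h : LogJet f a l) (ha : a = a') (hl : l = l') : LogJet f a' l' :=
  ha ▸ hl ▸ h

theorem Jet.logJet (h : Jet f a l) (ha : a ≠ 0) : LogJet f a (l / a) :=
  ⟨ha, h.congr rfl (by field_simp)⟩

theorem LogJet.mul (h : LogJet f a l) (h' : LogJet g b m) : LogJet (f * g) (a * b) (l + m) :=
  ⟨mul_ne_zero h.1 h'.1, (h.2.mul h'.2).congr rfl (by ring)⟩

theorem LogJet.inv (h : LogJet f a l) : LogJet f⁻¹ a⁻¹ (-l) :=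
  ⟨inv_ne_zero h.1, (h.2.inv h.1).congr rfl (by have := h.1; field_simp)⟩

theorem LogJet.neg (h : LogJet f a l) : LogJet (-f) (-a) l :=
  ⟨neg_ne_zero.2 h.1, h.2.neg.congr rfl (by ring)⟩

theorem LogJet.sq (h : LogJet f a l) : LogJet (f ^ 2) (a ^ 2) (2 * l) := by
  rw [pow_two f]
  exact (h.mul h).congr (pow_two a).symm (by ring)

theorem LogJet.prod {κ : Type*} (s : Finset κ) {f : κ → PowerSeries ℂ} {a l : κ → ℂ}
    (h : ∀ j ∈ s, LogJet (f j) (a j) (l j)) :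
    LogJet (∏ j ∈ s, f j) (∏ j ∈ s, a j) (∑ j ∈ s, l j) := by
  classical
  induction s using Finset.induction_on with
  | empty =>
    simp only [prod_empty, sum_empty]
    exact ⟨one_ne_zero, Jet.one.congr rfl (by simp)⟩
  | insert j s hj ih =>
    simp only [prod_insert hj, sum_insert hj]
    exact (h j (mem_insert_self j s)).mul (ih fun i hi => h i (mem_insert_of_mem hi))

theorem logJet_one_sub (h : constantCoeff f = a) : LogJet (1 - X ^ 2 * f) 1 (-a) :=
  ⟨one_ne_zero, (Jet.one.sub (Jet.X_sq_mul h)).congr (by ring) (by ring)⟩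

/-- The `h²` shifts of `y^±` in the rational factor and the explicit factors `1 - h²/(y y)`
contribute the same products of inverses, hence the coefficient 2. -/
theorem logJet_scattering {u w : PowerSeries ℂ} (hu : Jet u a l) (hw : Jet w b m) (ha : a.im = 0)
    (hb : b.im = 0) :
    LogJet (scattering u w) ((a - b - Complex.I) * (a - b + Complex.I)⁻¹)
      ((1 / (a - b - Complex.I) - 1 / (a - b + Complex.I)) * (l - m)
        + (2 * (a - Complex.I / 2)⁻¹ * (b + Complex.I / 2)⁻¹
          - 2 * (a + Complex.I / 2)⁻¹ * (b - Complex.I / 2)⁻¹)) := by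
  have hd : (a - b).im = 0 := by simp [ha, hb]
  have hd1 := sub_I_ne_zero hd
  have hd2 := add_I_ne_zero hd
  have a1 := add_I_div_two_ne_zero ha
  have a2 := sub_I_div_two_ne_zero ha
  have b1 := add_I_div_two_ne_zero hb
  have b2 := sub_I_div_two_ne_zero hb
  have h1 := ((hu.yMinus ha).sub (hw.yPlus hb)).congr (a' := a - b - Complex.I) (by ring) rfl
  have h2 := ((hu.yPlus ha).sub (hw.yMinus hb)).congr (a' := a - b + Complex.I) (by ring) rfl
  have h3 := logJet_one_sub (((hu.yPlus ha).mul (hw.yMinus hb)).inv (mul_ne_zero a1 b2)).constantCoeff_eq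
  have h4 := logJet_one_sub (((hu.yMinus ha).mul (hw.yPlus hb)).inv (mul_ne_zero a2 b1)).constantCoeff_eq
  refine ((((h1.logJet hd1).mul (h2.logJet hd2).inv).mul (h3.mul h4.inv)).mul
    (show LogJet (besSigmaSq u w) 1 0 from ⟨one_ne_zero, (jet_besSigmaSq u w).congr rfl (by simp)⟩)).congr
    (by simp) ?_
  have e1 : a - b - Complex.I = (a - Complex.I / 2) - (b + Complex.I / 2) := by ring
  have e2 : a - b + Complex.I = (a + Complex.I / 2) - (b - Complex.I / 2) := by ring
  rw [e1] at hd1 ⊢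
  rw [e2] at hd2 ⊢
  generalize a - Complex.I / 2 = A at *
  generalize a + Complex.I / 2 = A' at *
  generalize b - Complex.I / 2 = B at *
  generalize b + Complex.I / 2 = B' at *
  have k1 : (-A⁻¹ + B'⁻¹) / (A - B') = A⁻¹ * B'⁻¹ := by field_simp; ring
  have k2 : (-A'⁻¹ + B⁻¹) / (A' - B) = A'⁻¹ * B⁻¹ := by field_simp; ring
  have k3 : (l - A⁻¹ - (m - B'⁻¹)) / (A - B') = (l - m) * (1 / (A - B')) + A⁻¹ * B'⁻¹ := by
    rw [← k1]; ring
  have k4 : (l - A'⁻¹ - (m - B⁻¹)) / (A' - B) = (l - m) * (1 / (A' - B)) + A'⁻¹ * B⁻¹ := by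
    rw [← k2]; ring
  rw [k3, k4, mul_inv, mul_inv]
  ring

theorem logJet_betheRatio {ι : Type*} [Fintype ι] [DecidableEq ι] {u : ι → PowerSeries ℂ}
    {c η : ι → ℂ} (hu : ∀ k, Jet (u k) (c k) (η k)) (hc : ∀ k, (c k).im = 0) (k : ι) :
    LogJet (betheRatio k u)
      (((c k + Complex.I / 2) * (c k - Complex.I / 2)⁻¹) ^ 2 *
        (-∏ j ∈ univ.erase k, (c k - c j - Complex.I) * (c k - c j + Complex.I)⁻¹)⁻¹)
      (2 * ((η k - (c k + Complex.I / 2)⁻¹) / (c k + Complex.I / 2)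
          - (η k - (c k - Complex.I / 2)⁻¹) / (c k - Complex.I / 2))
        - ∑ j, (scatteringKernel c k j * (η k - η j)
          + (2 * (c k - Complex.I / 2)⁻¹ * (c j + Complex.I / 2)⁻¹
            - 2 * (c k + Complex.I / 2)⁻¹ * (c j - Complex.I / 2)⁻¹))) := by
  have h1 := (((hu k).yPlus (hc k)).logJet (add_I_div_two_ne_zero (hc k))).mul
    (((hu k).yMinus (hc k)).logJet (sub_I_div_two_ne_zero (hc k))).inv
  have h2 := LogJet.prod (univ.erase k) fun j _ => logJet_scattering (hu k) (hu j) (hc k) (hc j)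
  refine (h1.sq.mul h2.neg.inv).congr rfl ?_
  -- The sum may run over all `j` because the term `j = k` vanishes identically.
  rw [← add_sum_erase _ _ (mem_univ k)]
  simp only [scatteringKernel]
  ring

/-! ### The anomalous dimension -/

theorem psSqrt_eq {s : PowerSeries ℂ} (h : s * s = f) (hs : constantCoeff s = 1) : psSqrt f = s := by
  have hf : constantCoeff f = 1 := by rw [← h, map_mul, hs, one_mul]
  have h1 := psSqrt_mul_self f hf
  have h2 : (psSqrt f - s) * (psSqrt f + s) = 0 := by linear_combination h1 - h
  rcases mul_eq_zero.1 h2 with h3 | h3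
  · exact sub_eq_zero.1 h3
  · have := congrArg constantCoeff h3
    rw [map_add, constantCoeff_psSqrt hf, hs] at this
    norm_num at this

/-- Exact in `h`: the right-hand side squares to the radicand by the defining equations of `y^±`,
and a square root with constant coefficient 1 is unique. -/
theorem dispersion_eq (u : PowerSeries ℂ) (hu : (constantCoeff u).im = 0) :
    psSqrt (1 + 16 * X ^ 2 * sinSqHalfMomentum u) =
      1 + X ^ 2 * (C (2 * Complex.I) * ((yPlus u)⁻¹ - (yMinus u)⁻¹)) := by
  refine psSqrt_eq ?_ (by simp)
  have p0 := add_I_div_two_ne_zero hu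
  have m0 := sub_I_div_two_ne_zero hu
  have sp := deformed_spec (u + C (Complex.I / 2)) (by simpa using p0)
  have sm := deformed_spec (u - C (Complex.I / 2)) (by simpa using m0)
  rw [← yPlus] at sp
  rw [← yMinus] at sm
  have ip := PowerSeries.mul_inv_cancel (yPlus u) (by rwa [constantCoeff_yPlus])
  have im := PowerSeries.mul_inv_cancel (yMinus u) (by rwa [constantCoeff_yMinus])
  have h16 : (16 : PowerSeries ℂ) * C (1 / 4) = 4 := by
    rw [show (16 : PowerSeries ℂ) = C 16 from (map_ofNat C 16).symm,
      show (4 : PowerSeries ℂ) = C 4 from (map_ofNat C 4).symm, ← map_mul]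
    norm_num
  have hI : (C Complex.I : PowerSeries ℂ) ^ 2 = -1 := by
    rw [← map_pow, Complex.I_sq, map_neg, map_one]
  have hI2 : (C (Complex.I / 2) : PowerSeries ℂ) * 2 = C Complex.I := by
    rw [show (2 : PowerSeries ℂ) = C 2 from (map_ofNat C 2).symm, ← map_mul]
    congr 1; ring
  have h2I : (C (2 * Complex.I) : PowerSeries ℂ) = 2 * C Complex.I := by
    rw [map_mul, map_ofNat]
  rw [sinSqHalfMomentum, h2I]
  generalize yPlus u = p at *
  generalize yMinus u = q at *
  generalize p⁻¹ = P at *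
  generalize q⁻¹ = Q at *
  generalize (C Complex.I : PowerSeries ℂ) = i at *
  generalize (C (Complex.I / 2) : PowerSeries ℂ) = j at *
  generalize (C (1 / 4 : ℂ) : PowerSeries ℂ) = r at *
  have sp' : p + X ^ 2 * P = u + j := by
    linear_combination P * sp - (p - (u + j)) * ip
  have sm' : q + X ^ 2 * Q = u - j := by
    linear_combination Q * sm - (q - (u - j)) * im
  -- The difference of the equations `y^± + h²/y^± = u ± i/2`.
  have hi : i = p - q + X ^ 2 * (P - Q) := by linear_combination sm' - sp' - hI2
  have hPQ : i * (P - Q) = p * P - p * Q - q * P + q * Q + X ^ 2 * (P - Q) ^ 2 := by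
    rw [hi]; ring
  linear_combination (4 * X ^ 2) * hPQ + (4 * X ^ 4 * (P - Q) ^ 2) * hI
    - (X ^ 2 * (2 - p * Q - q * P)) * h16 + 4 * X ^ 2 * ip + 4 * X ^ 2 * im

theorem coeff_four_gammaABA {N : ℕ} {u : Fin N → PowerSeries ℂ} {c η : Fin N → ℂ}
    (hu : ∀ k, Jet (u k) (c k) (η k)) (hc : ∀ k, (c k).im = 0) :
    coeff 4 (gammaABA u) = ∑ k, 2 * Complex.I *
      (-((η k - (c k + Complex.I / 2)⁻¹) * (c k + Complex.I / 2)⁻¹ ^ 2)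
        + (η k - (c k - Complex.I / 2)⁻¹) * (c k - Complex.I / 2)⁻¹ ^ 2) := by
  rw [gammaABA, map_sum]
  refine sum_congr rfl fun k _ => ?_
  have h := (((hu k).yPlus (hc k)).inv (add_I_div_two_ne_zero (hc k))).sub
    (((hu k).yMinus (hc k)).inv (sub_I_div_two_ne_zero (hc k)))
  rw [dispersion_eq _ (by rw [(hu k).constantCoeff_eq, hc]), add_sub_cancel_left,
    show 4 = 2 + 2 from rfl, coeff_X_pow_mul, coeff_C_mul, h.coeff_two_eq]
  ring

/-! ### First order expansion of products -/

theorem Jet.prod {κ : Type*} [DecidableEq κ] (s : Finset κ) {f : κ → PowerSeries ℂ} {a l : κ → ℂ}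
    (h : ∀ j ∈ s, Jet (f j) (a j) (l j)) :
    Jet (∏ j ∈ s, f j) (∏ j ∈ s, a j) (∑ j ∈ s, l j * ∏ i ∈ s.erase j, a i) := by
  induction s using Finset.induction_on with
  | empty =>
    simp only [prod_empty, sum_empty]
    exact Jet.one
  | insert j s hj ih =>
    have e : ∑ k ∈ insert j s, l k * ∏ i ∈ (insert j s).erase k, a i =
        l j * ∏ i ∈ s, a i + a j * ∑ k ∈ s, l k * ∏ i ∈ s.erase k, a i := by
      rw [sum_insert hj, erase_insert hj, mul_sum]
      congr 1
      refine sum_congr rfl fun k hk => ?_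
      have hjk : j ≠ k := fun e => hj (e ▸ hk)
      rw [erase_insert_of_ne hjk, prod_insert fun h => hj (mem_of_mem_erase h)]
      ring
    rw [e, prod_insert hj, prod_insert hj]
    exact (h j (mem_insert_self j s)).mul (ih fun i hi => h i (mem_insert_of_mem hi))

end Jets

/-! ### Newton's identities up to degree three -/

section Newton
open Polynomial

theorem coeff_prod_one_add {κ : Type*} (s : Finset κ) (x : κ → ℂ) :
    (∏ k ∈ s, (1 + C (x k) * X)).coeff 0 = 1 ∧
    (∏ k ∈ s, (1 + C (x k) * X)).coeff 1 = ∑ k ∈ s, x k ∧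
    2 * (∏ k ∈ s, (1 + C (x k) * X)).coeff 2 = (∑ k ∈ s, x k) ^ 2 - ∑ k ∈ s, x k ^ 2 ∧
    6 * (∏ k ∈ s, (1 + C (x k) * X)).coeff 3 = (∑ k ∈ s, x k) ^ 3
      - 3 * (∑ k ∈ s, x k) * (∑ k ∈ s, x k ^ 2) + 2 * ∑ k ∈ s, x k ^ 3 := by
  classical
  induction s using Finset.induction_on with
  | empty => simp [coeff_one]
  | insert j s hj ih =>
    obtain ⟨h0, h1, h2, h3⟩ := ih
    simp only [prod_insert hj, sum_insert hj]
    generalize ∏ k ∈ s, (1 + C (x k) * X) = p at *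
    simp only [add_mul, one_mul, mul_assoc, coeff_add, coeff_C_mul, coeff_X_mul, coeff_X_mul_zero]
    generalize ∑ k ∈ s, x k = s1 at *
    generalize ∑ k ∈ s, x k ^ 2 = s2 at *
    generalize ∑ k ∈ s, x k ^ 3 = s3 at *
    refine ⟨?_, ?_, ?_, ?_⟩
    · linear_combination h0
    · linear_combination h1 + x j * h0
    · linear_combination h2 + 2 * x j * h1
    · linear_combination h3 + 3 * x j * h2

theorem coeff_sum_prod_erase {κ : Type*} [Fintype κ] [DecidableEq κ] (x y : κ → ℂ) :
    (∑ k, C (y k) * ∏ j ∈ univ.erase k, (1 + C (x j) * X)).coeff 0 = ∑ k, y k ∧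
    (∑ k, C (y k) * ∏ j ∈ univ.erase k, (1 + C (x j) * X)).coeff 1 =
      (∑ k, x k) * (∑ k, y k) - ∑ k, y k * x k := by
  simp only [finsetSum_coeff, coeff_C_mul, (coeff_prod_one_add _ x).1,
    (coeff_prod_one_add _ x).2.1, mul_one, true_and]
  rw [mul_sum, ← sum_sub_distrib]
  refine sum_congr rfl fun k _ => ?_
  rw [← add_sum_erase univ x (mem_univ k)]
  ring

end Newton

section Roots
open Polynomial Complex

/-! ### The leading order Bethe roots -/

theorem exists_roots (M : ℕ) : ∃ c : Fin (M + M) → ℂ,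
    ∀ z, baxterOp (M + M) (fun w => ∏ k, (w - c k)) z = 0 := by
  set Q := spectralPoly (binomialPoly M 1) with hQ
  have hs := IsAlgClosed.splits Q
  have hcard : Q.roots.toList.length = M + M := by
    rw [Multiset.length_toList, ← hs.natDegree_eq_card_roots, hQ, natDegree_spectralPoly_Q0]
  have hne : Q.leadingCoeff ≠ 0 := by
    rw [Ne, leadingCoeff_eq_zero]
    intro h
    have := eval_spectralPoly_Q0 M (I / 2)
    rw [← hQ, h, baxterQ0_I_div_two, eval_zero] at this
    exact zero_ne_one this
  have hroots : ∀ n, Q.roots.toList.length = n → ∃ c : Fin n → ℂ, ∀ w,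
      baxterQ0 (M + M) w = Q.leadingCoeff * ∏ k, (w - c k) := by
    rintro _ rfl
    refine ⟨fun k => Q.roots.toList[k.1], fun w => ?_⟩
    refine (eval_spectralPoly_Q0 M w).symm.trans ((hs.eval_eq_prod_roots w).trans ?_)
    congr 1
    rw [Fin.prod_univ_fun_getElem Q.roots.toList (fun a => w - a), ← Multiset.prod_coe,
      ← Multiset.map_coe, Multiset.coe_toList]
  obtain ⟨c, hc⟩ := hroots _ hcard
  refine ⟨c, fun z => mul_left_cancel₀ hne ?_⟩
  have := baxterOp_baxterQ0 M z
  simp only [baxterOp, hc] at this ⊢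
  linear_combination this

/-- Leading order roots of the twist-two ground state. -/
structure RootData (M : ℕ) (c : Fin (M + M) → ℂ) (p : ℂ) : Prop where
  eq : ∀ w, baxterQ0 (M + M) w = p * ∏ k, (w - c k)
  ne : p ≠ 0

/-- The monic product solves the Baxter equation, so by uniqueness it is its value at `i/2` times
`Q⁽⁰⁾`; that value is nonzero because the product is. -/
theorem exists_rootData {M : ℕ} {c : Fin (M + M) → ℂ}
    (h : ∀ z, baxterOp (M + M) (fun w => ∏ k, (w - c k)) z = 0) : ∃ p, RootData M c p := by
  have he : ∀ w, (∏ k, (X - C (c k))).eval w = ∏ k, (w - c k) := fun w => by simp [eval_prod]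
  have h1 := eval_eq_mul_baxterQ0 (M := M) (p := ∏ k, (X - C (c k))) (by simpa only [he] using h)
  have hne : (∏ k, (X - C (c k))).eval (I / 2) ≠ 0 := by
    intro h0
    rw [h0, C_0, zero_mul] at h1
    exact (monic_prod_of_monic _ _ fun k _ => monic_X_sub_C (c k)).ne_zero h1
  refine ⟨_, fun w => ?_, inv_ne_zero hne⟩
  rw [← he, eq_inv_mul_iff_mul_eq₀ hne, ← eval_spectralPoly_Q0, ← eval_C (x := w) (a := eval (I / 2) _),
    ← eval_mul, ← h1]

namespace RootData

variable {M : ℕ} {c : Fin (M + M) → ℂ} {p : ℂ} (h : RootData M c p)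
include h

theorem poly_eq : spectralPoly (binomialPoly M 1) = C p * ∏ k, (X - C (c k)) := by
  refine Polynomial.funext fun w => ?_
  rw [eval_spectralPoly_Q0, h.eq]
  simp [eval_prod]

theorem eval_root (k : Fin (M + M)) : (spectralPoly (binomialPoly M 1)).eval (c k) = 0 := by
  rw [eval_spectralPoly_Q0, h.eq, prod_eq_zero (mem_univ k) (sub_self _), mul_zero]

theorem im_eq_zero (k : Fin (M + M)) : (c k).im = 0 := (spectralPoly_root (h.eval_root k)).1

theorem eval_derivative (z : ℂ) : (derivative (spectralPoly (binomialPoly M 1))).eval z =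
    p * ∑ k, ∏ j ∈ univ.erase k, (z - c j) := by
  rw [h.poly_eq, derivative_C_mul, derivative_prod_finset]
  simp [eval_finsetSum, eval_prod]

theorem eval_derivative_root (k : Fin (M + M)) :
    (derivative (spectralPoly (binomialPoly M 1))).eval (c k) =
      p * ∏ j ∈ univ.erase k, (c k - c j) := by
  rw [h.eval_derivative, sum_eq_single k]
  · intro j _ hj
    exact prod_eq_zero (mem_erase.2 ⟨hj.symm, mem_univ k⟩) (sub_self _)
  · simp

theorem injective : Function.Injective c := by
  intro i k hik
  by_contra hne
  refine (spectralPoly_root (h.eval_root k)).2 ?_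
  rw [h.eval_derivative_root, prod_eq_zero (mem_erase.2 ⟨hne, mem_univ i⟩) (sub_eq_zero.2 hik.symm),
    mul_zero]

omit h in
/-- The second order corrections to the Bethe roots. -/
def _root_.ABJM.rootShift (M : ℕ) (z : ℂ) : ℂ :=
  -baxterQ1 (M + M) z / (derivative (spectralPoly (binomialPoly M 1))).eval z

theorem rootShift_mul (k : Fin (M + M)) : rootShift M (c k) *
    (derivative (spectralPoly (binomialPoly M 1))).eval (c k) = -baxterQ1 (M + M) (c k) :=
  div_mul_cancel₀ _ (spectralPoly_root (h.eval_root k)).2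

/-- Lagrange interpolation: both sides have degree below `N`, and they agree at the `N` distinct
roots by the choice of `rootShift`. -/
theorem baxterQ1_eq_sum_prod (z : ℂ) : baxterQ1 (M + M) z =
    -(p * ∑ k, rootShift M (c k) * ∏ j ∈ univ.erase k, (z - c j)) := by
  have key : spectralPoly (binomialPoly M (nloCoeff M)) =
      ∑ k, C (-(p * rootShift M (c k))) * ∏ j ∈ univ.erase k, (X - C (c j)) := by
    refine eq_of_degrees_lt_of_eval_index_eq univ (h.injective.injOn) ?_ ?_ fun k _ => ?_
    · rw [card_univ, Fintype.card_fin]; exact degree_spectralPoly_Q1_lt M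
    · rw [card_univ, Fintype.card_fin, ← mem_degreeLT]
      refine Submodule.sum_mem _ fun k _ => ?_
      rw [mem_degreeLT]
      refine (degree_mul_le _ _).trans_lt ((add_le_add_left degree_C_le _).trans_lt ?_)
      rw [degree_prod]
      simp only [degree_X_sub_C, sum_const, card_erase_of_mem (mem_univ k), card_univ,
        Fintype.card_fin, zero_add, nsmul_eq_mul, mul_one]
      have : 0 < M + M := k.pos
      exact_mod_cast Nat.sub_lt this one_pos
    · rw [eval_spectralPoly_Q1, eval_finsetSum, sum_eq_single k]
      · have := h.rootShift_mul k
        rw [h.eval_derivative_root] at this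
        simp only [eval_mul, eval_C, eval_prod, eval_sub, eval_X]
        linear_combination this
      · intro j _ hj
        rw [eval_mul, eval_prod, prod_eq_zero (mem_erase.2 ⟨hj.symm, mem_univ k⟩), mul_zero]
        simp
      · simp
  rw [← eval_spectralPoly_Q1, key]
  simp only [eval_finsetSum, eval_mul, eval_C, eval_prod, eval_sub, eval_X]
  rw [mul_sum, ← sum_neg_distrib]
  exact sum_congr rfl fun k _ => by ring

theorem baxterQ1_eq_mul_sum {z : ℂ} (hz : ∀ k, z - c k ≠ 0) : baxterQ1 (M + M) z =
    -(baxterQ0 (M + M) z * ∑ k, rootShift M (c k) * (1 / (z - c k))) := by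
  rw [h.baxterQ1_eq_sum_prod, h.eq, mul_assoc]
  congr 2
  rw [mul_sum]
  refine sum_congr rfl fun k _ => ?_
  have hk := Finset.mul_prod_erase univ (fun j => z - c j) (mem_univ k)
  have := hz k
  rw [← hk]
  field_simp

theorem eval_derivative_eq_mul_sum {z : ℂ} (hz : ∀ k, z - c k ≠ 0) :
    (derivative (spectralPoly (binomialPoly M 1))).eval z =
      baxterQ0 (M + M) z * ∑ k, 1 / (z - c k) := by
  rw [h.eval_derivative, h.eq, mul_assoc]
  congr 1
  rw [mul_sum]
  refine sum_congr rfl fun k _ => ?_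
  have hk := Finset.mul_prod_erase univ (fun j => z - c j) (mem_univ k)
  have := hz k
  rw [← hk]
  field_simp

theorem baxterQ0_ne_zero {z : ℂ} (hz : ∀ k, z - c k ≠ 0) : baxterQ0 (M + M) z ≠ 0 := by
  rw [h.eq]
  exact mul_ne_zero h.ne (prod_ne_zero_iff.2 fun k _ => hz k)

/-! ### Expansions at `u = ± i / 2` -/

theorem sign_sub_ne_zero {s : ℂ} (hs : s = 1 ∨ s = -1) (k : Fin (M + M)) : s * (I / 2) - c k ≠ 0 := by
  intro h0
  have := congrArg Complex.im h0
  rcases hs with rfl | rfl <;> simp [h.im_eq_zero k] at this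

theorem mul_prod_sign {s : ℂ} (hs : s = 1 ∨ s = -1) : p * ∏ k, (s * (I / 2) - c k) = 1 := by
  rw [← h.eq]
  rcases hs with rfl | rfl
  · rw [one_mul, baxterQ0_I_div_two]
  · have : baxterQ0 (M + M) (-1 * (I / 2)) = baxterQ0 (M + M) (I / 2) := by
      rw [neg_one_mul, baxterQ0_eq, baxterQ0_eq]
      simp only [basisFun_neg]
    rw [this, baxterQ0_I_div_two]

omit h in
theorem _root_.ABJM.eval_comp_expansion {s : ℂ} (hs : s = 1 ∨ s = -1) (q : ℂ[X]) (a : ℂ) :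
    (q.comp (-(X + X ^ 2))).eval a = (spectralPoly q).eval (s * (I / 2) + s * I * a) := by
  have hs2 : s ^ 2 = 1 := by rcases hs with rfl | rfl <;> norm_num
  rw [eval_spectralPoly, eval_comp]
  congr 1
  simp only [eval_neg, eval_add, eval_X, eval_pow]
  linear_combination (-(a + 1 / 2) ^ 2 * I ^ 2) * hs2 - (a + 1 / 2) ^ 2 * I_sq

theorem factor_eq {s : ℂ} (hs : s = 1 ∨ s = -1) (a : ℂ) (k : Fin (M + M)) :
    s * (I / 2) + s * I * a - c k = (s * (I / 2) - c k) * (1 + s * I * (1 / (s * (I / 2) - c k)) * a) := by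
  linear_combination (-(s * I * a)) * mul_one_div_cancel (h.sign_sub_ne_zero hs k)

theorem expansion_Q0 {s : ℂ} (hs : s = 1 ∨ s = -1) : (binomialPoly M 1).comp (-(X + X ^ 2)) =
    ∏ k, (1 + C (s * I * (1 / (s * (I / 2) - c k))) * X) := by
  refine Polynomial.funext fun a => ?_
  rw [eval_comp_expansion hs, eval_spectralPoly_Q0, h.eq]
  simp only [h.factor_eq hs]
  rw [prod_mul_distrib, ← mul_assoc, h.mul_prod_sign hs, one_mul]
  simp [eval_prod]

theorem expansion_Q1 {s : ℂ} (hs : s = 1 ∨ s = -1) :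
    (binomialPoly M (nloCoeff M)).comp (-(X + X ^ 2)) =
    ∑ k, C (-(rootShift M (c k) * (1 / (s * (I / 2) - c k)))) *
      ∏ j ∈ univ.erase k, (1 + C (s * I * (1 / (s * (I / 2) - c j))) * X) := by
  refine Polynomial.funext fun a => ?_
  rw [eval_comp_expansion hs, eval_spectralPoly_Q1, h.baxterQ1_eq_sum_prod, mul_sum, ← sum_neg_distrib,
    eval_finsetSum]
  refine sum_congr rfl fun k _ => ?_
  simp only [h.factor_eq hs, eval_mul, eval_C, eval_prod, eval_add, eval_one, eval_X]
  rw [prod_mul_distrib]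
  have h1 := h.mul_prod_sign hs
  rw [← mul_prod_erase _ _ (mem_univ k)] at h1
  have h2 := h.sign_sub_ne_zero hs k
  have h3 : p * ∏ j ∈ univ.erase k, (s * (I / 2) - c j) = 1 / (s * (I / 2) - c k) := by
    rw [eq_div_iff h2, ← h1]; ring
  rw [← h3]
  ring

/-- Equates two forms of the Taylor coefficients at `s i/2`: harmonic sums from the recurrence and
the basis, and power sums over the roots through Newton's identities. -/
theorem power_sums {s : ℂ} (hs : s = 1 ∨ s = -1) :
    s * I * ∑ k, 1 / (s * (I / 2) - c k) = harm 1 M ∧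
    ∑ k, (1 / (s * (I / 2) - c k)) ^ 3 = s * I * (harm 3 M - 3 * harmNested M) ∧
    ∑ k, rootShift M (c k) * (1 / (s * (I / 2) - c k)) ^ 2 =
      s * I * (2 * harmNested M + 2 * harm 1 M * harm 2 M) := by
  have hs2 : s ^ 2 = 1 := by rcases hs with rfl | rfl <;> norm_num
  obtain ⟨⟨-, r1, r2, r3⟩, -⟩ := expansion_binomialPoly M
  obtain ⟨q0, q1⟩ := expansion_nlo M
  rw [h.expansion_Q0 hs] at r1 r2 r3
  rw [h.expansion_Q1 hs] at q0 q1
  obtain ⟨-, e1, e2, e3⟩ := coeff_prod_one_add univ fun k => s * I * (1 / (s * (I / 2) - c k))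
  obtain ⟨f0, f1⟩ := coeff_sum_prod_erase (fun k => s * I * (1 / (s * (I / 2) - c k)))
    (fun k => -(rootShift M (c k) * (1 / (s * (I / 2) - c k))))
  rw [r1] at e1
  rw [r2, ← e1] at e2
  rw [r3, ← e1] at e3
  rw [q0] at f0
  rw [q1, ← e1, ← f0] at f1
  have g3 : ∑ k, (s * I * (1 / (s * (I / 2) - c k))) ^ 3 =
      -(s * I) * ∑ k, (1 / (s * (I / 2) - c k)) ^ 3 := by
    rw [mul_sum]
    refine sum_congr rfl fun k _ => ?_
    linear_combination (s * I * (1 / (s * (I / 2) - c k)) ^ 3) * (s ^ 2 * I_sq - hs2)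
  have g2 : ∑ k, -(rootShift M (c k) * (1 / (s * (I / 2) - c k))) * (s * I * (1 / (s * (I / 2) - c k))) =
      -(s * I) * ∑ k, rootShift M (c k) * (1 / (s * (I / 2) - c k)) ^ 2 := by
    rw [mul_sum]
    exact sum_congr rfl fun k _ => by ring
  have hsI : s * I * (s * I) = -1 := by linear_combination s ^ 2 * I_sq - hs2
  rw [g3] at e3
  rw [g2] at f1
  refine ⟨by rw [e1, mul_sum], ?_, ?_⟩
  · generalize ∑ k, (s * I * (1 / (s * (I / 2) - c k))) ^ 2 = P2 at *
    generalize ∑ k, (1 / (s * (I / 2) - c k)) ^ 3 = P3 at *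
    generalize s * I = t at *
    linear_combination P3 * hsI + (-t) * (e3 - 3 * harm 1 M * e2) / 2
  · generalize ∑ k, rootShift M (c k) * (1 / (s * (I / 2) - c k)) ^ 2 = P3 at *
    generalize s * I = t at *
    linear_combination P3 * hsI + t * f1

/-! ### The Bethe equations at second order -/

omit h in
theorem _root_.ABJM.baxter_derivative (z : ℂ) :
    2 * (z + I / 2) * baxterQ0 (M + M) (z + I)
      + (z + I / 2) ^ 2 * (derivative (spectralPoly (binomialPoly M 1))).eval (z + I)
      - 2 * (z - I / 2) * baxterQ0 (M + M) (z - I)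
      - (z - I / 2) ^ 2 * (derivative (spectralPoly (binomialPoly M 1))).eval (z - I) =
    I * (2 * (M + M) + 2) * (baxterQ0 (M + M) z
      + z * (derivative (spectralPoly (binomialPoly M 1))).eval z) := by
  have e : ((X + C (I / 2)) ^ 2 * (spectralPoly (binomialPoly M 1)).comp (X + C I)
      - (X - C (I / 2)) ^ 2 * (spectralPoly (binomialPoly M 1)).comp (X - C I)) =
      C (I * (2 * (M + M) + 2)) * (X * spectralPoly (binomialPoly M 1)) := by
    refine Polynomial.funext fun w => ?_
    have := baxterOp_baxterQ0 M w
    rw [baxterOp] at this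
    simp only [eval_sub, eval_mul, eval_pow, eval_add, eval_X, eval_C, eval_comp,
      eval_spectralPoly_Q0]
    push_cast at this
    linear_combination this
  have := congrArg (fun q => (derivative q).eval z) e
  simp only [derivative_sub, derivative_mul, derivative_pow, derivative_add, derivative_X,
    derivative_C, derivative_comp, eval_sub, eval_mul, eval_pow, eval_add, eval_X, eval_C, eval_comp,
    eval_spectralPoly_Q0, eval_one, eval_zero] at this
  push_cast at this
  linear_combination this

/-- The vanishing of the `h²` term of the logarithm of the Bethe ratio. Shifted values of `Q⁽¹⁾` and
`Q⁽⁰⁾'` become sums over roots by partial fractions, and the harmonic number in the source matches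
the sums of `1/(c_j ± i/2)`. -/
theorem second_order_bethe (k : Fin (M + M)) :
    2 * ((rootShift M (c k) - (c k + I / 2)⁻¹) / (c k + I / 2)
          - (rootShift M (c k) - (c k - I / 2)⁻¹) / (c k - I / 2))
        - ∑ j, (scatteringKernel c k j * (rootShift M (c k) - rootShift M (c j))
          + (2 * (c k - I / 2)⁻¹ * (c j + I / 2)⁻¹ - 2 * (c k + I / 2)⁻¹ * (c j - I / 2)⁻¹)) = 0 := by
  have hp : ∀ j, c k + I - c j ≠ 0 := fun j => by
    have := add_I_ne_zero (z := c k - c j) (by simp [h.im_eq_zero])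
    rwa [show c k + I - c j = c k - c j + I by ring]
  have hm : ∀ j, c k - I - c j ≠ 0 := fun j => by
    have := sub_I_ne_zero (z := c k - c j) (by simp [h.im_eq_zero])
    rwa [show c k - I - c j = c k - c j - I by ring]
  have a1 := add_I_div_two_ne_zero (h.im_eq_zero k)
  have a2 := sub_I_div_two_ne_zero (h.im_eq_zero k)
  have q1 := h.baxterQ0_ne_zero hp
  have q2 := h.baxterQ0_ne_zero hm
  have d1 := h.eval_derivative_eq_mul_sum hp
  have d2 := h.eval_derivative_eq_mul_sum hm
  have r1 := h.baxterQ1_eq_mul_sum hp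
  have r2 := h.baxterQ1_eq_mul_sum hm
  have bd := baxter_derivative (M := M) (c k)
  have b0 := baxterOp_baxterQ0 M (c k)
  have b1 := baxterOp_baxterQ1 M (c k)
  have hq0 : baxterQ0 (M + M) (c k) = 0 := by rw [← eval_spectralPoly_Q0, h.eval_root]
  have hsh := h.rootShift_mul k
  rw [baxterOp, hq0] at b0
  rw [baxterOp, baxterNLOSource, hq0, harmonicSum_one_cast, show (M + M) / 2 = M by omega] at b1
  rw [hq0] at bd
  have s1 := (h.power_sums (s := 1) (Or.inl rfl)).1
  have s2 := (h.power_sums (s := -1) (Or.inr rfl)).1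
  have t1 : ∑ j, (c j - I / 2)⁻¹ = I * harm 1 M := by
    rw [← s1, mul_sum, mul_sum]
    refine sum_congr rfl fun j _ => ?_
    have n1 := h.sign_sub_ne_zero (s := 1) (Or.inl rfl) j
    have n2 := sub_I_div_two_ne_zero (h.im_eq_zero j)
    have : c j - I / 2 = -(1 * (I / 2) - c j) := by ring
    rw [this, inv_neg]
    linear_combination (-(1 / (1 * (I / 2) - c j))) * I_sq
  have t2 : ∑ j, (c j + I / 2)⁻¹ = -(I * harm 1 M) := by
    rw [← s2, mul_sum, mul_sum, ← sum_neg_distrib]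
    refine sum_congr rfl fun j _ => ?_
    have : c j + I / 2 = -(-1 * (I / 2) - c j) := by ring
    rw [this, inv_neg]
    linear_combination (-(1 / (-1 * (I / 2) - c j))) * I_sq
  have hsum : ∑ j, (scatteringKernel c k j * (rootShift M (c k) - rootShift M (c j))
          + (2 * (c k - I / 2)⁻¹ * (c j + I / 2)⁻¹ - 2 * (c k + I / 2)⁻¹ * (c j - I / 2)⁻¹)) =
      rootShift M (c k) * (∑ j, 1 / (c k - I - c j) - ∑ j, 1 / (c k + I - c j))
        - (∑ j, rootShift M (c j) * (1 / (c k - I - c j)) - ∑ j, rootShift M (c j) * (1 / (c k + I - c j)))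
        + 2 * (c k - I / 2)⁻¹ * ∑ j, (c j + I / 2)⁻¹ - 2 * (c k + I / 2)⁻¹ * ∑ j, (c j - I / 2)⁻¹ := by
    simp only [mul_sub, mul_sum, ← sum_sub_distrib, ← sum_add_distrib]
    refine sum_congr rfl fun j _ => ?_
    rw [scatteringKernel, show c k - c j - I = c k - I - c j by ring,
      show c k - c j + I = c k + I - c j by ring]
    ring
  rw [hsum, t1, t2]
  generalize rootShift M (c k) = η at *
  generalize ∑ j, 1 / (c k - I - c j) = D2 at *
  generalize ∑ j, 1 / (c k + I - c j) = D1 at *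
  generalize ∑ j, rootShift M (c j) * (1 / (c k - I - c j)) = R2 at *
  generalize ∑ j, rootShift M (c j) * (1 / (c k + I - c j)) = R1 at *
  rw [d1, d2] at bd
  rw [r1, r2] at b1
  -- By the leading Baxter equation at the root this factor also equals `(c_k - i/2)² Q⁽⁰⁾(c_k -
  -- i)`, so it clears both families of denominators.
  have hV : (c k + I / 2) ^ 2 * baxterQ0 (M + M) (c k + I) ≠ 0 := mul_ne_zero (pow_ne_zero 2 a1) q1
  refine mul_left_cancel₀ hV ?_
  rw [mul_zero]
  generalize baxterQ0 (M + M) (c k + I) = A at *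
  generalize baxterQ0 (M + M) (c k - I) = B at *
  generalize baxterQ1 (M + M) (c k) = q at *
  generalize (derivative (spectralPoly (binomialPoly M 1))).eval (c k) = Q' at *
  have eV : (c k + I / 2) ^ 2 * A = (c k - I / 2) ^ 2 * B := by linear_combination b0
  have ip := mul_inv_cancel₀ a1
  have im := mul_inv_cancel₀ a2
  push_cast at bd b1
  simp only [div_eq_mul_inv _ (c k + I / 2), div_eq_mul_inv _ (c k - I / 2)]
  generalize (c k + I / 2)⁻¹ = P at *
  generalize (c k - I / 2)⁻¹ = Q at *
  generalize c k + I / 2 = x at *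
  generalize c k - I / 2 = y at *
  generalize harm 1 M = H at *
  have v1 : x ^ 2 * A * P = x * A := by linear_combination x * A * ip
  have v2 : x ^ 2 * A * Q = y * B := by rw [eV]; linear_combination y * B * im
  have v3 : x ^ 2 * A * P ^ 2 = A := by linear_combination (x * P + 1) * A * ip
  have v4 : x ^ 2 * A * Q ^ 2 = B := by rw [eV]; linear_combination (y * Q + 1) * B * im
  -- Adds `η` times the differentiated leading equation to the next-to-leading one; `hsh` cancels
  -- the unshifted terms `η Q⁽⁰⁾'(c_k) + Q⁽¹⁾(c_k)`.
  linear_combination (2 * η + 2 * I * H) * v1 - (2 * η - 2 * I * H) * v2 - 2 * v3 + 2 * v4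
    + η * bd + b1 + I * (2 * (M + M) + 2) * c k * hsh + (-η * D2 + R2) * eV

theorem gamma_eq : ∑ k, 2 * I *
      (-((rootShift M (c k) - (c k + I / 2)⁻¹) * (c k + I / 2)⁻¹ ^ 2)
        + (rootShift M (c k) - (c k - I / 2)⁻¹) * (c k - I / 2)⁻¹ ^ 2) =
    ((gammaFour (M + M) : ℚ) : ℂ) := by
  obtain ⟨-, a3, a2⟩ := h.power_sums (s := 1) (Or.inl rfl)
  obtain ⟨-, b3, b2⟩ := h.power_sums (s := -1) (Or.inr rfl)
  have e : ∑ k, 2 * I *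
      (-((rootShift M (c k) - (c k + I / 2)⁻¹) * (c k + I / 2)⁻¹ ^ 2)
        + (rootShift M (c k) - (c k - I / 2)⁻¹) * (c k - I / 2)⁻¹ ^ 2) =
      2 * I * (∑ k, (1 / (1 * (I / 2) - c k)) ^ 3 - ∑ k, (1 / (-1 * (I / 2) - c k)) ^ 3
        + ∑ k, rootShift M (c k) * (1 / (1 * (I / 2) - c k)) ^ 2
        - ∑ k, rootShift M (c k) * (1 / (-1 * (I / 2) - c k)) ^ 2) := by
    rw [← sum_sub_distrib, ← sum_add_distrib, ← sum_sub_distrib, mul_sum]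
    refine sum_congr rfl fun k _ => ?_
    rw [show c k - I / 2 = -(1 * (I / 2) - c k) by ring,
      show c k + I / 2 = -(-1 * (I / 2) - c k) by ring, inv_neg, inv_neg, one_div, one_div]
    ring
  rw [e, a3, a2, b3, b2, gammaFour_even]
  linear_combination (4 * (harm 3 M - 3 * harmNested M)
    + 4 * (2 * harmNested M + 2 * harm 1 M * harm 2 M)) * I_sq

end RootData

end Roots

/-! ### Existence of ground states, their expansion and anomalous dimension -/

section Main
open PowerSeries

theorem exists_groundState (M : ℕ) :
    ∃ u : Fin (M + M) → PowerSeries ℂ, IsTwistTwoGroundState (M + M) u := by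
  obtain ⟨c, hc⟩ := exists_roots M
  obtain ⟨p, h⟩ := exists_rootData hc
  obtain ⟨u, hu, hF⟩ := exists_solution_of_formalDiff (betheJacobian_det_ne_zero h.im_eq_zero)
    fun k => formalDiff_betheRatio h.im_eq_zero hc k
  refine ⟨u, (betheEquations_iff fun k => by rw [hu, h.im_eq_zero]).2 hF, ?_⟩
  simpa only [hu] using hc

/-- No expansion of the given solution is needed: an explicit truncation solves the equations modulo
`h³`, and uniqueness transfers its jet. In particular the order `h` term is zero. -/
theorem IsTwistTwoGroundState.exists_jet {M : ℕ} {u : Fin (M + M) → PowerSeries ℂ}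
    (hu : IsTwistTwoGroundState (M + M) u) :
    ∃ p, RootData M (fun k => constantCoeff (u k)) p ∧
      ∀ k, Jet (u k) (constantCoeff (u k)) (rootShift M (constantCoeff (u k))) := by
  obtain ⟨p, h⟩ := exists_rootData hu.baxter
  refine ⟨p, h, fun k => ?_⟩
  have hb := (betheEquations_iff h.im_eq_zero).1 hu.bethe
  -- The trial solution `c_k + h² η_k`.
  let v : Fin (M + M) → PowerSeries ℂ := fun k =>
    C (constantCoeff (u k)) + X ^ 2 * C (rootShift M (constantCoeff (u k)))
  have hv : ∀ k, Jet (v k) (constantCoeff (u k)) (rootShift M (constantCoeff (u k))) :=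
    fun k => ⟨0, by simp [v]⟩
  refine Jet.of_dvd (X_pow_dvd_sub_of_formalDiff (n := 2) (betheJacobian_det_ne_zero h.im_eq_zero)
    (fun k => formalDiff_betheRatio h.im_eq_zero hu.baxter k) (fun _ => rfl)
    (fun k => (hv k).constantCoeff_eq) (fun j => ?_) k) (hv k)
  have hj := (logJet_betheRatio hv h.im_eq_zero j).2
  rw [bethe_of_baxter h.im_eq_zero hu.baxter j, h.second_order_bethe j, mul_zero] at hj
  obtain ⟨w, hw⟩ := hj
  rw [hb j, hw]
  exact ⟨-w, by simp⟩

theorem IsTwistTwoGroundState.coeff_baxterPoly {M : ℕ} {u : Fin (M + M) → PowerSeries ℂ}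
    (hu : IsTwistTwoGroundState (M + M) u) : ∃ c : ℂ, ∀ z : ℂ,
      coeff 0 (baxterPoly c u z) = baxterQ0 (M + M) z ∧ coeff 1 (baxterPoly c u z) = 0 ∧
      coeff 2 (baxterPoly c u z) = baxterQ1 (M + M) z := by
  obtain ⟨p, h, hj⟩ := hu.exists_jet
  refine ⟨p, fun z => ?_⟩
  have := (Jet.const p).mul (Jet.prod univ fun k _ => (Jet.const z).sub (hj k))
  refine ⟨?_, this.coeff_one_eq, this.coeff_two_eq.trans ?_⟩
  · rw [coeff_zero_eq_constantCoeff_apply, baxterPoly, this.constantCoeff_eq, h.eq]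
  · rw [h.baxterQ1_eq_sum_prod, zero_mul, zero_add, ← mul_neg, ← sum_neg_distrib]
    congr 1
    exact sum_congr rfl fun k _ => by ring

theorem IsTwistTwoGroundState.coeff_gammaABA {M : ℕ} {u : Fin (M + M) → PowerSeries ℂ}
    (hu : IsTwistTwoGroundState (M + M) u) :
    coeff 4 (gammaABA u) = ((gammaFour (M + M) : ℚ) : ℂ) := by
  obtain ⟨p, h, hj⟩ := hu.exists_jet
  rw [coeff_four_gammaABA hj h.im_eq_zero, h.gamma_eq]

end Main

end ABJM

end

theorem mainTheorem1 :
    (∀ N : ℕ, Even N →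
      (∃ u : Fin N → PowerSeries ℂ, ABJM.IsTwistTwoGroundState N u) ∧
      (∀ u : Fin N → PowerSeries ℂ, ABJM.IsTwistTwoGroundState N u →
        PowerSeries.coeff 4 (ABJM.gammaABA u) = (ABJM.gammaFour N : ℂ) ∧
        ∃ c : ℂ, ∀ z : ℂ,
          PowerSeries.coeff 0 (ABJM.baxterPoly c u z) = ABJM.baxterQ0 N z ∧
          PowerSeries.coeff 1 (ABJM.baxterPoly c u z) = 0 ∧
          PowerSeries.coeff 2 (ABJM.baxterPoly c u z) = ABJM.baxterQ1 N z) ∧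
      (∀ z : ℂ, ABJM.baxterOp N (ABJM.baxterQ1 N) z = ABJM.baxterNLOSource N z)) ∧
    (∀ n : ℕ, ABJM.gammaFour (2 * n + 1) = ABJM.gammaFour (2 * n)) := by
  refine ⟨fun N hN => ?_, ABJM.gammaFour_odd⟩
  obtain ⟨M, rfl⟩ := hN
  exact ⟨ABJM.exists_groundState M, fun u hu => ⟨hu.coeff_gammaABA, hu.coeff_baxterPoly⟩,
    ABJM.baxterOp_baxterQ1 M⟩
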